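/- Let $\mathcal C^\gamma=B^\gamma_{\infty,\infty}(\mathbb R^d)$, $\gamma\in\mathbb R$, be the Besov space of real-valued tempered distributions $f$ with $\|f\|_\gamma=\sup_{j\ge 0}2^{\gamma j}\|(\phi_j\hat f)^\vee\|_{L^\infty}<\infty$. Here $\phi_0$ is a smooth real function on $\mathbb R^d$ with $\phi_0(x)=1$ for $|x|\le 1$ and $\phi_0(x)=0$ for $|x|\ge \frac32$, and $\phi_j(x)=\phi_0(2^{-j}x)-\phi_0(2^{-j+1}x)$ for $j\ge 1$. Assume: (A1) $F:\mathbb R^d\to\mathbb R$ is of class $C^1$ and its partial derivatives are Lipschitz with a common constant; (A2) $0<\alpha<1$, $\beta<0$ and $\max\{-\alpha,\alpha-1\}<\beta$; (A3) $0<T<\infty$ and $b\in L^\infty([0,T];\mathcal C^\beta)$; (A4) $F$ is globally Lipschitz. Let $\varepsilon>0$ satisfy $\alpha-1-\beta+2\varepsilon<0$, let $\nu>0$, and let $u_0\in\mathcal C^{\alpha+1+2\varepsilon+\nu}$. A mild solution on $[0,T]$ of $$\partial_t u=\Delta u+F(\nabla u)\,b,\qquad u(0)=u_0,$$ is a function $u\in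 C([0,T];\mathcal C^{\alpha+1})$ such that $$u(t)=P_tu_0+\int_0^tP_{t-s}\big(F(\nabla u(s))\,b(s)\big)\,ds\qquad\text{for all } t\in[0,T],$$ where $(P_t)_{t\ge0}$ is the heat semigroup generated by $\Delta$, the time integral is taken in the space of tempered distributions, and the product of $f=F(\nabla u(s))$ with $g=b(s)$ is Bony's product $fg=\lim_{N\to\infty}(S_Nf)(S_Ng)$ in the tempered distributions, with $S_Nf=\sum_{j\le N}(\phi_j\hat f)^\vee$. Then there exists a mild solution $u$ on $[0,T]$ that belongs to $C^\varepsilon([0,T];\mathcal C^{\alpha+1})$, that is, $$\sup_{0\le t\le T}\|u(t)\|_{\alpha+1}+\sup_{0\le s<t\le T}\frac{\|u(t)-u(s)\|_{\alpha+1}}{(t-s)^\varepsilon}<\infty,$$ and $u$ is the only mild solution in $C([0,T];\mathcal C^{\alpha+1})$. -/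

import Mathlib

open MeasureTheory Filter Set Topology
open scoped SchwartzMap ENNReal NNReal ContDiff LineDeriv

noncomputable section

namespace SingularPDE

/-- The Euclidean space `ℝ^d`. -/
abbrev Rd (d : ℕ) := EuclideanSpace ℝ (Fin d)

/-! ### Tempered distributions: real-valuedness, functions as distributions -/

/-- A tempered distribution is real-valued if it takes real values on real test functions. -/
def IsRealDistribution {d : ℕ} (f : 𝓢'(Rd d, ℂ)) : Prop :=
  ∀ ψ : 𝓢(Rd d, ℂ), (∀ x, (ψ x).im = 0) → (f ψ).im = 0

/-- The distribution `f` is given by integration against the function `g`. -/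
def IsGivenBy {d : ℕ} (f : 𝓢'(Rd d, ℂ)) (g : Rd d → ℂ) : Prop :=
  ∀ ψ : 𝓢(Rd d, ℂ), Integrable (fun x => ψ x * g x) ∧ f ψ = ∫ x, ψ x * g x

/-- The `L^∞` norm of a tempered distribution (`⊤` if it is not an `L^∞` function). The infimum
runs over the at most one class in `L^∞` that induces the distribution. -/
def linftyNorm {d : ℕ} (f : 𝓢'(Rd d, ℂ)) : ℝ≥0∞ :=
  ⨅ (g : Lp ℂ ∞ (volume : Measure (Rd d))) (_ : (g : 𝓢'(Rd d, ℂ)) = f), ‖g‖ₑ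

/-! ### Littlewood-Paley blocks and the spaces `𝓒^γ = B^γ_{∞,∞}` -/

/-- The zero-th element `φ₀` of a dyadic partition of unity. -/
structure DyadicCutoff (d : ℕ) where
  toFun : Rd d → ℝ
  smooth : ContDiff ℝ ∞ toFun
  eq_one : ∀ x, ‖x‖ ≤ 1 → toFun x = 1
  eq_zero : ∀ x, 3 / 2 ≤ ‖x‖ → toFun x = 0

/-- Such a cutoff exists. -/
instance (d : ℕ) : Nonempty (DyadicCutoff d) :=
  let f : ContDiffBump (0 : Rd d) := ⟨1, 3 / 2, by norm_num, by norm_num⟩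
  ⟨{ toFun := f
     smooth := f.contDiff
     eq_one := fun x hx => f.one_of_mem_closedBall (by simpa [f] using hx)
     eq_zero := fun x hx => f.zero_of_le_dist (by simpa [f] using hx) }⟩

/-- The dyadic partition of unity: `φ_j(x) = φ₀(2^{-j} x) - φ₀(2^{-j+1} x)` for `j ≥ 1`. -/
def DyadicCutoff.part {d : ℕ} (φ : DyadicCutoff d) : ℕ → Rd d → ℝ
  | 0 => φ.toFun
  | j + 1 => fun x => φ.toFun (((2 : ℝ) ^ (j + 1))⁻¹ • x) - φ.toFun (((2 : ℝ) ^ j)⁻¹ • x)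

theorem DyadicCutoff.toFun_temperate {d : ℕ} (φ : DyadicCutoff d) :
    φ.toFun.HasTemperateGrowth := by
  refine HasCompactSupport.hasTemperateGrowth ?_ φ.smooth
  refine HasCompactSupport.intro (isCompact_closedBall (0 : Rd d) (3 / 2)) fun x hx => ?_
  refine φ.eq_zero x ?_
  simp only [Metric.mem_closedBall, dist_zero_right, not_le] at hx
  exact hx.le

/-- The multipliers of the Littlewood-Paley blocks have temperate growth. -/
theorem DyadicCutoff.part_temperate {d : ℕ} (φ : DyadicCutoff d) (j : ℕ) :
    (fun ξ => (φ.part j ξ : ℂ)).HasTemperateGrowth := by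
  have h (c : ℝ) : (fun x : Rd d => φ.toFun (c • x)).HasTemperateGrowth :=
    φ.toFun_temperate.comp (c • ContinuousLinearMap.id ℝ (Rd d)).hasTemperateGrowth
  have h2 : (φ.part j).HasTemperateGrowth := by
    cases j with
    | zero => exact φ.toFun_temperate
    | succ j => exact (h _).sub (h _)
  exact Function.HasTemperateGrowth.comp Function.Complex.hasTemperateGrowth_ofReal h2

/-- The Littlewood-Paley block `(φ_j f̂)^∨`. -/
def block {d : ℕ} (φ : DyadicCutoff d) (j : ℕ) (f : 𝓢'(Rd d, ℂ)) : 𝓢'(Rd d, ℂ) :=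
  TemperedDistribution.fourierMultiplierCLM ℂ (fun ξ => (φ.part j ξ : ℂ)) f

/-- The Besov norm `‖f‖_γ = sup_j 2^{γ j} ‖(φ_j f̂)^∨‖_{L^∞}`, with values in `[0, ∞]`. -/
def besovNorm {d : ℕ} (φ : DyadicCutoff d) (γ : ℝ) (f : 𝓢'(Rd d, ℂ)) : ℝ≥0∞ :=
  ⨆ j : ℕ, ENNReal.ofReal ((2 : ℝ) ^ (γ * (j : ℝ))) * linftyNorm (block φ j f)

/-- `f ∈ 𝓒^γ`: a real-valued tempered distribution with `‖f‖_γ < ∞`. -/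
def MemBesov {d : ℕ} (φ : DyadicCutoff d) (γ : ℝ) (f : 𝓢'(Rd d, ℂ)) : Prop :=
  IsRealDistribution f ∧ besovNorm φ γ f < ⊤

/-! ### Spaces of functions of time with values in `𝓒^γ` -/

/-- `u ∈ C([0,T]; 𝓒^γ)`. -/
def MemContinuous {d : ℕ} (φ : DyadicCutoff d) (γ T : ℝ) (u : ℝ → 𝓢'(Rd d, ℂ)) : Prop :=
  (∀ t ∈ Icc 0 T, MemBesov φ γ (u t)) ∧
  ∀ t ∈ Icc 0 T, Tendsto (fun s => besovNorm φ γ (u s - u t)) (𝓝[Icc 0 T] t) (𝓝 0)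

/-- The norm `sup_t ‖u(t)‖_γ + sup_{s<t} ‖u(t) - u(s)‖_γ / (t - s)^ε` over `0 ≤ s < t ≤ T`. -/
def timeHolderNorm {d : ℕ} (φ : DyadicCutoff d) (ε γ T : ℝ) (u : ℝ → 𝓢'(Rd d, ℂ)) : ℝ≥0∞ :=
  (⨆ t ∈ Icc 0 T, besovNorm φ γ (u t)) +
  ⨆ (s ∈ Icc 0 T) (t ∈ Icc 0 T) (_ : s < t),
    besovNorm φ γ (u t - u s) / ENNReal.ofReal ((t - s) ^ ε)

/-- `u ∈ C^ε([0,T]; 𝓒^γ)`. -/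
def MemTimeHolder {d : ℕ} (φ : DyadicCutoff d) (ε γ T : ℝ) (u : ℝ → 𝓢'(Rd d, ℂ)) : Prop :=
  (∀ t ∈ Icc 0 T, MemBesov φ γ (u t)) ∧ timeHolderNorm φ ε γ T u < ⊤

/-- `b ∈ L^∞(0,T; 𝓒^γ)`: measurable in time (tested against Schwartz functions), with values in
`𝓒^γ` for almost every time, and with essentially bounded norm. -/
def MemLinfty {d : ℕ} (φ : DyadicCutoff d) (γ T : ℝ) (b : ℝ → 𝓢'(Rd d, ℂ)) : Prop :=
  (∀ ψ : 𝓢(Rd d, ℂ), AEMeasurable (fun s => b s ψ) (volume.restrict (Icc 0 T))) ∧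
  (∀ᵐ s ∂(volume.restrict (Icc 0 T)), MemBesov φ γ (b s)) ∧
  ∃ C : ℝ≥0, ∀ᵐ s ∂(volume.restrict (Icc 0 T)), besovNorm φ γ (b s) ≤ C

/-! ### Products, the non-linear term, the heat semigroup and mild solutions -/

/-- The partial Littlewood-Paley sum `S_N f = ∑_{j ≤ N} (φ_j f̂)^∨`. -/
def lowFreq {d : ℕ} (φ : DyadicCutoff d) (N : ℕ) (f : 𝓢'(Rd d, ℂ)) : 𝓢'(Rd d, ℂ) :=
  ∑ j ∈ Finset.range (N + 1), block φ j f

/-- `h` is the product `f g` of distributions in the sense of Bony,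
`f g = ∑_{j,k} (φ_j f̂)^∨ (φ_k ĝ)^∨ = lim_N (S_N f) (S_N g)` in the space of tempered distributions.
Here `S_N f` is a smooth function `a N` of temperate growth, and so multiplies `S_N g`. -/
def IsProduct {d : ℕ} (φ : DyadicCutoff d) (f g h : 𝓢'(Rd d, ℂ)) : Prop :=
  ∃ a : ℕ → Rd d → ℂ,
    (∀ N, (a N).HasTemperateGrowth ∧ IsGivenBy (lowFreq φ N f) (a N)) ∧
    Tendsto (fun N => TemperedDistribution.smulLeftCLM ℂ (a N) (lowFreq φ N g)) atTop (𝓝 h)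

/-- `h = F(∇w) b`: the distributional gradient of `w` is a continuous function `v : ℝ^d → ℝ^d`,
the composition `F ∘ v` defines a distribution `f`, and `h` is the product `f b`. -/
def IsNonlinearTerm {d : ℕ} (φ : DyadicCutoff d) (F : Rd d → ℝ) (w b h : 𝓢'(Rd d, ℂ)) : Prop :=
  ∃ (v : Rd d → Rd d) (f : 𝓢'(Rd d, ℂ)),
    Continuous v ∧
    (∀ i : Fin d, IsGivenBy (∂_{(EuclideanSpace.single i (1 : ℝ) : Rd d)} w)
      (fun x => ((v x i : ℝ) : ℂ))) ∧
    IsGivenBy f (fun x => (F (v x) : ℂ)) ∧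
    IsProduct φ f b h

/-- The heat semigroup `P_t = e^{tΔ}` on tempered distributions, `t ≥ 0`. With the Fourier transform
`f̂(ξ) = ∫ f(x) e^{-2πi x·ξ} dx` it is the multiplier `e^{-4π² t |ξ|²}`. -/
def heat {d : ℕ} (t : ℝ) (f : 𝓢'(Rd d, ℂ)) : 𝓢'(Rd d, ℂ) :=
  TemperedDistribution.fourierMultiplierCLM ℂ
    (fun ξ => (Real.exp (-(4 * Real.pi ^ 2 * t * ‖ξ‖ ^ 2)) : ℂ)) f

/-- The multiplier of the heat semigroup has temperate growth. -/
theorem heat_symbol_temperate {d : ℕ} {t : ℝ} (ht : 0 ≤ t) :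
    (fun ξ : Rd d =>
      (Real.exp (-(4 * Real.pi ^ 2 * t * ‖ξ‖ ^ 2)) : ℂ)).HasTemperateGrowth := by
  set c : ℝ := -(4 * Real.pi ^ 2 * t)
  have hc : c ≤ 0 := by
    have : 0 ≤ 4 * Real.pi ^ 2 * t := by positivity
    simp only [c]; linarith
  have hsm : ContDiff ℝ ∞ (fun r : ℝ => Real.exp (c * r)) := by fun_prop
  have key : ((fun r : ℝ => Real.exp (c * r)) ∘
      (fun ξ : Rd d => ‖ξ‖ ^ 2)).HasTemperateGrowth := by
    refine Function.HasTemperateGrowth.comp' (t := Ici 0) ?_ (uniqueDiffOn_Ici 0)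
      hsm.contDiffOn ?_ (Function.hasTemperateGrowth_norm_sq _)
    · rintro _ ⟨x, rfl⟩
      exact sq_nonneg ‖x‖
    · intro N
      refine ⟨0, (1 + |c|) ^ N, by positivity, fun n hn r hr => ?_⟩
      rw [norm_iteratedFDerivWithin_eq_norm_iteratedDerivWithin,
        iteratedDerivWithin_eq_iteratedDeriv (uniqueDiffOn_Ici 0)
          ((hsm.of_le (by exact_mod_cast le_top)).contDiffAt) hr, iteratedDeriv_exp_const_mul]
      have h1 : Real.exp (c * r) ≤ 1 :=
        Real.exp_le_one_iff.mpr (mul_nonpos_of_nonpos_of_nonneg hc (mem_Ici.mp hr))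
      have h2 : |c| ^ n ≤ (1 + |c|) ^ N :=
        (pow_le_pow_left₀ (abs_nonneg c) (by linarith) n).trans
          (pow_le_pow_right₀ (by linarith [abs_nonneg c]) hn)
      rw [Real.norm_eq_abs, abs_mul, abs_pow, Real.abs_exp, pow_zero, mul_one]
      calc |c| ^ n * Real.exp (c * r) ≤ |c| ^ n * 1 := by gcongr
        _ ≤ _ := by simpa using h2
  have := Function.HasTemperateGrowth.comp Function.Complex.hasTemperateGrowth_ofReal key
  have h0 : (fun ξ : Rd d => (Real.exp (-(4 * Real.pi ^ 2 * t * ‖ξ‖ ^ 2)) : ℂ)) =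
      Complex.ofReal ∘ ((fun r : ℝ => Real.exp (c * r)) ∘ (fun ξ : Rd d => ‖ξ‖ ^ 2)) := by
    ext ξ
    simp [c, neg_mul]
  rw [h0]
  exact this

/-- `u ∈ C([0,T]; 𝓒^γ)` is a mild solution on `[0,T]` of `∂_t u = Δu + F(∇u) b`, `u(0) = u₀`, i.e.
`u(t) = P_t u₀ + ∫₀ᵗ P_{t-s}(F(∇u(s)) b(s)) ds` for all `t ∈ [0,T]`. The time integral is that of a
function with values in the tempered distributions. -/
def IsMildSolution {d : ℕ} (φ : DyadicCutoff d) (F : Rd d → ℝ) (γ T : ℝ)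
    (b : ℝ → 𝓢'(Rd d, ℂ)) (u₀ : 𝓢'(Rd d, ℂ)) (u : ℝ → 𝓢'(Rd d, ℂ)) : Prop :=
  MemContinuous φ γ T u ∧
  ∃ G : ℝ → 𝓢'(Rd d, ℂ),
    (∀ᵐ s ∂(volume.restrict (Icc 0 T)), IsNonlinearTerm φ F (u s) (b s) (G s)) ∧
    ∀ t ∈ Icc 0 T, ∀ ψ : 𝓢(Rd d, ℂ),
      IntervalIntegrable (fun s => heat (t - s) (G s) ψ) volume 0 t ∧
      u t ψ = heat t u₀ ψ + ∫ s in (0 : ℝ)..t, heat (t - s) (G s) ψ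

end SingularPDE

end

open SingularPDE

noncomputable section

namespace SingularPDE
open FourierTransform

/-! ### Fourier multipliers on Schwartz functions and their `L¹` kernel estimates -/

variable {d : ℕ} {φ : DyadicCutoff d}

/-! The solution is a fixed point of Picard's map in `𝓒^{α+1}`. If `u(s) ∈ 𝓒^{α+1}`, then `∇u(s)` is
bounded and `α`-Hölder, hence so is `F(∇u(s))`. Since `α + β > 0`, its product with `b(s) ∈ 𝓒^β`
exists and stays in `𝓒^β`. The heat semigroup then gains `2θ = α + 1 - β` derivatives at the price
`(t-s)^{-θ}`, which is integrable because `β > α - 1` means `θ < 1`. The integral is therefore again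
in `𝓒^{α+1}`.

Two features of the nonlinearity close the argument. Because `F` is Lipschitz, the norm of `F(∇u) b`
grows at most linearly in that of `u`. Because `DF` is Lipschitz as well, `u ↦ F(∇u) b` is Lipschitz
on bounded sets (`IsNonlinearTerm.hasBound_sub`). With time weights `e^{ρt}` the mass of the
singular kernel tends to zero as `ρ → ∞` (`tendsto_wt`). A first weight `ρ` makes a ball invariant
(`IsSetting.exists_step`); its radius bounds the local Lipschitz constant, and a second weight `σ`
makes the map contract there (`IsSetting.contraction`). This gives existence on all of `[0,T]`, and
the same contraction gives uniqueness. Time regularity `ε` comes from `u(t) - u(s) = ∫_s^t P_{t-r}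
G(r) dr + (P_{t-s} - 1) u(s)`, with `u(s)` bounded in `𝓒^{α+1+2ε}`.

All estimates are made by duality on test functions. By `besovNorm_le_iff`, `‖f‖_γ ≤ A` says that
`|f(Δ_j ψ)| ≤ A 2^{-γj} ‖ψ‖_{L¹}`, where `Δ_j` is the transposed block. Every bound then reduces to
an `L¹` estimate of a convolution: of its size, of its `L¹` modulus of continuity, or of its
smallness on functions with such a modulus. In particular the product estimate `HasBound.smul` needs
no paraproducts: the Hölder factor multiplies the test function, and only its effect on the `L¹`
modulus matters. Time integrals are likewise estimated against one test function at a time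
(`HasBound.integral`), so measurability is needed only for scalar functions. -/

/-- The transpose of the Fourier multiplier with symbol `m`, acting on Schwartz functions. -/
def mult (m : Rd d → ℂ) : 𝓢(Rd d, ℂ) →L[ℂ] 𝓢(Rd d, ℂ) :=
  fourierCLM ℂ 𝓢(Rd d, ℂ) ∘L SchwartzMap.smulLeftCLM ℂ m ∘L fourierInvCLM ℂ 𝓢(Rd d, ℂ)

theorem mult_eq (m : Rd d → ℂ) (ψ : 𝓢(Rd d, ℂ)) :
    mult m ψ = 𝓕 (SchwartzMap.smulLeftCLM ℂ m (𝓕⁻ ψ)) := rfl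

theorem fourierMultiplier_apply (m : Rd d → ℂ) (f : 𝓢'(Rd d, ℂ)) (ψ : 𝓢(Rd d, ℂ)) :
    TemperedDistribution.fourierMultiplierCLM ℂ m f ψ = f (mult m ψ) := rfl

theorem mult_mult {m n : Rd d → ℂ} (hm : m.HasTemperateGrowth) (hn : n.HasTemperateGrowth)
    (ψ : 𝓢(Rd d, ℂ)) : mult m (mult n ψ) = mult (m * n) ψ := by
  simp [mult_eq, SchwartzMap.smulLeftCLM_smulLeftCLM_apply hm hn]

theorem mult_comm {m n : Rd d → ℂ} (hm : m.HasTemperateGrowth) (hn : n.HasTemperateGrowth)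
    (ψ : 𝓢(Rd d, ℂ)) : mult m (mult n ψ) = mult n (mult m ψ) := by
  rw [mult_mult hm hn, mult_mult hn hm, mul_comm]

theorem mult_sub {m n : Rd d → ℂ} (hm : m.HasTemperateGrowth) (hn : n.HasTemperateGrowth)
    (ψ : 𝓢(Rd d, ℂ)) : mult (m - n) ψ = mult m ψ - mult n ψ := by
  simp only [mult_eq, SchwartzMap.smulLeftCLM_sub hm hn, sub_apply]
  exact map_sub (fourierCLM ℂ 𝓢(Rd d, ℂ)) _ _

/-- The Fourier transform of a Schwartz function. -/
abbrev ft (s : 𝓢(Rd d, ℂ)) : 𝓢(Rd d, ℂ) := 𝓕 s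

/-- The dilation `ξ ↦ s (r ξ)` of a Schwartz function. -/
abbrev dil (s : 𝓢(Rd d, ℂ)) (r : ℝ) : Rd d → ℂ := fun ξ => s (r • ξ)

theorem dil_temperate (s : 𝓢(Rd d, ℂ)) (r : ℝ) : (dil s r).HasTemperateGrowth :=
  s.hasTemperateGrowth.comp (r • ContinuousLinearMap.id ℝ (Rd d)).hasTemperateGrowth

/-- The multiplication formula for the Fourier transform, with the pairing `-r⟨ξ, y⟩`. Keeping the
scale in the argument of `ψ` and not in the kernel avoids a change of variables, so `r = 0` is
allowed. -/
theorem mult_dil_apply (s ψ : 𝓢(Rd d, ℂ)) (r : ℝ) (x : Rd d) :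
    mult (dil s r) ψ x = ∫ y, ft s y * ψ (x - r • y) := by
  set h : 𝓢(Rd d, ℂ) := 𝓕⁻ ψ with hh
  have hψ : ψ = 𝓕 h := by simp [hh]
  set L : Rd d →ₗ[ℝ] Rd d →ₗ[ℝ] ℝ := (-r) • (innerₗ (Rd d)) with hLdef
  have hL : Continuous fun p : Rd d × Rd d => L p.1 p.2 := by
    simp only [hLdef, LinearMap.smul_apply, innerₗ_apply_apply]
    fun_prop
  let f : Rd d → ℂ := fun ξ => Real.fourierChar (-(inner ℝ ξ x)) • h ξ
  have hf : Integrable f := by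
    have := (VectorFourier.fourierIntegral_convergent_iff (E := ℂ) (μ := (volume : Measure (Rd d)))
      Real.continuous_fourierChar (L := innerₗ (Rd d)) (by simp only [innerₗ_apply_apply]; fun_prop)
      (f := h) x).2 h.integrable
    simpa [f, innerₗ_apply_apply] using this
  have key := VectorFourier.integral_fourierIntegral_smul_eq_flip (F := ℂ)
    Real.continuous_fourierChar hL hf ((ft s).integrable (μ := volume))
  have h1 : ∀ y, VectorFourier.fourierIntegral Real.fourierChar volume L f y
      = ψ (x - r • y) := by
    intro y
    rw [hψ, SchwartzMap.fourier_coe, Real.fourier_eq]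
    simp only [VectorFourier.fourierIntegral]
    refine integral_congr_ae (ae_of_all _ fun ξ => ?_)
    simp only [f, hLdef, LinearMap.smul_apply, innerₗ_apply_apply, smul_smul, inner_sub_right,
      inner_smul_right]
    rw [← AddChar.map_add_eq_mul]
    congr 2
    simp; ring
  have h2 : ∀ ξ, VectorFourier.fourierIntegral Real.fourierChar volume L.flip (ft s) ξ
      = s (r • ξ) := by
    intro ξ
    have : s (r • ξ) = 𝓕⁻ (ft s) (r • ξ) := by simp [ft]
    rw [this, SchwartzMap.fourierInv_coe, Real.fourierInv_eq]
    simp only [VectorFourier.fourierIntegral]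
    refine integral_congr_ae (ae_of_all _ fun y => ?_)
    simp [hLdef, innerₗ_apply_apply, inner_smul_right, real_inner_comm]
  simp only [h1, h2, smul_eq_mul] at key
  rw [mult_eq, SchwartzMap.fourier_coe, Real.fourier_eq]
  calc _ = ∫ ξ, f ξ * s (r • ξ) := by
        refine integral_congr_ae (ae_of_all _ fun ξ => ?_)
        simp only [f]
        rw [SchwartzMap.smulLeftCLM_apply_apply (dil_temperate s r)]
        simp only [smul_eq_mul, Circle.smul_def, dil, ← hh]
        ring
    _ = _ := by rw [← key]; exact integral_congr_ae (ae_of_all _ fun y => mul_comm _ _)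

theorem integral_fourier (s : 𝓢(Rd d, ℂ)) : ∫ y, ft s y = s 0 := by
  have : s 0 = 𝓕⁻ (ft s) 0 := by simp [ft]
  rw [this, SchwartzMap.fourierInv_coe, Real.fourierInv_eq]
  simp

/-- Minkowski's inequality for integrals, with a Schwartz kernel. -/
theorem integral_norm_integral_le (k : 𝓢(Rd d, ℂ)) {H : Rd d → Rd d → ℂ}
    (hH : Continuous (Function.uncurry H)) (hHi : ∀ y, Integrable fun x => H x y)
    {w : Rd d → ℝ} (hw : ∀ y, ∫ x, ‖H x y‖ ≤ w y) (hi : Integrable fun y => ‖k y‖ * w y) :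
    ∫ x, ‖∫ y, k y * H x y‖ ≤ ∫ y, ‖k y‖ * w y := by
  have hw0 : ∀ y, 0 ≤ w y := fun y => (integral_nonneg fun _ => norm_nonneg _).trans (hw y)
  have hc : Continuous (Function.uncurry fun x y => k y * H x y) :=
    (k.continuous.comp continuous_snd).mul hH
  have h0 : 0 ≤ ∫ y, ‖k y‖ * w y := integral_nonneg fun y => mul_nonneg (norm_nonneg _) (hw0 y)
  rw [integral_norm_eq_lintegral_enorm]
  swap
  · exact (hc.stronglyMeasurable.integral_prod_right (ν := volume)).aestronglyMeasurable
  refine ENNReal.toReal_le_of_le_ofReal h0 ?_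
  calc ∫⁻ x, ‖∫ y, k y * H x y‖ₑ ≤ ∫⁻ x, ∫⁻ y, ‖k y * H x y‖ₑ :=
        lintegral_mono fun x => enorm_integral_le_lintegral_enorm _
    _ = ∫⁻ y, ∫⁻ x, ‖k y * H x y‖ₑ :=
        lintegral_lintegral_swap hc.enorm.measurable.aemeasurable
    _ ≤ ∫⁻ y, ENNReal.ofReal (‖k y‖ * w y) := by
        refine lintegral_mono fun y => ?_
        simp only [enorm_mul]
        rw [lintegral_const_mul' _ _ (by simp), ENNReal.ofReal_mul (norm_nonneg _), ofReal_norm]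
        gcongr
        rw [← ofReal_integral_norm_eq_lintegral_enorm (hHi y)]
        exact ENNReal.ofReal_le_ofReal (hw y)
    _ = _ := (ofReal_integral_eq_lintegral_ofReal hi
        (ae_of_all _ fun y => mul_nonneg (norm_nonneg _) (hw0 y))).symm

/-- The `L¹` norm. -/
def l1 (f : Rd d → ℂ) : ℝ := ∫ x, ‖f x‖

theorem l1_nonneg (f : Rd d → ℂ) : 0 ≤ l1 f := integral_nonneg fun _ => norm_nonneg _

theorem l1_add_le {f g : Rd d → ℂ} (hf : Integrable f) (hg : Integrable g) :
    l1 (fun x => f x + g x) ≤ l1 f + l1 g := by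
  rw [l1, l1, l1, ← integral_add hf.norm hg.norm]
  exact integral_mono (hf.add hg).norm (hf.norm.add hg.norm) fun x => norm_add_le _ _

theorem l1_comp_sub (f : Rd d → ℂ) (y : Rd d) : l1 (fun x => f (x - y)) = l1 f :=
  integral_sub_right_eq_self (fun x => ‖f x‖) y

theorem l1_mult_dil_le (s ψ : 𝓢(Rd d, ℂ)) (r : ℝ) :
    l1 (mult (dil s r) ψ) ≤ l1 (ft s) * l1 ψ := by
  have := integral_norm_integral_le (ft s) (H := fun x y => ψ (x - r • y))
    (by unfold Function.uncurry; exact ψ.continuous.comp (by fun_prop))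
    (fun y => ψ.integrable.comp_sub_right _)
    (w := fun _ => l1 ψ) (fun y => (l1_comp_sub ψ (r • y)).le)
    ((ft s).integrable.norm.mul_const _)
  simp only [← mult_dil_apply] at this
  refine this.trans ?_
  rw [integral_mul_const]; rfl

/-- `h` has the `L¹` modulus of continuity `N |y|^a`. -/
def HasModulus (a N : ℝ) (h : Rd d → ℂ) : Prop :=
  ∀ y, l1 (fun x => h (x - y) - h x) ≤ N * ‖y‖ ^ a

theorem integrable_norm_mul_rpow (k : 𝓢(Rd d, ℂ)) {a : ℝ} (ha : 0 ≤ a) (ha1 : a ≤ 1) :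
    Integrable fun y => ‖k y‖ * ‖y‖ ^ a := by
  have h1 : Integrable fun y => ‖k y‖ + ‖y‖ * ‖k y‖ := by
    have := k.integrable_pow_mul volume 1
    simp only [pow_one] at this
    exact k.integrable.norm.add this
  refine h1.mono' ?_ (ae_of_all _ fun y => ?_)
  · exact (k.continuous.norm.mul
      (continuous_norm.rpow_const fun _ => Or.inr ha)).aestronglyMeasurable
  · have : ‖y‖ ^ a ≤ 1 + ‖y‖ := by
      rcases le_total ‖y‖ 1 with h | h
      · have := Real.rpow_le_one (norm_nonneg y) h ha
        linarith [norm_nonneg y]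
      · calc ‖y‖ ^ a ≤ ‖y‖ ^ (1 : ℝ) := Real.rpow_le_rpow_of_exponent_le h ha1
          _ ≤ _ := by rw [Real.rpow_one]; linarith
    rw [Real.norm_of_nonneg (by positivity)]
    nlinarith [norm_nonneg (k y)]

/-- The moment `∫ |ft s (y)| |y|^a dy`. -/
def moment (a : ℝ) (s : 𝓢(Rd d, ℂ)) : ℝ := ∫ y, ‖ft s y‖ * ‖y‖ ^ a

theorem moment_nonneg (a : ℝ) (s : 𝓢(Rd d, ℂ)) : 0 ≤ moment a s :=
  integral_nonneg fun _ => by positivity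

/-- Since the integral of the kernel `ft s` is `s 0`, the difference is an average of increments of
`ψ`. It serves twice: with `s 0 = 0` it shows that frequency blocks of a regular function are small,
and with the Gaussian, where `s 0 = 1`, it measures the heat semigroup against the identity. -/
theorem l1_mult_dil_sub_le (s ψ : 𝓢(Rd d, ℂ)) {r a N : ℝ} (hr : 0 ≤ r) (ha : 0 ≤ a) (ha1 : a ≤ 1)
    (hN : HasModulus a N ψ) :
    l1 (fun x => mult (dil s r) ψ x - s 0 * ψ x) ≤ moment a s * r ^ a * N := by
  have h1 : ∀ x, mult (dil s r) ψ x - s 0 * ψ x = ∫ y, ft s y * (ψ (x - r • y) - ψ x) := by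
    intro x
    simp only [mul_sub]
    rw [mult_dil_apply, integral_sub, integral_mul_const, integral_fourier]
    · exact (ft s).integrable.mul_bdd (c := SchwartzMap.seminorm ℝ 0 0 ψ)
        ((ψ.continuous.comp (by fun_prop)).aestronglyMeasurable)
        (ae_of_all _ fun y => SchwartzMap.norm_le_seminorm ℝ ψ _)
    · exact (ft s).integrable.mul_const _
  have hi := integrable_norm_mul_rpow (ft s) ha ha1
  have := integral_norm_integral_le (ft s) (H := fun x y => ψ (x - r • y) - ψ x)
    (by unfold Function.uncurry
        exact (ψ.continuous.comp (by fun_prop)).sub (ψ.continuous.comp (by fun_prop)))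
    (fun y => (ψ.integrable.comp_sub_right _).sub ψ.integrable)
    (w := fun y => ‖y‖ ^ a * (r ^ a * N)) (fun y => by
      refine (hN (r • y)).trans (le_of_eq ?_)
      rw [norm_smul, Real.mul_rpow (norm_nonneg _) (norm_nonneg _), Real.norm_of_nonneg hr]; ring)
    (by simpa only [mul_assoc] using hi.mul_const (r ^ a * N))
  rw [l1]
  simp only [h1]
  refine this.trans (le_of_eq ?_)
  simp only [← mul_assoc]
  rw [integral_mul_const, integral_mul_const]; rfl

/-- An integrated form of the mean value inequality. -/
theorem hasModulus_fderiv (k : 𝓢(Rd d, ℂ)) : HasModulus 1 (∫ x, ‖fderiv ℝ k x‖) k := by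
  intro w
  have hdc : Continuous (fderiv ℝ k) := (k.smooth 1).continuous_fderiv (by simp)
  have hdi : Integrable fun x => ‖fderiv ℝ k x‖ :=
    ((SchwartzMap.fderivCLM ℝ (Rd d) ℂ k).integrable (μ := volume)).norm
  have h1 : ∀ x, ‖k (x - w) - k x‖ₑ ≤
      ∫⁻ t in Ioc (0 : ℝ) 1, ‖fderiv ℝ k (x - t • w)‖ₑ * ‖w‖ₑ := by
    intro x
    have hd : ∀ t : ℝ, HasDerivAt (fun t : ℝ => k (x - t • w))
        (fderiv ℝ k (x - t • w) (-w)) t := by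
      intro t
      have h2 : HasDerivAt (fun t : ℝ => x - t • w) (-w) t := by
        simpa using ((hasDerivAt_id t).smul_const w).const_sub x
      exact (k.differentiable _).hasFDerivAt.comp_hasDerivAt t h2
    have hc : Continuous fun t : ℝ => fderiv ℝ k (x - t • w) (-w) :=
      (hdc.comp (by fun_prop)).clm_apply continuous_const
    have h3 := intervalIntegral.integral_eq_sub_of_hasDerivAt (a := 0) (b := 1)
      (fun t _ => hd t) (hc.intervalIntegrable _ _)
    simp only [one_smul, zero_smul, sub_zero] at h3
    rw [← h3, intervalIntegral.integral_of_le zero_le_one]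
    refine (enorm_integral_le_lintegral_enorm _).trans (lintegral_mono fun t => ?_)
    rw [← enorm_neg w, ← ofReal_norm, ← ofReal_norm, ← ofReal_norm,
      ← ENNReal.ofReal_mul (norm_nonneg _)]
    exact ENNReal.ofReal_le_ofReal (ContinuousLinearMap.le_opNorm _ _)
  have hc : Continuous fun x => k (x - w) - k x :=
    (k.continuous.comp (by fun_prop)).sub k.continuous
  rw [Real.rpow_one, l1, integral_norm_eq_lintegral_enorm hc.aestronglyMeasurable]
  refine ENNReal.toReal_le_of_le_ofReal
    (mul_nonneg (integral_nonneg fun _ => norm_nonneg _) (norm_nonneg _)) ?_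
  calc ∫⁻ x, ‖k (x - w) - k x‖ₑ
      ≤ ∫⁻ x, ∫⁻ t in Ioc (0 : ℝ) 1, ‖fderiv ℝ k (x - t • w)‖ₑ * ‖w‖ₑ := lintegral_mono h1
    _ = ∫⁻ t in Ioc (0 : ℝ) 1, ∫⁻ x, ‖fderiv ℝ k (x - t • w)‖ₑ * ‖w‖ₑ := by
        refine lintegral_lintegral_swap (Continuous.aemeasurable ?_)
        unfold Function.uncurry
        exact ENNReal.continuous_mul_const (by simp) |>.comp
          ((hdc.comp (by fun_prop)).enorm)
    _ = ∫⁻ t in Ioc (0 : ℝ) 1, ENNReal.ofReal ((∫ x, ‖fderiv ℝ k x‖) * ‖w‖) := by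
        refine lintegral_congr fun t => ?_
        rw [lintegral_mul_const' _ _ (by simp),
          lintegral_sub_right_eq_self (fun x => ‖fderiv ℝ k x‖ₑ) (t • w),
          ENNReal.ofReal_mul (integral_nonneg fun _ => norm_nonneg _), ofReal_norm,
          ofReal_integral_norm_eq_lintegral_enorm]
        exact (SchwartzMap.fderivCLM ℝ (Rd d) ℂ k).integrable (μ := volume)
    _ = _ := by simp

/-- A constant such that `k` has all the moduli `C |y|^a`, `0 ≤ a ≤ 1`. -/
def w11 (k : 𝓢(Rd d, ℂ)) : ℝ := 2 * l1 k + ∫ x, ‖fderiv ℝ k x‖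

theorem w11_nonneg (k : 𝓢(Rd d, ℂ)) : 0 ≤ w11 k :=
  add_nonneg (mul_nonneg zero_le_two (l1_nonneg _)) (integral_nonneg fun _ => norm_nonneg _)

theorem l1_sub_le {f g : Rd d → ℂ} (hf : Integrable f) (hg : Integrable g) :
    l1 (fun x => f x - g x) ≤ l1 f + l1 g := by
  have := l1_add_le hf hg.neg
  simpa [l1, sub_eq_add_neg] using this

/-- For `‖y‖ ≤ 1` the derivative controls the increment and `‖y‖ ≤ ‖y‖^a`; for `‖y‖ ≥ 1` the
triangle inequality suffices and `1 ≤ ‖y‖^a`. -/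
theorem hasModulus_w11 (k : 𝓢(Rd d, ℂ)) {a : ℝ} (ha : 0 ≤ a) (ha1 : a ≤ 1) :
    HasModulus a (w11 k) k := by
  intro w
  have hp : 0 ≤ ∫ x, ‖fderiv ℝ k x‖ := integral_nonneg fun _ => norm_nonneg _
  have hl := l1_nonneg k
  rcases le_total ‖w‖ 1 with h | h
  · have h1 := hasModulus_fderiv k w
    have h2 : ‖w‖ ^ (1 : ℝ) ≤ ‖w‖ ^ a := by
      rcases (norm_nonneg w).eq_or_lt with h0 | h0
      · rw [← h0, Real.zero_rpow one_ne_zero]; exact Real.rpow_nonneg le_rfl _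
      · exact Real.rpow_le_rpow_of_exponent_ge h0 h ha1
    refine h1.trans ?_
    rw [w11]
    have h3 : 0 ≤ ‖w‖ ^ (1 : ℝ) := Real.rpow_nonneg (norm_nonneg _) _
    gcongr
    linarith
  · have h1 := l1_sub_le (k.integrable.comp_sub_right w) (k.integrable (μ := volume))
    rw [l1_comp_sub] at h1
    have h2 : 1 ≤ ‖w‖ ^ a := Real.one_le_rpow h ha
    refine h1.trans ?_
    rw [w11]
    nlinarith

/-- A translation of the convolution by `y` can be moved to the kernel, where it becomes a
translation by `r⁻¹ y`. Only the `L¹` norm of `ψ` is then needed. -/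
theorem hasModulus_mult_dil (s ψ : 𝓢(Rd d, ℂ)) {r a : ℝ} (hr : 0 < r) (ha : 0 ≤ a) (ha1 : a ≤ 1) :
    HasModulus a (w11 (ft s) * r⁻¹ ^ a * l1 ψ) (mult (dil s r) ψ) := by
  intro y
  set k := SchwartzMap.compSubConstCLM ℂ (r⁻¹ • y) (ft s) - ft s with hk
  have hint : ∀ (k : 𝓢(Rd d, ℂ)) (x : Rd d), Integrable fun z => k z * ψ (x - r • z) := by
    intro k x
    exact k.integrable.mul_bdd (c := SchwartzMap.seminorm ℝ 0 0 ψ)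
        ((ψ.continuous.comp (by fun_prop)).aestronglyMeasurable)
        (ae_of_all _ fun y => SchwartzMap.norm_le_seminorm ℝ ψ _)
  have h1 : ∀ x, mult (dil s r) ψ (x - y) - mult (dil s r) ψ x
      = ∫ z, k z * ψ (x - r • z) := by
    intro x
    have h2 : mult (dil s r) ψ (x - y) = ∫ z, ft s (z - r⁻¹ • y) * ψ (x - r • z) := by
      rw [mult_dil_apply, ← integral_sub_right_eq_self _ (r⁻¹ • y)]
      refine integral_congr_ae (ae_of_all _ fun z => ?_)
      simp only [smul_sub, smul_smul, mul_inv_cancel₀ hr.ne', one_smul]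
      congr 2
      abel
    rw [h2, mult_dil_apply, ← integral_sub]
    · refine integral_congr_ae (ae_of_all _ fun z => ?_)
      simp [hk, sub_mul]
    · exact hint (SchwartzMap.compSubConstCLM ℂ (r⁻¹ • y) (ft s)) x
    · exact hint _ x
  have := integral_norm_integral_le k (H := fun x y => ψ (x - r • y))
    (by unfold Function.uncurry; exact ψ.continuous.comp (by fun_prop))
    (fun y => ψ.integrable.comp_sub_right _)
    (w := fun _ => l1 ψ) (fun y => (l1_comp_sub ψ (r • y)).le)
    (k.integrable.norm.mul_const _)
  rw [l1]
  simp only [h1]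
  refine this.trans ?_
  rw [integral_mul_const]
  have h4 := hasModulus_w11 (ft s) ha ha1 (r⁻¹ • y)
  rw [norm_smul, Real.mul_rpow (norm_nonneg _) (norm_nonneg _),
    Real.norm_of_nonneg (inv_nonneg.2 hr.le)] at h4
  have h5 : ∫ z, ‖k z‖ = l1 (fun x => ft s (x - r⁻¹ • y) - ft s x) := by
    simp [l1, hk]
  rw [h5]
  calc _ ≤ w11 (ft s) * (r⁻¹ ^ a * ‖y‖ ^ a) * l1 ψ := by
        gcongr
        exact l1_nonneg _
    _ = _ := by ring

theorem mult_dil_comp_sub (s ψ : 𝓢(Rd d, ℂ)) (r : ℝ) (y : Rd d) :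
    mult (dil s r) (SchwartzMap.compSubConstCLM ℂ y ψ) =
      SchwartzMap.compSubConstCLM ℂ y (mult (dil s r) ψ) := by
  ext x
  rw [SchwartzMap.compSubConstCLM_apply, mult_dil_apply, mult_dil_apply]
  simp [sub_right_comm]

/-- The symbol of the derivative, times a Schwartz function. -/
def derivSymbol (e : Rd d) (s : 𝓢(Rd d, ℂ)) : 𝓢(Rd d, ℂ) :=
  -(2 * Real.pi * Complex.I) • SchwartzMap.smulLeftCLM ℂ (inner ℝ · e) s

/-- The derivative multiplies the symbol by a linear function of `ξ = r⁻¹ (r ξ)`, which is absorbed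
into the profile at the cost of `r⁻¹`. This is the source of Bernstein's inequality. -/
theorem lineDeriv_mult_dil (e : Rd d) (s ψ : 𝓢(Rd d, ℂ)) {r : ℝ} (hr : 0 < r) :
    ∂_{e} (mult (dil s r) ψ) = (r⁻¹ : ℂ) • mult (dil (derivSymbol e s) r) ψ := by
  have hin : (fun x : Rd d => inner ℝ x e).HasTemperateGrowth := by fun_prop
  rw [mult_eq, mult_eq, SchwartzMap.lineDerivOp_fourier_eq, ← FourierTransform.fourier_smul]
  congr 1
  ext x
  simp only [smul_apply, smul_eq_mul]
  rw [SchwartzMap.smulLeftCLM_apply_apply hin, SchwartzMap.smulLeftCLM_apply_apply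
    (dil_temperate s r), SchwartzMap.smulLeftCLM_apply_apply (dil_temperate _ r)]
  simp only [dil, derivSymbol, smul_apply, smul_eq_mul]
  rw [SchwartzMap.smulLeftCLM_apply_apply hin]
  have : (r : ℂ) ≠ 0 := by exact_mod_cast hr.ne'
  simp only [inner_smul_left, Complex.real_smul]
  push_cast
  simp only [conj_trivial]
  field_simp

/-- Multiplication by `s (r x)` tends to multiplication by `s 0` on Schwartz functions. -/
theorem tendsto_smulLeft_dil (s g : 𝓢(Rd d, ℂ)) :
    Tendsto (fun r => SchwartzMap.smulLeftCLM ℂ (dil s r) g) (𝓝[≥] 0) (𝓝 (s 0 • g)) := by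
  rw [(schwartz_withSeminorms ℝ (Rd d) ℂ).tendsto_nhds _ _]
  rintro ⟨k, n⟩ ε hε
  simp only [SchwartzMap.schwartzSeminormFamily_apply]
  set S : ℕ → ℝ := fun i => SchwartzMap.seminorm ℝ 0 i s with hS
  set G : ℝ := ∑ i ∈ Finset.range (n + 1), (n.choose i : ℝ) * (S i + S 1) *
    (SchwartzMap.seminorm ℝ k (n - i) g + SchwartzMap.seminorm ℝ (k + 1) (n - i) g) with hG
  have hS0 : ∀ i, 0 ≤ S i := fun i => apply_nonneg _ _
  have hsn : ∀ a b, 0 ≤ SchwartzMap.seminorm ℝ a b g := fun a b => apply_nonneg _ _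
  have hG0 : 0 ≤ G := Finset.sum_nonneg fun i _ => mul_nonneg
    (mul_nonneg (by positivity) (add_nonneg (hS0 _) (hS0 _))) (add_nonneg (hsn _ _) (hsn _ _))
  -- One factor `r` is always available: from the mean value inequality for `i = 0`, and from the
  -- chain rule with `r ^ i ≤ r` for `i ≥ 1`. The growth `1 + ‖x‖` is paid for by one more power in
  -- the seminorm of `g`.
  have hm : ∀ r ∈ Icc (0 : ℝ) 1, ∀ i x, ‖iteratedFDeriv ℝ i (fun x => s (r • x) - s 0) x‖
      ≤ r * ((S i + S 1) * (1 + ‖x‖)) := by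
    rintro r ⟨hr0, hr1⟩ i x
    rcases Nat.eq_zero_or_pos i with rfl | hi
    · rw [norm_iteratedFDeriv_zero]
      have h1 : ‖s (r • x) - s 0‖ ≤ S 1 * ‖r • x - 0‖ := by
        refine Convex.norm_image_sub_le_of_norm_fderiv_le (𝕜 := ℝ) (s := univ)
          (fun y _ => s.differentiableAt) (fun y _ => ?_) convex_univ (mem_univ _) (mem_univ _)
        rw [← norm_iteratedFDeriv_one]
        exact SchwartzMap.norm_iteratedFDeriv_le_seminorm ℝ s 1 y
      rw [sub_zero, norm_smul, Real.norm_of_nonneg hr0] at h1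
      calc _ ≤ r * (S 1 * ‖x‖) := by linarith
        _ ≤ _ := by
          gcongr
          · linarith [hS0 0]
          · linarith
    · have h1 : (fun x => s (r • x) - s 0) = (fun x => s (r • x)) - fun _ => s 0 := rfl
      have hc : ContDiff ℝ i fun x => s (r • x) := (s.smooth i).comp (by fun_prop)
      rw [h1, iteratedFDeriv_sub_apply hc.contDiffAt contDiff_const.contDiffAt,
        iteratedFDeriv_const_of_ne hi.ne', Pi.zero_apply, sub_zero,
        iteratedFDeriv_comp_const_smul r (s.smooth i), norm_smul, norm_pow, Real.norm_of_nonneg hr0]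
      have h2 := SchwartzMap.norm_iteratedFDeriv_le_seminorm ℝ s i (r • x)
      have h3 : r ^ i ≤ r := pow_le_of_le_one hr0 hr1 hi.ne'
      gcongr
      calc _ ≤ S i := h2
        _ ≤ (S i + S 1) * 1 := by linarith [hS0 1]
        _ ≤ _ := by
          have := add_nonneg (hS0 i) (hS0 1)
          gcongr
          linarith [norm_nonneg x]
  have key : ∀ r ∈ Icc (0 : ℝ) 1, SchwartzMap.seminorm ℝ k n
      (SchwartzMap.smulLeftCLM ℂ (dil s r) g - s 0 • g) ≤ r * G := by
    intro r hr
    refine SchwartzMap.seminorm_le_bound ℝ k n _ (mul_nonneg hr.1 hG0) fun x => ?_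
    have h1 : ⇑(SchwartzMap.smulLeftCLM ℂ (dil s r) g - s 0 • g)
        = fun x => (s (r • x) - s 0) * g x := by
      ext x
      simp [SchwartzMap.smulLeftCLM_apply_apply (dil_temperate s r), sub_mul, dil]
    rw [h1]
    have hc : ContDiff ℝ n fun x => s (r • x) - s 0 :=
      ((s.smooth n).comp (by fun_prop)).sub contDiff_const
    calc _ ≤ ‖x‖ ^ k * ∑ i ∈ Finset.range (n + 1), (n.choose i : ℝ) *
          ‖iteratedFDeriv ℝ i (fun x => s (r • x) - s 0) x‖ * ‖iteratedFDeriv ℝ (n - i) g x‖ := by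
          gcongr
          exact norm_iteratedFDeriv_mul_le hc (g.smooth n) x le_rfl
      _ ≤ _ := by
          rw [hG, Finset.mul_sum, Finset.mul_sum]
          refine Finset.sum_le_sum fun i _ => ?_
          have h2 := SchwartzMap.le_seminorm ℝ k (n - i) g x
          have h3 := SchwartzMap.le_seminorm ℝ (k + 1) (n - i) g x
          calc _ ≤ ‖x‖ ^ k * ((n.choose i : ℝ) * (r * ((S i + S 1) * (1 + ‖x‖))) *
                ‖iteratedFDeriv ℝ (n - i) g x‖) := by
                gcongr
                exact hm r hr i x
            _ = r * ((n.choose i : ℝ) * (S i + S 1) *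
                (‖x‖ ^ k * ‖iteratedFDeriv ℝ (n - i) g x‖ +
                  ‖x‖ ^ (k + 1) * ‖iteratedFDeriv ℝ (n - i) g x‖)) := by ring
            _ ≤ _ := by
                have := add_nonneg (hS0 i) (hS0 1)
                have := hr.1
                gcongr
  have h4 : Tendsto (fun r : ℝ => r * G) (𝓝[≥] 0) (𝓝 0) := by
    have : Tendsto (fun r : ℝ => r * G) (𝓝 0) (𝓝 (0 * G)) := tendsto_id.mul_const G
    rw [zero_mul] at this
    exact this.mono_left nhdsWithin_le_nhds
  filter_upwards [h4.eventually_lt_const hε, Icc_mem_nhdsGE (zero_lt_one' ℝ)] with r h5 h6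
  exact (key r h6).trans_lt h5

theorem tendsto_mult_dil (s ψ : 𝓢(Rd d, ℂ)) :
    Tendsto (fun r => mult (dil s r) ψ) (𝓝[≥] 0) (𝓝 (s 0 • ψ)) := by
  have h := (fourierCLM ℂ 𝓢(Rd d, ℂ)).continuous.tendsto (s 0 • 𝓕⁻ ψ)
  have h2 := h.comp (tendsto_smulLeft_dil s (𝓕⁻ ψ))
  have h3 : fourierCLM ℂ 𝓢(Rd d, ℂ) (s 0 • 𝓕⁻ ψ) = s 0 • ψ := by
    rw [map_smul]; simp
  rw [h3] at h2
  exact h2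

/-! ### The Gaussian, the cutoff and mollifiers as Schwartz functions -/

theorem pow_mul_exp_neg_sq_bounded (M : ℕ) {c : ℝ} (hc : 0 < c) :
    ∃ C : ℝ, 0 ≤ C ∧ ∀ t : ℝ, 0 ≤ t → (1 + t) ^ M * Real.exp (-(c * t ^ 2)) ≤ C := by
  refine ⟨Real.exp c * (M.factorial * (2 / c) ^ M), by positivity, fun t ht => ?_⟩
  have h1 : (1 + t) ^ M ≤ ((1 + t) ^ 2) ^ M :=
    pow_le_pow_left₀ (by linarith) (by nlinarith) M
  -- Uses `(1 + t)² ≤ 2 (1 + t²)`; afterwards the power `((1 + t)²)^M` is compared with one term of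
  -- the exponential series.
  have h2 : Real.exp (-(c * t ^ 2)) ≤ Real.exp c * Real.exp (-(c / 2 * (1 + t) ^ 2)) := by
    rw [← Real.exp_add]
    refine Real.exp_le_exp.2 ?_
    nlinarith [mul_nonneg hc.le (sq_nonneg (t - 1))]
  have h3 := Real.pow_div_factorial_le_exp (c / 2 * (1 + t) ^ 2) (by positivity) M
  rw [div_le_iff₀ (by positivity), mul_pow] at h3
  have h4 : ((1 + t) ^ 2) ^ M * Real.exp (-(c / 2 * (1 + t) ^ 2)) ≤ M.factorial * (2 / c) ^ M := by
    rw [Real.exp_neg, ← div_eq_mul_inv, div_le_iff₀ (Real.exp_pos _)]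
    have h5 : (2 / c) ^ M * (c / 2) ^ M = 1 := by
      rw [← mul_pow]; field_simp; exact one_pow M
    calc ((1 + t) ^ 2) ^ M = (2 / c) ^ M * ((c / 2) ^ M * ((1 + t) ^ 2) ^ M) := by
          rw [← mul_assoc, h5, one_mul]
      _ ≤ (2 / c) ^ M * (Real.exp (c / 2 * (1 + t) ^ 2) * M.factorial) := by gcongr
      _ = _ := by ring
  calc _ ≤ ((1 + t) ^ 2) ^ M * (Real.exp c * Real.exp (-(c / 2 * (1 + t) ^ 2))) := by gcongr
    _ = Real.exp c * (((1 + t) ^ 2) ^ M * Real.exp (-(c / 2 * (1 + t) ^ 2))) := by ring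
    _ ≤ _ := by gcongr

theorem gaussian_smooth (c : ℝ) :
    ContDiff ℝ ∞ fun ξ : Rd d => Real.exp (-(c * ‖ξ‖ ^ 2)) := by
  have : ContDiff ℝ ∞ fun ξ : Rd d => ‖ξ‖ ^ 2 := contDiff_norm_sq ℝ
  fun_prop

/-- The Gaussian is an exponential composed with `‖ξ‖²`. Each derivative costs at most a polynomial
in `‖ξ‖` by the Faà di Bruno bound, and the exponential factor absorbs it. -/
theorem gaussian_decay {c : ℝ} (hc : 0 < c) (k n : ℕ) : ∃ C : ℝ, ∀ x : Rd d,
    ‖x‖ ^ k * ‖iteratedFDeriv ℝ n (fun ξ : Rd d => Real.exp (-(c * ‖ξ‖ ^ 2))) x‖ ≤ C := by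
  obtain ⟨k', C', hC', h⟩ :=
    (Function.hasTemperateGrowth_norm_sq (H := Rd d)).norm_iteratedFDeriv_le_uniform n
  obtain ⟨C, hC, hb⟩ := pow_mul_exp_neg_sq_bounded (k + k' * n) hc
  refine ⟨(n.factorial * (1 + c) ^ n * (1 + C') ^ n) * C, fun x => ?_⟩
  have hg : ContDiff ℝ n fun r : ℝ => Real.exp (-c * r) := by fun_prop
  have h1 := norm_iteratedFDeriv_comp_le (𝕜 := ℝ) (n := n) (N := n) hg
    ((contDiff_norm_sq ℝ : ContDiff ℝ n fun ξ : Rd d => ‖ξ‖ ^ 2)) le_rfl x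
    (C := (1 + c) ^ n * Real.exp (-(c * ‖x‖ ^ 2))) (D := (1 + C') * (1 + ‖x‖) ^ k')
    (fun i hi => by
      rw [norm_iteratedFDeriv_eq_norm_iteratedDeriv, iteratedDeriv_exp_const_mul]
      rw [norm_mul, norm_pow, Real.norm_eq_abs, Real.norm_eq_abs, Real.abs_exp, abs_neg,
        abs_of_pos hc, neg_mul]
      gcongr
      exact (pow_le_pow_left₀ hc.le (by linarith) i).trans
        (pow_le_pow_right₀ (by linarith) hi))
    (fun i hi1 hi => by
      refine (h i hi x).trans ?_
      have h2 : 1 ≤ (1 + C') * (1 + ‖x‖) ^ k' :=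
        one_le_mul_of_one_le_of_one_le (by linarith)
          (one_le_pow₀ (by linarith [norm_nonneg x]))
      refine le_trans ?_ (le_self_pow₀ h2 (by omega))
      gcongr
      linarith)
  have h3 : (fun r : ℝ => Real.exp (-c * r)) ∘ (fun ξ : Rd d => ‖ξ‖ ^ 2)
      = fun ξ : Rd d => Real.exp (-(c * ‖ξ‖ ^ 2)) := by
    ext; simp
  rw [h3] at h1
  calc _ ≤ (1 + ‖x‖) ^ k * (n.factorial * ((1 + c) ^ n * Real.exp (-(c * ‖x‖ ^ 2)))
        * ((1 + C') * (1 + ‖x‖) ^ k') ^ n) := by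
        gcongr
        linarith
    _ = (n.factorial * (1 + c) ^ n * (1 + C') ^ n) *
        ((1 + ‖x‖) ^ (k + k' * n) * Real.exp (-(c * ‖x‖ ^ 2))) := by
        rw [mul_pow, ← pow_mul, pow_add]; ring
    _ ≤ _ := by
        gcongr
        exact hb _ (norm_nonneg x)

/-- The symbol of the heat semigroup at time one. -/
def gauss (d : ℕ) : 𝓢(Rd d, ℂ) :=
  SchwartzMap.postcompCLM (𝕜 := ℝ) Complex.ofRealCLM
    { toFun := fun ξ : Rd d => Real.exp (-(4 * Real.pi ^ 2 * ‖ξ‖ ^ 2))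
      smooth' := gaussian_smooth _
      decay' := gaussian_decay (by positivity) }

theorem gauss_apply (ξ : Rd d) :
    gauss d ξ = (Real.exp (-(4 * Real.pi ^ 2 * ‖ξ‖ ^ 2)) : ℂ) := rfl

theorem gauss_ne_zero (ξ : Rd d) : gauss d ξ ≠ 0 := by
  rw [gauss_apply]
  exact_mod_cast (Real.exp_pos _).ne'

theorem gauss_zero : gauss d 0 = 1 := by
  simp [gauss_apply]

theorem heat_apply {t : ℝ} (ht : 0 ≤ t) (f : 𝓢'(Rd d, ℂ)) (ψ : 𝓢(Rd d, ℂ)) :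
    heat t f ψ = f (mult (dil (gauss d) √t) ψ) := by
  suffices h : (fun ξ : Rd d => (Real.exp (-(4 * Real.pi ^ 2 * t * ‖ξ‖ ^ 2)) : ℂ))
      = dil (gauss d) √t by
    rw [heat, fourierMultiplier_apply, h]
  ext ξ
  rw [dil, gauss_apply, norm_smul, mul_pow, Real.norm_of_nonneg (Real.sqrt_nonneg t), Real.sq_sqrt ht]
  congr 3
  ring

theorem hasCompactSupport_cutoff (φ : DyadicCutoff d) :
    HasCompactSupport fun ξ => (φ.toFun ξ : ℂ) := by
  refine HasCompactSupport.intro (isCompact_closedBall (0 : Rd d) (3 / 2)) fun x hx => ?_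
  rw [φ.eq_zero x, Complex.ofReal_zero]
  simp only [Metric.mem_closedBall, dist_zero_right, not_le] at hx
  exact hx.le

/-- The cutoff as a Schwartz function. -/
def cut (φ : DyadicCutoff d) : 𝓢(Rd d, ℂ) :=
  (hasCompactSupport_cutoff φ).toSchwartzMap (Complex.ofRealCLM.contDiff.comp φ.smooth)

theorem cut_apply (φ : DyadicCutoff d) (x : Rd d) : cut φ x = (φ.toFun x : ℂ) := rfl

theorem cut_zero (φ : DyadicCutoff d) : cut φ 0 = 1 := by
  rw [cut_apply, φ.eq_one 0 (by simp), Complex.ofReal_one]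

/-- A sequence of mollifiers. -/
def bump (d n : ℕ) : ContDiffBump (0 : Rd d) :=
  ⟨1 / (n + 1 : ℝ) / 2, 1 / (n + 1 : ℝ), by positivity, half_lt_self (by positivity)⟩

/-- The mollifier centred at `x`, as a Schwartz function. -/
def moll (n : ℕ) (x : Rd d) : 𝓢(Rd d, ℂ) :=
  HasCompactSupport.toSchwartzMap (f := fun t => (((bump d n).normed volume (x - t) : ℝ) : ℂ))
    (by
      have h : HasCompactSupport fun t => (bump d n).normed volume (x - t) :=
        (bump d n).hasCompactSupport_normed.comp_homeomorph (Homeomorph.subLeft x)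
      exact h.comp_left (g := Complex.ofReal) Complex.ofReal_zero)
    (Complex.ofRealCLM.contDiff.comp
      ((bump d n).contDiff_normed.comp (contDiff_const.sub contDiff_id)))

theorem moll_apply (n : ℕ) (x t : Rd d) :
    moll n x t = (((bump d n).normed volume (x - t) : ℝ) : ℂ) := rfl

theorem moll_compSub (n : ℕ) (x y : Rd d) :
    SchwartzMap.compSubConstCLM ℂ y (moll n x) = moll n (x + y) := by
  ext t
  rw [SchwartzMap.compSubConstCLM_apply, moll_apply, moll_apply]
  rw [sub_sub_eq_add_sub]

theorem l1_moll (n : ℕ) (x : Rd d) : l1 (moll n x) = 1 := by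
  simp only [l1, moll_apply, Complex.norm_real]
  rw [integral_sub_left_eq_self (fun t => ‖(bump d n).normed volume t‖)]
  simp only [Real.norm_of_nonneg ((bump d n).nonneg_normed _)]
  exact (bump d n).integral_normed

theorem ae_tendsto_moll {g : Rd d → ℂ} (hg : LocallyIntegrable g) :
    ∀ᵐ x, Tendsto (fun n => ∫ t, moll n x t * g t) atTop (𝓝 (g x)) := by
  have h := ContDiffBump.ae_convolution_tendsto_right_of_locallyIntegrable (μ := volume)
    (φ := bump d) (l := atTop) (K := 2)
    (by simpa [bump] using tendsto_one_div_add_atTop_nhds_zero_nat (𝕜 := ℝ))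
    (Eventually.of_forall fun n => by simp only [bump]; linarith) hg
  filter_upwards [h] with x hx
  refine hx.congr fun n => ?_
  rw [convolution_eq_swap]
  simp [moll_apply]

/-! ### Duality of `L¹` and `L^∞` -/

/-- Multiplication by a Gaussian maps `L²` to `L¹` by Cauchy–Schwarz, so the functional becomes
bounded for the `L²` norm. It extends from the dense Schwartz functions, and Riesz' theorem gives
its density. -/
theorem exists_density {f : 𝓢'(Rd d, ℂ)} {A : ℝ} (hf : ∀ ψ, ‖f ψ‖ ≤ A * l1 ψ) :
    ∃ G : Rd d → ℂ, MemLp G 2 ∧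
      ∀ ψ, f (SchwartzMap.smulLeftCLM ℂ (gauss d) ψ) = ∫ x, G x * ψ x := by
  set e : 𝓢(Rd d, ℂ) →L[ℂ] Lp ℂ 2 (volume : Measure (Rd d)) := SchwartzMap.toLpCLM ℂ ℂ 2 volume with he
  set Λ : 𝓢(Rd d, ℂ) →ₗ[ℂ] ℂ := f.toLinearMap ∘ₗ (SchwartzMap.smulLeftCLM ℂ (gauss d)).toLinearMap
    with hΛ
  have hΛa : ∀ ψ, Λ ψ = f (SchwartzMap.smulLeftCLM ℂ (gauss d) ψ) := fun ψ => rfl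
  have hA : 0 ≤ A := by
    have := (norm_nonneg _).trans (hf (moll 0 0))
    rwa [l1_moll, mul_one] at this
  have hb : ∀ ψ, ‖Λ ψ‖ ≤ (A * ‖e (gauss d)‖) * ‖e ψ‖ := by
    intro ψ
    rw [hΛa]
    refine (hf _).trans ?_
    rw [mul_assoc]
    gcongr
    have h1 : l1 (SchwartzMap.smulLeftCLM ℂ (gauss d) ψ) = ∫ x, ‖gauss d x‖ * ‖ψ x‖ := by
      simp only [l1, SchwartzMap.smulLeftCLM_apply_apply (gauss d).hasTemperateGrowth, smul_eq_mul,
        norm_mul]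
    rw [h1]
    have h2 := integral_mul_norm_le_Lp_mul_Lq (μ := volume) (p := 2) (q := 2)
      (Real.HolderConjugate.two_two) (f := gauss d) (g := ψ)
      (by simpa using (gauss d).memLp 2) (by simpa using ψ.memLp 2)
    refine h2.trans (le_of_eq ?_)
    simp only [he, SchwartzMap.toLpCLM_apply]
    rw [SchwartzMap.norm_toLp' (by simp) (by simp), SchwartzMap.norm_toLp' (by simp) (by simp)]
    simp
  have hd : DenseRange e := SchwartzMap.denseRange_toLpCLM (by simp)
  set Λe := Λ.extendOfNorm e.toLinearMap with hΛe
  have hext : ∀ ψ, Λe (e ψ) = Λ ψ := LinearMap.extendOfNorm_eq hd ⟨_, hb⟩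
  set G0 := (InnerProductSpace.toDual ℂ (Lp ℂ 2 (volume : Measure (Rd d)))).symm Λe with hG0
  refine ⟨fun x => (starRingEnd ℂ) (G0 x), (Lp.memLp G0).star, fun ψ => ?_⟩
  rw [← hΛa, ← hext, ← InnerProductSpace.toDual_symm_apply, ← hG0, L2.inner_def]
  refine integral_congr_ae ?_
  filter_upwards [ψ.coeFn_toLp 2 volume] with x hx
  simp only [he, SchwartzMap.toLpCLM_apply, RCLike.inner_apply]
  rw [hx, mul_comm]

/-- Duality of `L¹` and `L^∞`, for tempered distributions. -/
theorem exists_linfty {f : 𝓢'(Rd d, ℂ)} {A : ℝ} (hf : ∀ ψ, ‖f ψ‖ ≤ A * l1 ψ) :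
    ∃ g : Rd d → ℂ, AEStronglyMeasurable g ∧ (∀ᵐ x, ‖g x‖ ≤ A) ∧ IsGivenBy f g ∧
      ∀ᵐ x, Tendsto (fun n => f (moll n x)) atTop (𝓝 (g x)) := by
  obtain ⟨G, hG, hGf⟩ := exists_density hf
  -- Undo the Gaussian weight. The quotient is only known to be locally integrable at this point, so
  -- `f` is first represented on compactly supported functions; the pointwise bound `A` then follows
  -- by testing with mollifiers, whose `L¹` norm is one.
  set g : Rd d → ℂ := fun x => (gauss d x)⁻¹ * G x with hg
  have hinv : ContDiff ℝ ∞ fun x => (gauss d x)⁻¹ := ((gauss d).smooth ⊤).inv gauss_ne_zero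
  have hgl : LocallyIntegrable g :=
    (hG.locallyIntegrable (by simp)).continuous_mul hinv.continuous
  have hcs : ∀ η : 𝓢(Rd d, ℂ), HasCompactSupport η → f η = ∫ x, η x * g x := by
    intro η hη
    set ψ : 𝓢(Rd d, ℂ) := HasCompactSupport.toSchwartzMap (f := fun x => (gauss d x)⁻¹ * η x)
      hη.mul_left (hinv.mul (η.smooth ⊤)) with hψ
    have hψa : ∀ x, ψ x = (gauss d x)⁻¹ * η x := fun x => rfl
    have h1 : SchwartzMap.smulLeftCLM ℂ (gauss d) ψ = η := by
      ext x
      rw [SchwartzMap.smulLeftCLM_apply_apply (gauss d).hasTemperateGrowth, smul_eq_mul, hψa,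
        ← mul_assoc, mul_inv_cancel₀ (gauss_ne_zero x), one_mul]
    rw [← h1, hGf]
    refine integral_congr_ae (ae_of_all _ fun x => ?_)
    simp only
    rw [h1, hψa, hg]
    ring
  have hmc : ∀ n (x : Rd d), HasCompactSupport (moll n x) := fun n x =>
    ((bump d n).hasCompactSupport_normed.comp_homeomorph (Homeomorph.subLeft x)).comp_left
      (g := Complex.ofReal) Complex.ofReal_zero
  have hlim : ∀ᵐ x, Tendsto (fun n => f (moll n x)) atTop (𝓝 (g x)) := by
    filter_upwards [ae_tendsto_moll hgl] with x hx
    exact hx.congr fun n => (hcs _ (hmc n x)).symm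
  have hbd : ∀ᵐ x, ‖g x‖ ≤ A := by
    filter_upwards [hlim] with x hx
    refine le_of_tendsto hx.norm (Eventually.of_forall fun n => ?_)
    have := hf (moll n x)
    rwa [l1_moll, mul_one] at this
  have hgm := hgl.aestronglyMeasurable
  have hint : ∀ ψ : 𝓢(Rd d, ℂ), Integrable fun x => ψ x * g x := fun ψ =>
    ψ.integrable.mul_bdd hgm hbd
  refine ⟨g, hgm, hbd, fun ψ => ⟨hint ψ, ?_⟩, hlim⟩
  -- Any cutoff serves here: the truncations of `ψ` by its dilations converge to `ψ` in the Schwartz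
  -- space, and the integrals converge by domination.
  obtain ⟨φ⟩ : Nonempty (DyadicCutoff d) := inferInstance
  have ht0 : Tendsto (fun n : ℕ => 1 / ((n : ℝ) + 1)) atTop (𝓝[≥] 0) :=
    tendsto_nhdsWithin_iff.2 ⟨tendsto_one_div_add_atTop_nhds_zero_nat,
      Eventually.of_forall fun n => by simp only [mem_Ici]; positivity⟩
  set ψn : ℕ → 𝓢(Rd d, ℂ) := fun n =>
    SchwartzMap.smulLeftCLM ℂ (dil (cut φ) (1 / ((n : ℝ) + 1))) ψ with hψn
  have hψna : ∀ n x, ψn n x = cut φ ((1 / ((n : ℝ) + 1)) • x) * ψ x := fun n x => by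
    rw [hψn]
    simp only
    rw [SchwartzMap.smulLeftCLM_apply_apply (dil_temperate _ _), smul_eq_mul]
  have h1 : Tendsto (fun n => f (ψn n)) atTop (𝓝 (f ψ)) := by
    have h2 := (tendsto_smulLeft_dil (cut φ) ψ).comp ht0
    rw [cut_zero, one_smul] at h2
    exact (f.continuous.tendsto ψ).comp h2
  have h2 : Tendsto (fun n => ∫ x, ψn n x * g x) atTop (𝓝 (∫ x, ψ x * g x)) := by
    refine tendsto_integral_of_dominated_convergence
      (fun x => SchwartzMap.seminorm ℝ 0 0 (cut φ) * ‖ψ x * g x‖)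
      (fun n => (hint _).1) ((hint ψ).norm.const_mul _) (fun n => ae_of_all _ fun x => ?_)
      (ae_of_all _ fun x => ?_)
    · rw [hψna, mul_assoc, norm_mul]
      gcongr
      exact SchwartzMap.norm_le_seminorm ℝ _ _
    · simp only [hψna]
      have h3 : Tendsto (fun n : ℕ => cut φ ((1 / ((n : ℝ) + 1)) • x)) atTop (𝓝 1) := by
        have h4 : Tendsto (fun r : ℝ => cut φ (r • x)) (𝓝 0) (𝓝 (cut φ ((0 : ℝ) • x))) :=
          ((cut φ).continuous.comp (by fun_prop : Continuous fun r : ℝ => r • x)).tendsto 0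
        rw [zero_smul, cut_zero] at h4
        exact h4.comp (ht0.mono_right nhdsWithin_le_nhds)
      simpa using (h3.mul_const (ψ x)).mul_const (g x)
  refine tendsto_nhds_unique (h1.congr fun n => hcs _ ?_) h2
  have h5 : HasCompactSupport fun x => cut φ ((1 / ((n : ℝ) + 1)) • x) :=
    (hasCompactSupport_cutoff φ).comp_smul (by positivity)
  have h6 : ⇑(ψn n) = fun x => cut φ ((1 / ((n : ℝ) + 1)) • x) * ψ x := funext (hψna n)
  rw [h6]
  exact h5.mul_right

theorem linftyNorm_le_iff {f : 𝓢'(Rd d, ℂ)} {A : ℝ} (hA : 0 ≤ A) :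
    linftyNorm f ≤ ENNReal.ofReal A ↔ ∀ ψ, ‖f ψ‖ ≤ A * l1 ψ := by
  constructor
  · intro h ψ
    -- The infimum defining the norm is not known to be attained, so a slightly larger constant is
    -- used and then sent to `A`.
    have key : ∀ B, A < B → ‖f ψ‖ ≤ B * l1 ψ := by
      intro B hB
      have h1 : linftyNorm f < ENNReal.ofReal B :=
        h.trans_lt ((ENNReal.ofReal_lt_ofReal_iff (hA.trans_lt hB)).2 hB)
      simp only [linftyNorm, iInf_lt_iff] at h1
      obtain ⟨g, hg, hgB⟩ := h1
      have hB' : ‖g‖ ≤ B := by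
        rw [← ofReal_norm] at hgB
        exact ((ENNReal.ofReal_lt_ofReal_iff (hA.trans_lt hB)).1 hgB).le
      rw [← hg, Lp.toTemperedDistribution_apply]
      refine (norm_integral_le_integral_norm _).trans ?_
      rw [l1, ← integral_const_mul]
      refine integral_mono_of_nonneg (ae_of_all _ fun _ => norm_nonneg _)
        (ψ.integrable.norm.const_mul _) ?_
      have hae : ∀ᵐ x, ‖g x‖ ≤ ‖g‖ := by
        filter_upwards [ae_le_eLpNormEssSup (f := g) (μ := volume)] with x hx
        rw [← eLpNorm_exponent_top, ← Lp.enorm_def, ← ofReal_norm, ← ofReal_norm] at hx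
        exact (ENNReal.ofReal_le_ofReal_iff (norm_nonneg _)).1 hx
      filter_upwards [hae] with x hx
      rw [smul_eq_mul, norm_mul, mul_comm]
      gcongr
      exact hx.trans hB'
    have h2 : Tendsto (fun B => B * l1 ψ) (𝓝[>] A) (𝓝 (A * l1 ψ)) :=
      ((continuous_id.mul continuous_const).tendsto A).mono_left nhdsWithin_le_nhds
    exact ge_of_tendsto h2 (eventually_nhdsWithin_of_forall fun B hB => key B hB)
  · intro h
    obtain ⟨g, hgm, hbd, hgf, -⟩ := exists_linfty h
    have hg : MemLp g ∞ := memLp_top_of_bound hgm A hbd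
    refine iInf₂_le_of_le hg.toLp ?_ ?_
    · ext ψ
      rw [Lp.toTemperedDistribution_apply, (hgf ψ).2]
      refine integral_congr_ae ?_
      filter_upwards [hg.coeFn_toLp] with x hx
      rw [hx, smul_eq_mul]
    · rw [Lp.enorm_toLp, eLpNorm_exponent_top]
      refine eLpNormEssSup_le_of_ae_bound hbd

/-! ### Profiles of the Littlewood–Paley blocks and uniform kernel constants -/

/-- The dilated cutoff as a Schwartz function. -/
def cutScale (φ : DyadicCutoff d) (c : ℝ) (hc : c ≠ 0) : 𝓢(Rd d, ℂ) :=
  ((hasCompactSupport_cutoff φ).comp_smul hc).toSchwartzMap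
    (Complex.ofRealCLM.contDiff.comp (φ.smooth.comp (contDiff_const_smul c)))

theorem cutScale_apply (φ : DyadicCutoff d) (c : ℝ) (hc : c ≠ 0) (x : Rd d) :
    cutScale φ c hc x = (φ.toFun (c • x) : ℂ) := rfl

/-- The profile of the symbol of the `j`-th block. -/
def partS (φ : DyadicCutoff d) : ℕ → 𝓢(Rd d, ℂ)
  | 0 => cut φ
  | _ + 1 => cut φ - cutScale φ 2 two_ne_zero

/-- The profile of a symbol that is one on the support of the `j`-th block. -/
def fatS (φ : DyadicCutoff d) : ℕ → 𝓢(Rd d, ℂ)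
  | 0 => cutScale φ (1 / 2) (by norm_num)
  | _ + 1 => cutScale φ (1 / 2) (by norm_num) - cutScale φ 4 (by norm_num)

/-- All blocks are dilations of only two profiles, one for `j = 0` and one for `j ≥ 1`. This is why
a single constant `Kc φ` serves every `j`. -/
theorem part_eq_dil (φ : DyadicCutoff d) (j : ℕ) :
    (fun ξ => (φ.part j ξ : ℂ)) = dil (partS φ j) ((2 : ℝ) ^ j)⁻¹ := by
  ext ξ
  cases j with
  | zero => simp [DyadicCutoff.part, partS, dil, cut_apply]
  | succ j =>
    simp only [DyadicCutoff.part, partS, dil, sub_apply, cut_apply, cutScale_apply, smul_smul,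
      Complex.ofReal_sub]
    congr 4
    rw [pow_succ]; field_simp

/-- The transposed Littlewood-Paley block. -/
def blk (φ : DyadicCutoff d) (j : ℕ) : 𝓢(Rd d, ℂ) →L[ℂ] 𝓢(Rd d, ℂ) :=
  mult (dil (partS φ j) ((2 : ℝ) ^ j)⁻¹)

/-- A transposed block with larger support. -/
def fat (φ : DyadicCutoff d) (j : ℕ) : 𝓢(Rd d, ℂ) →L[ℂ] 𝓢(Rd d, ℂ) :=
  mult (dil (fatS φ j) ((2 : ℝ) ^ j)⁻¹)

/-- The heat semigroup on Schwartz functions. -/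
def heatS (t : ℝ) : 𝓢(Rd d, ℂ) →L[ℂ] 𝓢(Rd d, ℂ) := mult (dil (gauss d) √t)

theorem heat_apply' {t : ℝ} (ht : 0 ≤ t) (f : 𝓢'(Rd d, ℂ)) (ψ : 𝓢(Rd d, ℂ)) :
    heat t f ψ = f (heatS t ψ) := heat_apply ht f ψ

theorem block_apply (φ : DyadicCutoff d) (j : ℕ) (f : 𝓢'(Rd d, ℂ)) (ψ : 𝓢(Rd d, ℂ)) :
    block φ j f ψ = f (blk φ j ψ) := by
  rw [block, fourierMultiplier_apply, part_eq_dil, blk]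

/-- The fat symbol equals one wherever the symbol of the block is nonzero. Inserting it allows the
test function to be localized in frequency while a block remains in front for `f`; for `j ≥ 1` its
profile vanishes near zero. -/
theorem blk_fat (φ : DyadicCutoff d) (j : ℕ) (ψ : 𝓢(Rd d, ℂ)) :
    blk φ j (fat φ j ψ) = blk φ j ψ := by
  rw [blk, fat, mult_mult (dil_temperate _ _) (dil_temperate _ _)]
  congr 2
  ext ξ
  simp only [Pi.mul_apply, dil]
  set x := ((2 : ℝ) ^ j)⁻¹ • ξ
  have h1 : ‖x‖ ≤ 2 → φ.toFun ((1 / 2 : ℝ) • x) = 1 := fun h => φ.eq_one _ (by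
    rw [norm_smul, Real.norm_of_nonneg (by norm_num)]; linarith)
  have h0 : 2 ≤ ‖x‖ → φ.toFun x = 0 := fun h => φ.eq_zero _ (by linarith)
  cases j with
  | zero =>
    simp only [partS, fatS, cut_apply, cutScale_apply]
    rcases le_total ‖x‖ 2 with h | h
    · rw [h1 h]; simp
    · rw [h0 h]; simp
  | succ j =>
    simp only [partS, fatS, cut_apply, cutScale_apply, sub_apply]
    have h4 : 1 / 2 ≤ ‖x‖ → φ.toFun ((4 : ℝ) • x) = 0 := fun h => φ.eq_zero _ (by
      rw [norm_smul, Real.norm_of_nonneg (by norm_num)]; linarith)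
    rcases le_total ‖x‖ 2 with h | h
    · rw [h1 h]
      rcases le_total (1 / 2) ‖x‖ with h' | h'
      · rw [h4 h']; simp
      · rw [φ.eq_one x (by linarith), φ.eq_one ((2 : ℝ) • x) (by
          rw [norm_smul, Real.norm_of_nonneg (by norm_num)]; linarith)]
        simp
    · rw [h0 h, φ.eq_zero ((2 : ℝ) • x) (by
          rw [norm_smul, Real.norm_of_nonneg (by norm_num)]; linarith)]
      simp

theorem mult_dil_comm (s s' : 𝓢(Rd d, ℂ)) (r r' : ℝ) (ψ : 𝓢(Rd d, ℂ)) :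
    mult (dil s r) (mult (dil s' r') ψ) = mult (dil s' r') (mult (dil s r) ψ) :=
  mult_comm (dil_temperate _ _) (dil_temperate _ _) ψ

theorem heatS_add {s t : ℝ} (hs : 0 ≤ s) (ht : 0 ≤ t) (ψ : 𝓢(Rd d, ℂ)) :
    heatS s (heatS t ψ) = heatS (s + t) ψ := by
  rw [heatS, heatS, heatS, mult_mult (dil_temperate _ _) (dil_temperate _ _)]
  congr 2
  ext ξ
  simp only [Pi.mul_apply, dil, gauss_apply, norm_smul, mul_pow,
    Real.norm_of_nonneg (Real.sqrt_nonneg _), Real.sq_sqrt hs, Real.sq_sqrt ht,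
    Real.sq_sqrt (add_nonneg hs ht)]
  rw [← Complex.ofReal_mul, ← Real.exp_add]
  congr 2
  ring

/-- A constant for all the kernel estimates of `s`. -/
def kc (s : 𝓢(Rd d, ℂ)) : ℝ := l1 (ft s) + w11 (ft s) + moment 0 s + moment 1 s

theorem l1_le_kc (s : 𝓢(Rd d, ℂ)) : l1 (ft s) ≤ kc s := by
  have := w11_nonneg (ft s); have := moment_nonneg 0 s; have := moment_nonneg 1 s
  rw [kc]; linarith

theorem w11_le_kc (s : 𝓢(Rd d, ℂ)) : w11 (ft s) ≤ kc s := by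
  have := l1_nonneg (ft s); have := moment_nonneg 0 s; have := moment_nonneg 1 s
  rw [kc]; linarith

theorem kc_nonneg (s : 𝓢(Rd d, ℂ)) : 0 ≤ kc s := (l1_nonneg _).trans (l1_le_kc s)

theorem moment_le_kc (s : 𝓢(Rd d, ℂ)) {a : ℝ} (ha : 0 ≤ a) (ha1 : a ≤ 1) :
    moment a s ≤ kc s := by
  have h : moment a s ≤ moment 0 s + moment 1 s := by
    have h0 := integrable_norm_mul_rpow (ft s) le_rfl zero_le_one
    have h1 := integrable_norm_mul_rpow (ft s) zero_le_one le_rfl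
    rw [moment, moment, moment, ← integral_add h0 h1]
    refine integral_mono (integrable_norm_mul_rpow (ft s) ha ha1) (h0.add h1) fun y => ?_
    simp only [Real.rpow_zero, Real.rpow_one, ← mul_add]
    gcongr
    rcases le_total ‖y‖ 1 with h | h
    · have := Real.rpow_le_one (norm_nonneg y) h ha
      linarith [norm_nonneg y]
    · calc ‖y‖ ^ a ≤ ‖y‖ ^ (1 : ℝ) := Real.rpow_le_rpow_of_exponent_le h ha1
        _ ≤ _ := by rw [Real.rpow_one]; linarith
  have := w11_nonneg (ft s); have := l1_nonneg (ft s)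
  rw [kc]; linarith

/-- A constant for all the kernel estimates related to `φ`. -/
def Kc (φ : DyadicCutoff d) : ℝ :=
  1 + kc (cut φ) + kc (partS φ 1) + kc (fatS φ 0) + kc (fatS φ 1) + kc (gauss d)

theorem kc_part_le (φ : DyadicCutoff d) (j : ℕ) : kc (partS φ j) ≤ Kc φ := by
  have h1 := kc_nonneg (cut φ); have h2 := kc_nonneg (partS φ 1); have h3 := kc_nonneg (fatS φ 0)
  have h4 := kc_nonneg (fatS φ 1); have h5 := kc_nonneg (gauss d)
  cases j with
  | zero => simp only [partS, Kc] at *; linarith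
  | succ j =>
    have : partS φ (j + 1) = partS φ 1 := rfl
    rw [this, Kc]; linarith

theorem kc_fat_le (φ : DyadicCutoff d) (j : ℕ) : kc (fatS φ j) ≤ Kc φ := by
  have h1 := kc_nonneg (cut φ); have h2 := kc_nonneg (partS φ 1); have h3 := kc_nonneg (fatS φ 0)
  have h4 := kc_nonneg (fatS φ 1); have h5 := kc_nonneg (gauss d)
  cases j with
  | zero => rw [Kc]; linarith
  | succ j =>
    have : fatS φ (j + 1) = fatS φ 1 := rfl
    rw [this, Kc]; linarith

theorem kc_cut_le (φ : DyadicCutoff d) : kc (cut φ) ≤ Kc φ := kc_part_le φ 0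

theorem kc_gauss_le (φ : DyadicCutoff d) : kc (gauss d) ≤ Kc φ := by
  have h1 := kc_nonneg (cut φ); have h2 := kc_nonneg (partS φ 1); have h3 := kc_nonneg (fatS φ 0)
  have h4 := kc_nonneg (fatS φ 1)
  rw [Kc]; linarith

theorem one_le_Kc (φ : DyadicCutoff d) : 1 ≤ Kc φ := by
  have h1 := kc_nonneg (cut φ); have h2 := kc_nonneg (partS φ 1); have h3 := kc_nonneg (fatS φ 0)
  have h4 := kc_nonneg (fatS φ 1); have h5 := kc_nonneg (gauss d)
  rw [Kc]; linarith

theorem Kc_nonneg (φ : DyadicCutoff d) : 0 ≤ Kc φ := zero_le_one.trans (one_le_Kc φ)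

theorem inv_two_pow_rpow (j : ℕ) (a : ℝ) : (((2 : ℝ) ^ j)⁻¹) ^ a = 2 ^ (-(a * j)) := by
  rw [← Real.rpow_natCast, ← Real.rpow_neg zero_le_two, ← Real.rpow_mul zero_le_two]
  congr 1; ring

theorem two_pow_rpow (j : ℕ) (a : ℝ) : ((((2 : ℝ) ^ j)⁻¹)⁻¹) ^ a = 2 ^ (a * j) := by
  rw [inv_inv, ← Real.rpow_natCast, ← Real.rpow_mul zero_le_two]
  congr 1; ring

section kernels
variable (φ : DyadicCutoff d) (ψ : 𝓢(Rd d, ℂ))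

theorem l1_mult_le {s : 𝓢(Rd d, ℂ)} (hs : kc s ≤ Kc φ) (r : ℝ) :
    l1 (mult (dil s r) ψ) ≤ Kc φ * l1 ψ :=
  (l1_mult_dil_le s ψ r).trans
    (mul_le_mul_of_nonneg_right ((l1_le_kc s).trans hs) (l1_nonneg _))

theorem modulus_mult {s : 𝓢(Rd d, ℂ)} (hs : kc s ≤ Kc φ) {r a : ℝ} (hr : 0 < r) (ha : 0 ≤ a)
    (ha1 : a ≤ 1) : HasModulus a (Kc φ * r⁻¹ ^ a * l1 ψ) (mult (dil s r) ψ) := fun y => by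
  refine (hasModulus_mult_dil s ψ hr ha ha1 y).trans ?_
  have := (w11_le_kc s).trans hs
  have := l1_nonneg ψ
  gcongr

theorem l1_fat_le (j : ℕ) : l1 (fat φ j ψ) ≤ Kc φ * l1 ψ := l1_mult_le φ ψ (kc_fat_le φ j) _

theorem l1_blk_le (j : ℕ) : l1 (blk φ j ψ) ≤ Kc φ * l1 ψ := l1_mult_le φ ψ (kc_part_le φ j) _

theorem l1_heatS_le (t : ℝ) : l1 (heatS t ψ) ≤ Kc φ * l1 ψ := l1_mult_le φ ψ (kc_gauss_le φ) _

theorem modulus_fat (j : ℕ) {a : ℝ} (ha : 0 ≤ a) (ha1 : a ≤ 1) :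
    HasModulus a (Kc φ * 2 ^ (a * j) * l1 ψ) (fat φ j ψ) := by
  have := modulus_mult φ ψ (kc_fat_le φ j) (r := ((2 : ℝ) ^ j)⁻¹) (by positivity) ha ha1
  rwa [two_pow_rpow] at this

theorem modulus_blk (j : ℕ) {a : ℝ} (ha : 0 ≤ a) (ha1 : a ≤ 1) :
    HasModulus a (Kc φ * 2 ^ (a * j) * l1 ψ) (blk φ j ψ) := by
  have := modulus_mult φ ψ (kc_part_le φ j) (r := ((2 : ℝ) ^ j)⁻¹) (by positivity) ha ha1
  rwa [two_pow_rpow] at this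

theorem modulus_heatS {t : ℝ} (ht : 0 < t) {a : ℝ} (ha : 0 ≤ a) (ha1 : a ≤ 1) :
    HasModulus a (Kc φ * t ^ (-(a / 2)) * l1 ψ) (heatS t ψ) := by
  have := modulus_mult φ ψ (kc_gauss_le φ) (r := √t) (by positivity) ha ha1
  rwa [show (√t)⁻¹ ^ a = t ^ (-(a / 2)) by
    rw [Real.sqrt_eq_rpow, ← Real.rpow_neg ht.le, ← Real.rpow_mul ht.le]; ring_nf] at this

variable {ψ}

/-- For `j ≥ 1` the kernel of the fat block has mean zero, so it sees only increments of `ψ` at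
scale `2^{-j}`. For `j = 0` there is no such gain, and later estimates treat that block separately.
-/
theorem l1_fat_small {j : ℕ} (hj : j ≠ 0) {a N : ℝ} (ha : 0 ≤ a) (ha1 : a ≤ 1) (hN0 : 0 ≤ N)
    (hN : HasModulus a N ψ) : l1 (fat φ j ψ) ≤ Kc φ * 2 ^ (-(a * j)) * N := by
  have h0 : fatS φ j 0 = 0 := by
    cases j with
    | zero => exact (hj rfl).elim
    | succ j => simp [fatS, cutScale_apply]
  have := l1_mult_dil_sub_le (fatS φ j) ψ (r := ((2 : ℝ) ^ j)⁻¹) (by positivity) ha ha1 hN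
  rw [h0] at this
  simp only [zero_mul, sub_zero, inv_two_pow_rpow] at this
  refine this.trans ?_
  have := (moment_le_kc (fatS φ j) ha ha1).trans (kc_fat_le φ j)
  gcongr

theorem l1_heatS_sub_le {t : ℝ} (ht : 0 ≤ t) {a N : ℝ} (ha : 0 ≤ a) (ha1 : a ≤ 1) (hN0 : 0 ≤ N)
    (hN : HasModulus a N ψ) : l1 (heatS t ψ - ψ) ≤ Kc φ * t ^ (a / 2) * N := by
  have := l1_mult_dil_sub_le (gauss d) ψ (Real.sqrt_nonneg t) ha ha1 hN
  rw [gauss_zero, Real.sqrt_eq_rpow, ← Real.rpow_mul ht, show 1 / 2 * a = a / 2 by ring,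
    ← Real.sqrt_eq_rpow] at this
  simp only [one_mul] at this
  refine this.trans ?_
  have := (moment_le_kc (gauss d) ha ha1).trans (kc_gauss_le φ)
  gcongr

end kernels

/-! ### Besov bounds in dual form and the heat semigroup -/

/-- The dual form of the bound `‖f‖_γ ≤ A`. -/
def HasBound (φ : DyadicCutoff d) (γ A : ℝ) (f : 𝓢'(Rd d, ℂ)) : Prop :=
  ∀ j ψ, ‖f (blk φ j ψ)‖ ≤ A * 2 ^ (-(γ * j)) * l1 ψ

variable {φ : DyadicCutoff d}

/-- The `L¹`–`L^∞` duality `linftyNorm_le_iff`, applied to each block. -/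
theorem besovNorm_le_iff {γ A : ℝ} (hA : 0 ≤ A) {f : 𝓢'(Rd d, ℂ)} :
    besovNorm φ γ f ≤ ENNReal.ofReal A ↔ HasBound φ γ A f := by
  rw [besovNorm, iSup_le_iff]
  refine forall_congr' fun j => ?_
  have hp : (0 : ℝ) < 2 ^ (γ * j) := by positivity
  have h1 : ENNReal.ofReal (2 ^ (γ * j)) * linftyNorm (block φ j f) ≤ ENNReal.ofReal A ↔
      linftyNorm (block φ j f) ≤ ENNReal.ofReal (A * 2 ^ (-(γ * j))) := by
    rw [Real.rpow_neg zero_le_two, ← div_eq_mul_inv, ENNReal.ofReal_div_of_pos hp,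
      ENNReal.le_div_iff_mul_le (Or.inl (by simpa using hp)) (Or.inl ENNReal.ofReal_ne_top),
      mul_comm]
  rw [h1, linftyNorm_le_iff (by positivity)]
  simp only [block_apply]

theorem exists_hasBound {γ : ℝ} {f : 𝓢'(Rd d, ℂ)} (h : besovNorm φ γ f < ⊤) :
    ∃ A, 0 ≤ A ∧ HasBound φ γ A f :=
  ⟨(besovNorm φ γ f).toReal, ENNReal.toReal_nonneg,
    (besovNorm_le_iff ENNReal.toReal_nonneg).1 (by rw [ENNReal.ofReal_toReal h.ne])⟩

theorem HasBound.besovNorm_lt_top {γ A : ℝ} {f : 𝓢'(Rd d, ℂ)} (hA : 0 ≤ A)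
    (h : HasBound φ γ A f) : besovNorm φ γ f < ⊤ :=
  ((besovNorm_le_iff hA).2 h).trans_lt ENNReal.ofReal_lt_top

section HasBound
variable {γ A B : ℝ} {f g : 𝓢'(Rd d, ℂ)}

theorem HasBound.mono (h : HasBound φ γ A f) (hAB : A ≤ B) : HasBound φ γ B f := fun j ψ =>
  (h j ψ).trans (by have := l1_nonneg ψ; gcongr)

theorem HasBound.mono_exponent {γ' : ℝ} (hA : 0 ≤ A) (h : HasBound φ γ A f) (hγ : γ' ≤ γ) :
    HasBound φ γ' A f := fun j ψ =>
  (h j ψ).trans (by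
    have := l1_nonneg ψ
    gcongr
    exact one_le_two)

theorem HasBound.add (hf : HasBound φ γ A f) (hg : HasBound φ γ B g) :
    HasBound φ γ (A + B) (f + g) := fun j ψ => by
  have h1 := hf j ψ
  have h2 := hg j ψ
  refine (norm_add_le _ _).trans ?_
  rw [add_mul, add_mul]
  exact add_le_add h1 h2

theorem HasBound.neg (hf : HasBound φ γ A f) : HasBound φ γ A (-f) := fun j ψ => by
  have h1 := hf j ψ
  have : (-f) (blk φ j ψ) = -(f (blk φ j ψ)) := rfl
  rwa [this, norm_neg]

theorem HasBound.sub (hf : HasBound φ γ A f) (hg : HasBound φ γ B g) :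
    HasBound φ γ (A + B) (f - g) := by
  rw [sub_eq_add_neg]
  exact hf.add hg.neg

theorem HasBound.apply_blk_le (hf : HasBound φ γ A f) (j : ℕ) (h : 𝓢(Rd d, ℂ)) :
    ‖f (blk φ j h)‖ ≤ A * 2 ^ (-(γ * j)) * l1 (fat φ j h) := by
  have := hf j (fat φ j h)
  rwa [blk_fat] at this

theorem HasBound.apply_blk_small (hA : 0 ≤ A) (hf : HasBound φ γ A f) {j : ℕ} (hj : j ≠ 0)
    {h : 𝓢(Rd d, ℂ)} {a N : ℝ} (ha : 0 ≤ a) (ha1 : a ≤ 1) (hN0 : 0 ≤ N) (hN : HasModulus a N h) :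
    ‖f (blk φ j h)‖ ≤ A * Kc φ * N * 2 ^ (-((γ + a) * j)) := by
  refine (hf.apply_blk_le j h).trans ?_
  calc _ ≤ A * 2 ^ (-(γ * j)) * (Kc φ * 2 ^ (-(a * j)) * N) := by
        gcongr
        exact l1_fat_small φ hj ha ha1 hN0 hN
    _ = _ := by
        rw [add_mul, neg_add, Real.rpow_add two_pos]; ring

theorem HasBound.heat (hA : 0 ≤ A) (hf : HasBound φ γ A f) {t : ℝ} (ht : 0 ≤ t) :
    HasBound φ γ (Kc φ * A) (heat t f) := fun j ψ => by
  rw [heat_apply' ht, heatS, blk, mult_dil_comm]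
  refine (hf j _).trans ?_
  have := l1_heatS_le φ ψ t
  calc _ ≤ A * 2 ^ (-(γ * j)) * (Kc φ * l1 ψ) := by gcongr; exact this
    _ = _ := by ring

/-- The heat kernel gives the test function an `L¹` modulus of order `θ`, which a fat block converts
into the factor `2^{-θj}`. Moduli only make sense up to order one, so to reach `2θ` up to two the
time is halved and the gain is taken twice. -/
theorem HasBound.heat_smoothing (hA : 0 ≤ A) (hf : HasBound φ γ A f) {t θ : ℝ} (ht : 0 < t)
    (hθ : 0 ≤ θ) (hθ1 : θ ≤ 1) :
    HasBound φ (γ + 2 * θ) (2 * Kc φ ^ 4 * A * (1 + t ^ (-θ))) (SingularPDE.heat t f) := by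
  intro j ψ
  have hK := one_le_Kc φ
  have hl := l1_nonneg ψ
  have ht0 : 0 ≤ t ^ (-θ) := Real.rpow_nonneg ht.le _
  have hK4 : Kc φ ≤ 2 * Kc φ ^ 4 := by
    have : Kc φ ≤ Kc φ ^ 4 := le_self_pow₀ hK (by norm_num)
    linarith
  rcases eq_or_ne j 0 with rfl | hj
  · refine (hf.heat hA ht.le 0 ψ).trans ?_
    simp only [Nat.cast_zero, mul_zero, neg_zero, Real.rpow_zero, mul_one]
    have : Kc φ * A ≤ 2 * Kc φ ^ 4 * A := by gcongr
    have h2 : 0 ≤ 2 * Kc φ ^ 4 * A := by positivity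
    have h3 : Kc φ * A ≤ 2 * Kc φ ^ 4 * A * (1 + t ^ (-θ)) := by nlinarith
    exact mul_le_mul_of_nonneg_right h3 hl
  · have hcomm : ∀ (t : ℝ) χ, heatS t (blk φ j χ) = blk φ j (heatS t χ) := fun t χ =>
      mult_dil_comm _ _ _ _ _
    have hcomm' : ∀ (t : ℝ) χ, heatS t (fat φ j χ) = fat φ j (heatS t χ) := fun t χ =>
      mult_dil_comm _ _ _ _ _
    have ht2 : 0 < t / 2 := by positivity
    set P : 𝓢(Rd d, ℂ) → 𝓢(Rd d, ℂ) := fun χ => fat φ j (heatS (t / 2) χ) with hP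
    have hPb : ∀ χ, l1 (P χ) ≤ Kc φ * 2 ^ (-(θ * j)) * (Kc φ * (t / 2) ^ (-(θ / 2)) * l1 χ) :=
      fun χ => l1_fat_small φ hj hθ hθ1 (by have := l1_nonneg χ; have := Kc_nonneg φ; positivity)
        (modulus_heatS φ χ ht2 hθ hθ1)
    have h1 : heatS t (blk φ j ψ) = blk φ j (P (P ψ)) := by
      rw [hcomm, ← blk_fat, ← blk_fat, hP]
      simp only
      rw [hcomm', heatS_add ht2.le ht2.le, add_halves]
    rw [heat_apply' ht.le, h1]
    refine (hf j _).trans ?_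
    have h2 : l1 (P (P ψ)) ≤ Kc φ ^ 4 * (2 ^ (-(θ * j)) * 2 ^ (-(θ * j))) *
        ((t / 2) ^ (-(θ / 2)) * (t / 2) ^ (-(θ / 2))) * l1 ψ := by
      refine (hPb _).trans ?_
      have := hPb ψ
      have := Kc_nonneg φ
      calc _ ≤ Kc φ * 2 ^ (-(θ * j)) * (Kc φ * (t / 2) ^ (-(θ / 2)) *
            (Kc φ * 2 ^ (-(θ * j)) * (Kc φ * (t / 2) ^ (-(θ / 2)) * l1 ψ))) := by gcongr
        _ = _ := by ring
    have h3 : (t / 2) ^ (-(θ / 2)) * (t / 2) ^ (-(θ / 2)) ≤ 2 * (1 + t ^ (-θ)) := by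
      rw [← Real.rpow_add ht2, show -(θ / 2) + -(θ / 2) = -θ by ring,
        Real.div_rpow ht.le zero_le_two, Real.rpow_neg zero_le_two, div_inv_eq_mul]
      have : (2 : ℝ) ^ θ ≤ 2 := by
        calc (2 : ℝ) ^ θ ≤ 2 ^ (1 : ℝ) := Real.rpow_le_rpow_of_exponent_le one_le_two hθ1
          _ = 2 := Real.rpow_one 2
      nlinarith
    have h4 : (2 : ℝ) ^ (-((γ + 2 * θ) * j)) =
        2 ^ (-(γ * j)) * (2 ^ (-(θ * j)) * 2 ^ (-(θ * j))) := by
      rw [← Real.rpow_add two_pos, ← Real.rpow_add two_pos]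
      congr 1; ring
    rw [h4]
    calc _ ≤ A * 2 ^ (-(γ * j)) * (Kc φ ^ 4 * (2 ^ (-(θ * j)) * 2 ^ (-(θ * j))) *
        (2 * (1 + t ^ (-θ))) * l1 ψ) := by
          gcongr
          refine h2.trans ?_
          gcongr
      _ = _ := by ring

/-- The semigroup commutes with the fat block, whose output has a modulus of order `a` with constant
of size `2^{aj}`. The semigroup minus the identity turns this into `t^{a/2}`, and the excess
regularity of `f` pays for `2^{aj}`. -/
theorem HasBound.heat_sub {a : ℝ} (hA : 0 ≤ A) (hf : HasBound φ (γ + a) A f) {t : ℝ} (ht : 0 ≤ t)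
    (ha : 0 ≤ a) (ha1 : a ≤ 1) :
    HasBound φ γ (Kc φ ^ 2 * A * t ^ (a / 2)) (SingularPDE.heat t f - f) := by
  intro j ψ
  have hl := l1_nonneg ψ
  have h1 : (SingularPDE.heat t f - f) (blk φ j ψ) = f (blk φ j (heatS t ψ - ψ)) := by
    have : (SingularPDE.heat t f - f) (blk φ j ψ) = SingularPDE.heat t f (blk φ j ψ)
      - f (blk φ j ψ) := rfl
    rw [this, heat_apply' ht, heatS, blk, mult_dil_comm, map_sub, map_sub]
  rw [h1]
  refine (hf.apply_blk_le j _).trans ?_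
  have h2 : fat φ j (heatS t ψ - ψ) = heatS t (fat φ j ψ) - fat φ j ψ := by
    rw [map_sub, fat, heatS, mult_dil_comm]
  rw [h2]
  have := Kc_nonneg φ
  have h3 := l1_heatS_sub_le φ ht ha ha1 (by positivity) (modulus_fat φ ψ j ha ha1)
  have h4 : (2 : ℝ) ^ (-((γ + a) * j)) * 2 ^ (a * j) = 2 ^ (-(γ * j)) := by
    rw [← Real.rpow_add two_pos]
    congr 1; ring
  calc _ ≤ A * 2 ^ (-((γ + a) * j)) * (Kc φ * t ^ (a / 2) * (Kc φ * 2 ^ (a * j) * l1 ψ)) := by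
        gcongr
    _ = Kc φ ^ 2 * A * t ^ (a / 2) * (2 ^ (-((γ + a) * j)) * 2 ^ (a * j)) * l1 ψ := by ring
    _ = _ := by rw [h4]

/-! ### Summation over Littlewood–Paley blocks -/

/-- The transposed partial sum. -/
def lowS (φ : DyadicCutoff d) (N : ℕ) : 𝓢(Rd d, ℂ) →L[ℂ] 𝓢(Rd d, ℂ) :=
  mult (dil (cut φ) ((2 : ℝ) ^ N)⁻¹)

theorem sum_blk (φ : DyadicCutoff d) (N : ℕ) (ψ : 𝓢(Rd d, ℂ)) :
    ∑ j ∈ Finset.range (N + 1), blk φ j ψ = lowS φ N ψ := by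
  induction N with
  | zero => simp [blk, lowS, partS]
  | succ N ih =>
    rw [Finset.sum_range_succ, ih, lowS, lowS, blk]
    have : dil (partS φ (N + 1)) ((2 : ℝ) ^ (N + 1))⁻¹ =
        dil (cut φ) ((2 : ℝ) ^ (N + 1))⁻¹ - dil (cut φ) ((2 : ℝ) ^ N)⁻¹ := by
      rw [← part_eq_dil]
      ext ξ
      simp [DyadicCutoff.part, dil, cut_apply]
    rw [this, mult_sub (dil_temperate _ _) (dil_temperate _ _)]
    abel

theorem lowFreq_apply (φ : DyadicCutoff d) (N : ℕ) (f : 𝓢'(Rd d, ℂ)) (ψ : 𝓢(Rd d, ℂ)) :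
    lowFreq φ N f ψ = f (lowS φ N ψ) := by
  rw [← sum_blk, map_sum, lowFreq, sum_apply]
  simp only [block_apply]

theorem lowFreq_apply_eq_sum (φ : DyadicCutoff d) (N : ℕ) (f : 𝓢'(Rd d, ℂ)) (ψ : 𝓢(Rd d, ℂ)) :
    lowFreq φ N f ψ = ∑ j ∈ Finset.range (N + 1), f (blk φ j ψ) := by
  rw [lowFreq_apply, ← sum_blk, map_sum]

theorem tendsto_inv_two_pow : Tendsto (fun N : ℕ => ((2 : ℝ) ^ N)⁻¹) atTop (𝓝[≥] 0) :=
  tendsto_nhdsWithin_iff.2 ⟨tendsto_inv_atTop_zero.comp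
    (tendsto_pow_atTop_atTop_of_one_lt one_lt_two),
    Eventually.of_forall fun n => by simp only [mem_Ici]; positivity⟩

theorem tendsto_lowS (φ : DyadicCutoff d) (ψ : 𝓢(Rd d, ℂ)) :
    Tendsto (fun N => lowS φ N ψ) atTop (𝓝 ψ) := by
  have := (tendsto_mult_dil (cut φ) ψ).comp tendsto_inv_two_pow
  rwa [cut_zero, one_smul] at this

theorem tendsto_sum_blk (φ : DyadicCutoff d) (f : 𝓢'(Rd d, ℂ)) (ψ : 𝓢(Rd d, ℂ)) :
    Tendsto (fun N => ∑ j ∈ Finset.range (N + 1), f (blk φ j ψ)) atTop (𝓝 (f ψ)) := by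
  refine ((f.continuous.tendsto ψ).comp (tendsto_lowS φ ψ)).congr fun N => ?_
  rw [← lowFreq_apply_eq_sum, lowFreq_apply]
  rfl

/-- The partial sums tend to `f ψ` for every tempered distribution, because the telescoped symbols
`φ₀(2^{-N} ·)` tend to multiplication by one. Summable bounds make the convergence absolute. -/
theorem hasSum_blk {c : ℕ → ℝ} (hc : Summable c) {f : 𝓢'(Rd d, ℂ)} {ψ : 𝓢(Rd d, ℂ)}
    (h : ∀ j, ‖f (blk φ j ψ)‖ ≤ c j) : HasSum (fun j => f (blk φ j ψ)) (f ψ) := by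
  have hs : Summable fun j => f (blk φ j ψ) := .of_norm_bounded hc h
  have h1 := hs.hasSum.tendsto_sum_nat.comp (tendsto_add_atTop_nat 1)
  rw [← tendsto_nhds_unique h1 (tendsto_sum_blk φ f ψ)]
  exact hs.hasSum

theorem norm_apply_le_tsum {c : ℕ → ℝ} (hc : Summable c) {f : 𝓢'(Rd d, ℂ)} {ψ : 𝓢(Rd d, ℂ)}
    (h : ∀ j, ‖f (blk φ j ψ)‖ ≤ c j) : ‖f ψ‖ ≤ ∑' j, c j :=
  (hasSum_blk hc h).norm_le_of_bounded hc.hasSum h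

theorem two_rpow_neg_mul (a : ℝ) (j : ℕ) : (2 : ℝ) ^ (-(a * j)) = ((2 : ℝ) ^ (-a)) ^ j := by
  rw [← Real.rpow_natCast, ← Real.rpow_mul zero_le_two]; congr 1; ring

theorem two_rpow_neg_lt_one {a : ℝ} (ha : 0 < a) : (2 : ℝ) ^ (-a) < 1 :=
  Real.rpow_lt_one_of_one_lt_of_neg one_lt_two (by linarith)

theorem summable_two_rpow {a : ℝ} (ha : 0 < a) : Summable fun j : ℕ => (2 : ℝ) ^ (-(a * j)) := by
  simp only [two_rpow_neg_mul]
  exact summable_geometric_of_lt_one (by positivity) (two_rpow_neg_lt_one ha)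

/-- The sum of the geometric series `2^{-aj}`. -/
def geo (a : ℝ) : ℝ := ∑' j : ℕ, (2 : ℝ) ^ (-(a * j))

theorem geo_nonneg (a : ℝ) : 0 ≤ geo a := tsum_nonneg fun _ => by positivity

/-- Elements of `𝓒^γ` act on functions with an `L¹` modulus of continuity of order `a > -γ`. -/
theorem HasBound.apply_le (hA : 0 ≤ A) (hf : HasBound φ γ A f) {a N : ℝ} (ha : 0 ≤ a)
    (ha1 : a ≤ 1) (hγ : 0 < γ + a) {h : 𝓢(Rd d, ℂ)} (hN0 : 0 ≤ N) (hN : HasModulus a N h) :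
    ‖f h‖ ≤ geo (γ + a) * Kc φ * A * (l1 h + N) := by
  have hl := l1_nonneg h
  have hK := Kc_nonneg φ
  have hb : ∀ j, ‖f (blk φ j h)‖ ≤ A * Kc φ * (l1 h + N) * 2 ^ (-((γ + a) * j)) := by
    intro j
    rcases eq_or_ne j 0 with rfl | hj
    · have h0 := (hf.apply_blk_le 0 h).trans
        (mul_le_mul_of_nonneg_left (l1_fat_le φ h 0) (by positivity))
      simp only [Nat.cast_zero, mul_zero, neg_zero, Real.rpow_zero, mul_one] at h0 ⊢
      refine h0.trans ?_
      rw [← mul_assoc]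
      gcongr
      linarith
    · refine (hf.apply_blk_small hA hj ha ha1 hN0 hN).trans ?_
      gcongr
      linarith
  refine (norm_apply_le_tsum ((summable_two_rpow hγ).mul_left _) hb).trans (le_of_eq ?_)
  rw [tsum_mul_left, geo]; ring

theorem hasModulus_zero (h : 𝓢(Rd d, ℂ)) : HasModulus 0 (2 * l1 h) h := fun y => by
  have := l1_sub_le (h.integrable.comp_sub_right y) (h.integrable (μ := volume))
  rw [l1_comp_sub] at this
  rw [Real.rpow_zero]
  linarith

theorem HasBound.apply_le_l1 (hA : 0 ≤ A) (hf : HasBound φ γ A f) (hγ : 0 < γ) (h : 𝓢(Rd d, ℂ)) :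
    ‖f h‖ ≤ 3 * geo γ * Kc φ * A * l1 h := by
  have := hf.apply_le hA le_rfl zero_le_one (by simpa using hγ) (by have := l1_nonneg h; positivity)
    (hasModulus_zero h)
  rw [add_zero] at this
  linarith

end HasBound

/-! ### Embedding of `𝓒^α` into Hölder functions -/

theorem summable_two_rpow_abs {δ : ℝ} (hδ : 0 < δ) :
    Summable fun n : ℤ => (2 : ℝ) ^ (-(δ * |(n : ℝ)|)) := by
  refine Summable.of_nat_of_neg ?_ ?_
  · simpa using summable_two_rpow hδ
  · simpa using summable_two_rpow hδ

/-- The sum of the two-sided geometric series `2^{-δ|n|}`. -/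
def geoZ (δ : ℝ) : ℝ := ∑' n : ℤ, (2 : ℝ) ^ (-(δ * |(n : ℝ)|))

theorem geoZ_nonneg (δ : ℝ) : 0 ≤ geoZ δ := tsum_nonneg fun _ => by positivity

theorem summable_two_rpow_abs_sub {δ : ℝ} (hδ : 0 < δ) (i : ℕ) :
    Summable fun j : ℕ => (2 : ℝ) ^ (-(δ * |(j : ℝ) - i|)) := by
  have h : Function.Injective fun j : ℕ => (j : ℤ) - i := fun a b h => by simpa using h
  simpa [Function.comp_def] using (summable_two_rpow_abs hδ).comp_injective h

theorem tsum_two_rpow_abs_sub_le {δ : ℝ} (hδ : 0 < δ) (i : ℕ) :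
    ∑' j : ℕ, (2 : ℝ) ^ (-(δ * |(j : ℝ) - i|)) ≤ geoZ δ := by
  have h : Function.Injective fun j : ℕ => (j : ℤ) - i := fun a b h => by simpa using h
  have := tsum_comp_le_tsum_of_inj (summable_two_rpow_abs hδ) (fun n => by positivity) h
  simpa [Function.comp_def, geoZ] using this

/-- `J` is the dyadic scale with `2^{-(J+1)} < r ≤ 2^{-J}`. Above `J` the factor `2^{-αj}` decays,
below `J` the factor `2^{(1-α)j} r` does; both meet at a value of order `r^α`. -/
theorem exists_dyadic_bound {α r : ℝ} (hα : 0 < α) (hα1 : α < 1) (hr : 0 < r) (hr1 : r ≤ 1) :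
    ∃ J : ℕ, ∀ j : ℕ, (2 : ℝ) ^ (-(α * j)) * min 1 (2 ^ j * r) ≤
      2 * r ^ α * 2 ^ (-(min α (1 - α) * |(j : ℝ) - J|)) := by
  obtain ⟨J, hJ1, hJ2⟩ := exists_nat_pow_near_of_lt_one hr hr1 (y := (1 / 2 : ℝ))
    (by norm_num) (by norm_num)
  have e : ∀ n : ℕ, (1 / 2 : ℝ) ^ n = 2 ^ (-(n : ℝ)) := fun n => by
    rw [Real.rpow_neg zero_le_two, Real.rpow_natCast, one_div, inv_pow]
  rw [e] at hJ1 hJ2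
  have h1 : (2 : ℝ) ^ (-(α * J)) ≤ 2 * r ^ α := by
    have : (2 : ℝ) ^ (-(α * J)) = 2 ^ α * (2 ^ (-((J + 1 : ℕ) : ℝ))) ^ α := by
      rw [← Real.rpow_mul zero_le_two, ← Real.rpow_add two_pos]
      congr 1; push_cast; ring
    rw [this]
    have h2 : (2 : ℝ) ^ α ≤ 2 := by
      calc (2 : ℝ) ^ α ≤ 2 ^ (1 : ℝ) := Real.rpow_le_rpow_of_exponent_le one_le_two hα1.le
        _ = 2 := Real.rpow_one 2
    gcongr
  refine ⟨J, fun j => ?_⟩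
  have key : (2 : ℝ) ^ (-(α * j)) * min 1 (2 ^ j * r) ≤
      2 ^ (-(α * J)) * 2 ^ (-(min α (1 - α) * |(j : ℝ) - J|)) := by
    rcases le_total J j with h | h
    · have hc : (J : ℝ) ≤ j := by exact_mod_cast h
      calc _ ≤ (2 : ℝ) ^ (-(α * j)) * 1 := by gcongr; exact min_le_left _ _
        _ = 2 ^ (-(α * J)) * 2 ^ (-(α * (j - J))) := by
            rw [mul_one, ← Real.rpow_add two_pos]; congr 1; ring
        _ ≤ _ := by
            rw [abs_of_nonneg (by linarith)]
            have h0 : 0 ≤ (j : ℝ) - J := by linarith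
            gcongr
            · exact one_le_two
            exact min_le_left _ _
    · have hc : (j : ℝ) ≤ J := by exact_mod_cast h
      calc _ ≤ (2 : ℝ) ^ (-(α * j)) * (2 ^ j * 2 ^ (-(J : ℝ))) := by
            gcongr
            exact (min_le_right _ _).trans (by gcongr)
        _ = 2 ^ (-(α * J)) * 2 ^ (-((1 - α) * (J - j))) := by
            rw [← Real.rpow_natCast, ← Real.rpow_add two_pos, ← Real.rpow_add two_pos,
              ← Real.rpow_add two_pos]
            congr 1; ring
        _ ≤ _ := by
            rw [abs_of_nonpos (by linarith), neg_sub]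
            have h0 : 0 ≤ (J : ℝ) - j := by linarith
            gcongr
            · exact one_le_two
            exact min_le_right _ _
  exact key.trans (by gcongr)

/-- For small `y`, the increment of a block costs `min 1 (2^j ‖y‖)`, from its moduli of order zero
and one. Weighted with `2^{-αj}` this is geometric in both directions around the scale of `y`. For
`‖y‖ ≥ 1` the `L^∞` bound is enough. -/
theorem HasBound.apply_translation_le {α A : ℝ} {f : 𝓢'(Rd d, ℂ)} (hA : 0 ≤ A)
    (hf : HasBound φ α A f) (hα : 0 < α) (hα1 : α < 1) (ψ : 𝓢(Rd d, ℂ)) (y : Rd d) :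
    ‖f (SchwartzMap.compSubConstCLM ℂ y ψ - ψ)‖ ≤
      (6 * geo α + 2 * geoZ (min α (1 - α))) * Kc φ * A * ‖y‖ ^ α * l1 ψ := by
  have hK := Kc_nonneg φ
  have hl := l1_nonneg ψ
  have hg := geo_nonneg α
  have hgz := geoZ_nonneg (min α (1 - α))
  rcases eq_or_ne y 0 with rfl | hy
  · have : SchwartzMap.compSubConstCLM ℂ (0 : Rd d) ψ - ψ = 0 := by
      rw [SchwartzMap.compSubConstCLM_zero]; simp
    rw [this, map_zero, norm_zero]
    positivity
  have hy0 : 0 < ‖y‖ := norm_pos_iff.2 hy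
  rcases le_total ‖y‖ 1 with hy1 | hy1
  · obtain ⟨J, hJ⟩ := exists_dyadic_bound hα hα1 hy0 hy1
    have hδ : 0 < min α (1 - α) := lt_min hα (by linarith)
    have hb : ∀ j, ‖f (blk φ j (SchwartzMap.compSubConstCLM ℂ y ψ - ψ))‖ ≤
        (A * Kc φ * l1 ψ * (2 * ‖y‖ ^ α)) * 2 ^ (-(min α (1 - α) * |(j : ℝ) - J|)) := by
      intro j
      refine (hf.apply_blk_le j _).trans ?_
      have h1 : l1 (fat φ j (SchwartzMap.compSubConstCLM ℂ y ψ - ψ)) =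
          l1 (fun x => fat φ j ψ (x - y) - fat φ j ψ x) := by
        rw [map_sub, fat, mult_dil_comp_sub]
        rfl
      have h2 := modulus_fat φ ψ j le_rfl zero_le_one y
      have h3 := modulus_fat φ ψ j zero_le_one le_rfl y
      rw [Real.rpow_zero, zero_mul, Real.rpow_zero, mul_one, mul_one] at h2
      rw [one_mul, Real.rpow_one, Real.rpow_natCast] at h3
      have h4 : l1 (fun x => fat φ j ψ (x - y) - fat φ j ψ x) ≤
          Kc φ * l1 ψ * min 1 (2 ^ j * ‖y‖) := by
        rw [mul_min_of_nonneg _ _ (by positivity), le_min_iff]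
        exact ⟨by linarith, by linarith⟩
      rw [h1]
      calc _ ≤ A * 2 ^ (-(α * j)) * (Kc φ * l1 ψ * min 1 (2 ^ j * ‖y‖)) := by gcongr
        _ = A * Kc φ * l1 ψ * (2 ^ (-(α * j)) * min 1 (2 ^ j * ‖y‖)) := by ring
        _ ≤ A * Kc φ * l1 ψ * (2 * ‖y‖ ^ α * 2 ^ (-(min α (1 - α) * |(j : ℝ) - J|))) := by
            exact mul_le_mul_of_nonneg_left (hJ j) (by positivity)
        _ = _ := by ring
    refine (norm_apply_le_tsum ((summable_two_rpow_abs_sub hδ J).mul_left _) hb).trans ?_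
    rw [tsum_mul_left]
    calc _ ≤ (A * Kc φ * l1 ψ * (2 * ‖y‖ ^ α)) * geoZ (min α (1 - α)) := by
          gcongr
          exact tsum_two_rpow_abs_sub_le hδ J
      _ = (0 + 2 * geoZ (min α (1 - α))) * Kc φ * A * ‖y‖ ^ α * l1 ψ := by ring
      _ ≤ _ := by gcongr; positivity
  · have h1 := hf.apply_le_l1 hA hα (SchwartzMap.compSubConstCLM ℂ y ψ - ψ)
    have h2 : l1 (SchwartzMap.compSubConstCLM ℂ y ψ - ψ) ≤ 2 * l1 ψ := by
      have := hasModulus_zero ψ y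
      rwa [Real.rpow_zero, mul_one] at this
    have h3 : 1 ≤ ‖y‖ ^ α := Real.one_le_rpow hy1 hα.le
    calc _ ≤ 3 * geo α * Kc φ * A * (2 * l1 ψ) := h1.trans (by gcongr)
      _ = (6 * geo α + 0) * Kc φ * A * 1 * l1 ψ := by ring
      _ ≤ _ := by gcongr; positivity

/-- Boundedness and Hölder continuity, with the same constant. -/
def HolderBound {G : Type*} [NormedAddCommGroup G] (α A : ℝ) (v : Rd d → G) : Prop :=
  (∀ x, ‖v x‖ ≤ A) ∧ ∀ x y, ‖v x - v y‖ ≤ A * ‖x - y‖ ^ α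

theorem HolderBound.continuous {G : Type*} [NormedAddCommGroup G] {α A : ℝ} (hα : 0 < α)
    {v : Rd d → G} (hv : HolderBound α A v) : Continuous v := by
  rw [continuous_iff_continuousAt]
  intro x
  rw [ContinuousAt, tendsto_iff_norm_sub_tendsto_zero]
  have h : Tendsto (fun y => A * ‖y - x‖ ^ α) (𝓝 x) (𝓝 0) := by
    have h1 : Continuous fun y : Rd d => A * ‖y - x‖ ^ α :=
      continuous_const.mul ((by fun_prop : Continuous fun y : Rd d => ‖y - x‖).rpow_const
        fun _ => Or.inr hα.le)
    have := h1.tendsto x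
    simpa [Real.zero_rpow hα.ne'] using this
  exact squeeze_zero (fun _ => norm_nonneg _) (fun y => hv.2 y x) h

theorem HolderBound.mono {G : Type*} [NormedAddCommGroup G] {α A B : ℝ} {v : Rd d → G}
    (hv : HolderBound α A v) (h : A ≤ B) : HolderBound α B v :=
  ⟨fun x => (hv.1 x).trans h, fun x y => (hv.2 x y).trans (by gcongr)⟩

/-- A distribution with the bounds of a Hölder function is a Hölder function. -/
theorem exists_holder {f : 𝓢'(Rd d, ℂ)} (hreal : IsRealDistribution f) {α A : ℝ} (hα : 0 < α)
    (h1 : ∀ ψ, ‖f ψ‖ ≤ A * l1 ψ)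
    (h2 : ∀ ψ y, ‖f (SchwartzMap.compSubConstCLM ℂ y ψ - ψ)‖ ≤ A * ‖y‖ ^ α * l1 ψ) :
    ∃ v : Rd d → ℝ, HolderBound α A v ∧ IsGivenBy f fun x => (v x : ℂ) := by
  obtain ⟨g, hgm, hgb, hfg, hlim⟩ := exists_linfty h1
  have hA : 0 ≤ A := by
    have := (norm_nonneg _).trans (h1 (moll 0 0))
    rwa [l1_moll, mul_one] at this
  set V : ℕ → Rd d → ℂ := fun n x => f (moll n x) with hV
  have hVim : ∀ n x, (V n x).im = 0 := fun n x => hreal _ fun t => by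
    rw [moll_apply, Complex.ofReal_im]
  have hVb : ∀ n x, ‖V n x‖ ≤ A := fun n x => by
    have := h1 (moll n x)
    rwa [l1_moll, mul_one] at this
  have hVh : ∀ n x y, ‖V n x - V n y‖ ≤ A * ‖x - y‖ ^ α := fun n x y => by
    have := h2 (moll n y) (x - y)
    rwa [moll_compSub, l1_moll, mul_one, map_sub, add_sub_cancel] at this
  -- The mollified values converge almost everywhere, hence on a dense set. They are Hölder
  -- uniformly in `n`, so convergence spreads to every point and the limit inherits the Hölder
  -- bound.
  have hdense : Dense {x | Tendsto (fun n => V n x) atTop (𝓝 (g x))} :=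
    Measure.dense_of_ae hlim
  have hcauchy : ∀ x, CauchySeq fun n => V n x := by
    intro x
    rw [Metric.cauchySeq_iff]
    intro ε hε
    have h3 : Tendsto (fun y => A * ‖x - y‖ ^ α) (𝓝 x) (𝓝 0) := by
      have h1 : Continuous fun y : Rd d => A * ‖x - y‖ ^ α :=
        continuous_const.mul ((by fun_prop : Continuous fun y : Rd d => ‖x - y‖).rpow_const
          fun _ => Or.inr hα.le)
      have := h1.tendsto x
      simpa [Real.zero_rpow hα.ne'] using this
    obtain ⟨z, hzl, hz⟩ := hdense.inter_nhds_nonempty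
      (h3.eventually_lt_const (show (0 : ℝ) < ε / 3 by positivity))
    have hzl' : Tendsto (fun n => V n z) atTop (𝓝 (g z)) := hzl
    obtain ⟨N, hN⟩ := Metric.cauchySeq_iff.1 hzl'.cauchySeq (ε / 3) (by positivity)
    refine ⟨N, fun m hm n hn => ?_⟩
    have h4 := hN m hm n hn
    have hz' : A * ‖x - z‖ ^ α < ε / 3 := hz
    have h5 := hVh m x z
    have h6 := hVh n z x
    rw [norm_sub_rev z x] at h6
    rw [dist_eq_norm] at h4 ⊢
    calc ‖V m x - V n x‖ = ‖(V m x - V m z) + (V m z - V n z) + (V n z - V n x)‖ := by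
          congr 1; ring
      _ ≤ ‖V m x - V m z‖ + ‖V m z - V n z‖ + ‖V n z - V n x‖ := norm_add₃_le
      _ < ε := by linarith
  choose w hw using fun x => cauchySeq_tendsto_of_complete (hcauchy x)
  have hwim : ∀ x, ((w x).re : ℂ) = w x := fun x => by
    have h3 : Tendsto (fun n => (V n x).im) atTop (𝓝 (w x).im) :=
      (Complex.continuous_im.tendsto _).comp (hw x)
    simp only [hVim] at h3
    have := tendsto_nhds_unique h3 tendsto_const_nhds
    exact Complex.ext (by simp) (by simp [this])
  refine ⟨fun x => (w x).re, ⟨fun x => ?_, fun x y => ?_⟩, ?_⟩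
  · refine (Complex.abs_re_le_norm _).trans (le_of_tendsto (hw x).norm (.of_forall fun n => hVb n x))
  · rw [← Complex.sub_re]
    exact (Complex.abs_re_le_norm _).trans
      (le_of_tendsto ((hw x).sub (hw y)).norm (.of_forall fun n => hVh n x y))
  · have hae : ∀ᵐ x, w x = g x := by
      filter_upwards [hlim] with x hx
      exact tendsto_nhds_unique (hw x) hx
    intro ψ
    have hae2 : (fun x => ψ x * g x) =ᵐ[volume] fun x => ψ x * ((w x).re : ℂ) := by
      filter_upwards [hae] with x hx
      rw [hwim, hx]
    exact ⟨(hfg ψ).1.congr hae2, (hfg ψ).2.trans (integral_congr_ae hae2)⟩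

/-- The function inducing a distribution is unique among continuous functions. -/
theorem IsGivenBy.eq_of_continuous {f : 𝓢'(Rd d, ℂ)} {g h : Rd d → ℂ} (hg : IsGivenBy f g)
    (hh : IsGivenBy f h) (hgc : Continuous g) (hhc : Continuous h) : g = h := by
  have h1 : (fun x => g x - h x) =ᵐ[volume] 0 := by
    refine ae_eq_zero_of_integral_contDiff_smul_eq_zero (hgc.sub hhc).locallyIntegrable ?_
    intro η hη hηc
    have hη₁ : HasCompactSupport (Complex.ofRealCLM ∘ η) := hηc.comp_left rfl
    have hη₂ : ContDiff ℝ ∞ (Complex.ofRealCLM ∘ η) := by fun_prop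
    set ψ := hη₁.toSchwartzMap hη₂
    have h3 : ∀ x, ψ x = (η x : ℂ) := fun x => rfl
    have h2 := (hg ψ).2.symm.trans (hh ψ).2
    rw [← sub_eq_zero, ← integral_sub (hg ψ).1 (hh ψ).1] at h2
    rw [← h2]
    refine integral_congr_ae (ae_of_all _ fun x => ?_)
    simp only [h3, Complex.real_smul]
    ring
  have h2 : (fun x => g x - h x) = 0 :=
    (hgc.sub hhc).ae_eq_iff_eq volume continuous_const |>.1 h1
  ext x
  exact sub_eq_zero.1 (congrFun h2 x)

/-! ### Gradients -/

/-- The constant in Bernstein's inequality. -/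
def gradC (φ : DyadicCutoff d) (i : Fin d) : ℝ :=
  l1 (ft (derivSymbol (EuclideanSpace.single i 1) (fatS φ 0))) +
    l1 (ft (derivSymbol (EuclideanSpace.single i 1) (fatS φ 1)))

theorem gradC_nonneg (φ : DyadicCutoff d) (i : Fin d) : 0 ≤ gradC φ i :=
  add_nonneg (l1_nonneg _) (l1_nonneg _)

theorem lineDeriv_apply (e : Rd d) (u : 𝓢'(Rd d, ℂ)) (ψ : 𝓢(Rd d, ℂ)) :
    (∂_{e} u) ψ = -(u (∂_{e} ψ)) := by
  rw [TemperedDistribution.lineDerivOp_apply_apply, map_neg]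

/-- Bernstein's inequality: a fat block is inserted to carry the derivative, which costs `2^j`. Two
profiles occur, hence the two terms of `gradC`. -/
theorem HasBound.lineDeriv {γ A : ℝ} {u : 𝓢'(Rd d, ℂ)} (hA : 0 ≤ A) (hu : HasBound φ (γ + 1) A u)
    (i : Fin d) : HasBound φ γ (gradC φ i * A) (∂_{(EuclideanSpace.single i (1 : ℝ) : Rd d)} u) := by
  intro j ψ
  set e : Rd d := EuclideanSpace.single i 1
  have h1 : ∂_{e} (blk φ j ψ) =
      ((((2 : ℝ) ^ j)⁻¹ : ℝ)⁻¹ : ℂ) • blk φ j (mult (dil (derivSymbol e (fatS φ j)) ((2 : ℝ) ^ j)⁻¹) ψ) := by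
    have : blk φ j ψ = fat φ j (blk φ j ψ) := by
      rw [fat, blk, mult_dil_comm]
      exact (blk_fat φ j ψ).symm
    rw [this, fat, lineDeriv_mult_dil e _ _ (by positivity), blk, mult_dil_comm]
  rw [lineDeriv_apply, norm_neg, h1, map_smul, norm_smul]
  have h2 : l1 (ft (derivSymbol e (fatS φ j))) ≤ gradC φ i := by
    cases j with
    | zero => rw [gradC]; linarith [l1_nonneg (ft (derivSymbol e (fatS φ 1)))]
    | succ j => rw [gradC]; exact le_add_of_nonneg_left (l1_nonneg _)
  have h3 := (l1_mult_dil_le (derivSymbol e (fatS φ j)) ψ ((2 : ℝ) ^ j)⁻¹).trans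
    (mul_le_mul_of_nonneg_right h2 (l1_nonneg ψ))
  have h4 : ‖((((2 : ℝ) ^ j)⁻¹ : ℝ)⁻¹ : ℂ)‖ = 2 ^ ((1 : ℝ) * j) := by
    rw [one_mul, Real.rpow_natCast]
    simp
  rw [h4]
  have h5 : (2 : ℝ) ^ ((1 : ℝ) * j) * 2 ^ (-((γ + 1) * j)) = 2 ^ (-(γ * j)) := by
    rw [← Real.rpow_add two_pos]; congr 1; ring
  calc _ ≤ (2 : ℝ) ^ ((1 : ℝ) * j) * (A * 2 ^ (-((γ + 1) * j)) * (gradC φ i * l1 ψ)) := by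
        gcongr
        refine (hu j _).trans ?_
        gcongr
    _ = gradC φ i * A * (2 ^ ((1 : ℝ) * j) * 2 ^ (-((γ + 1) * j))) * l1 ψ := by ring
    _ = _ := by rw [h5]

theorem IsRealDistribution.lineDeriv {u : 𝓢'(Rd d, ℂ)} (hu : IsRealDistribution u) (e : Rd d) :
    IsRealDistribution (∂_{e} u) := by
  intro ψ hψ
  rw [lineDeriv_apply, Complex.neg_im, hu, neg_zero]
  intro x
  rw [SchwartzMap.lineDerivOp_apply_eq_fderiv]
  have h1 : HasFDerivAt (fun x => (ψ x).im) (Complex.imCLM.comp (fderiv ℝ ψ x)) x :=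
    Complex.imCLM.hasFDerivAt.comp x (ψ.hasFDerivAt x)
  simp only [hψ] at h1
  have := h1.unique (hasFDerivAt_const 0 x)
  exact congrArg (fun L : Rd d →L[ℝ] ℝ => L e) this

theorem IsRealDistribution.sub {f g : 𝓢'(Rd d, ℂ)} (hf : IsRealDistribution f)
    (hg : IsRealDistribution g) : IsRealDistribution (f - g) := fun ψ hψ => by
  have : (f - g) ψ = f ψ - g ψ := rfl
  rw [this, Complex.sub_im, hf ψ hψ, hg ψ hψ, sub_zero]

/-- The constant in the embedding of `𝓒^α` into the Hölder space. -/
def holderC (φ : DyadicCutoff d) (α : ℝ) : ℝ := (6 * geo α + 2 * geoZ (min α (1 - α))) * Kc φ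

theorem holderC_nonneg (φ : DyadicCutoff d) (α : ℝ) : 0 ≤ holderC φ α := by
  have := geo_nonneg α; have := geoZ_nonneg (min α (1 - α)); have := Kc_nonneg φ
  rw [holderC]; positivity

theorem HasBound.exists_holder {α A : ℝ} {f : 𝓢'(Rd d, ℂ)} (hreal : IsRealDistribution f)
    (hA : 0 ≤ A) (hf : HasBound φ α A f) (hα : 0 < α) (hα1 : α < 1) :
    ∃ v : Rd d → ℝ, HolderBound α (holderC φ α * A) v ∧ IsGivenBy f fun x => (v x : ℂ) := by
  refine SingularPDE.exists_holder hreal hα (fun ψ => ?_)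
    (fun ψ y => hf.apply_translation_le hA hα hα1 ψ y)
  refine (hf.apply_le_l1 hA hα ψ).trans ?_
  have := geo_nonneg α; have := geoZ_nonneg (min α (1 - α)); have := Kc_nonneg φ
  have := l1_nonneg ψ
  rw [holderC]
  gcongr
  linarith

/-- The constant in the estimate of the gradient. -/
def gradHC (φ : DyadicCutoff d) (α : ℝ) : ℝ := ∑ i, holderC φ α * gradC φ i

theorem gradHC_nonneg (φ : DyadicCutoff d) (α : ℝ) : 0 ≤ gradHC φ α :=
  Finset.sum_nonneg fun i _ => mul_nonneg (holderC_nonneg φ α) (gradC_nonneg φ i)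

/-- `v` is the gradient of `u`. -/
def IsGrad (u : 𝓢'(Rd d, ℂ)) (v : Rd d → Rd d) : Prop :=
  Continuous v ∧ ∀ i : Fin d, IsGivenBy (∂_{(EuclideanSpace.single i (1 : ℝ) : Rd d)} u)
    (fun x => ((v x i : ℝ) : ℂ))

theorem IsGrad.unique {u : 𝓢'(Rd d, ℂ)} {v w : Rd d → Rd d} (hv : IsGrad u v) (hw : IsGrad u w) :
    v = w := by
  ext x i
  have h := (hv.2 i).eq_of_continuous (hw.2 i)
    (Complex.continuous_ofReal.comp ((EuclideanSpace.proj i).continuous.comp hv.1))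
    (Complex.continuous_ofReal.comp ((EuclideanSpace.proj i).continuous.comp hw.1))
  exact_mod_cast congrFun h x

theorem IsGivenBy.sub {f g : 𝓢'(Rd d, ℂ)} {a b : Rd d → ℂ} (hf : IsGivenBy f a)
    (hg : IsGivenBy g b) : IsGivenBy (f - g) fun x => a x - b x := fun ψ => by
  have h1 : ∀ x, ψ x * (a x - b x) = ψ x * a x - ψ x * b x := fun x => mul_sub _ _ _
  have h2 : (f - g) ψ = f ψ - g ψ := rfl
  simp only [h1]
  exact ⟨(hf ψ).1.sub (hg ψ).1, by rw [h2, integral_sub (hf ψ).1 (hg ψ).1, (hf ψ).2, (hg ψ).2]⟩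

theorem IsGrad.sub {u u' : 𝓢'(Rd d, ℂ)} {v v' : Rd d → Rd d} (hv : IsGrad u v)
    (hv' : IsGrad u' v') : IsGrad (u - u') fun x => v x - v' x := by
  refine ⟨hv.1.sub hv'.1, fun i => ?_⟩
  have h : (∂_{(EuclideanSpace.single i (1 : ℝ) : Rd d)} (u - u')) =
      ∂_{(EuclideanSpace.single i (1 : ℝ) : Rd d)} u -
        ∂_{(EuclideanSpace.single i (1 : ℝ) : Rd d)} u' := by
    ext ψ
    have h2 : ∀ f g : 𝓢'(Rd d, ℂ), (f - g) ψ = f ψ - g ψ := fun f g => rfl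
    have h3 : ∀ χ, (u - u') χ = u χ - u' χ := fun χ => rfl
    rw [h2, lineDeriv_apply, lineDeriv_apply, lineDeriv_apply, h3]
    ring
  rw [h]
  have := (hv.2 i).sub (hv'.2 i)
  simpa using this

theorem norm_le_sum_abs (x : Rd d) : ‖x‖ ≤ ∑ i, |x i| := by
  have h : x = ∑ i, x i • (EuclideanSpace.single i (1 : ℝ) : Rd d) := by
    ext j
    simp [Pi.single_apply]
  conv_lhs => rw [h]
  refine (norm_sum_le _ _).trans (le_of_eq ?_)
  simp [norm_smul]

theorem HasBound.exists_grad {α A : ℝ} {u : 𝓢'(Rd d, ℂ)} (hreal : IsRealDistribution u)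
    (hA : 0 ≤ A) (hu : HasBound φ (α + 1) A u) (hα : 0 < α) (hα1 : α < 1) :
    ∃ v : Rd d → Rd d, IsGrad u v ∧ HolderBound α (gradHC φ α * A) v := by
  have h1 := fun i => (hu.lineDeriv hA i).exists_holder (hreal.lineDeriv _)
    (mul_nonneg (gradC_nonneg φ i) hA) hα hα1
  choose w hw hwu using h1
  set v : Rd d → Rd d := fun x => WithLp.toLp 2 fun i => w i x with hv
  have hH : HolderBound α (gradHC φ α * A) v := by
    constructor
    · intro x
      refine (norm_le_sum_abs _).trans ?_
      rw [gradHC, Finset.sum_mul]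
      refine Finset.sum_le_sum fun i _ => ?_
      have := (hw i).1 x
      rw [← mul_assoc] at this
      exact this
    · intro x y
      refine (norm_le_sum_abs _).trans ?_
      rw [gradHC, Finset.sum_mul, Finset.sum_mul]
      refine Finset.sum_le_sum fun i _ => ?_
      have := (hw i).2 x y
      rw [← mul_assoc] at this
      exact this
  exact ⟨v, ⟨hH.continuous hα, hwu⟩, hH⟩

theorem IsGrad.holderBound {α A : ℝ} {u : 𝓢'(Rd d, ℂ)} {v : Rd d → Rd d} (hv : IsGrad u v)
    (hreal : IsRealDistribution u) (hA : 0 ≤ A) (hu : HasBound φ (α + 1) A u) (hα : 0 < α)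
    (hα1 : α < 1) : HolderBound α (gradHC φ α * A) v := by
  obtain ⟨w, hw, hwH⟩ := hu.exists_grad hreal hA hα hα1
  rwa [hv.unique hw]

/-! ### Regularization by convolution -/

section convolution

set_option linter.unusedSectionVars false

/-- The convolution of a bounded function with a reflected Schwartz kernel. -/
def corr {G : Type} [NormedAddCommGroup G] [NormedSpace ℝ G] [NormedSpace ℂ G]
    (f : Rd d → ℂ) (K : 𝓢(Rd d, G)) (z : Rd d) : G :=
  ∫ w, f w • K (w - z)

variable {G : Type} [NormedAddCommGroup G] [NormedSpace ℝ G] [NormedSpace ℂ G] [CompleteSpace G]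
  [SMulCommClass ℝ ℂ G] {f : Rd d → ℂ} {A : ℝ}

/-- The domination needed to differentiate under the integral sign, uniform for `z` near `z₀`. The
power `d + 1` exceeds the dimension, which makes the bound integrable. -/
theorem schwartz_decay_translate (K : 𝓢(Rd d, G)) (z₀ : Rd d) :
    ∃ b : Rd d → ℝ, Integrable b ∧ ∀ w, ∀ z ∈ Metric.ball z₀ 1, ‖K (w - z)‖ ≤ b w := by
  set n : ℕ := d + 1
  obtain ⟨C, hC⟩ : ∃ C, ∀ x, (1 + ‖x‖) ^ n * ‖K x‖ ≤ C := by
    have h := fun x => SchwartzMap.one_add_le_sup_seminorm_apply (𝕜 := ℝ) (m := (n, 0))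
      le_rfl le_rfl K x
    simp only [norm_iteratedFDeriv_zero] at h
    exact ⟨_, h⟩
  have hC0 : 0 ≤ C := le_trans (by positivity) (hC 0)
  refine ⟨fun w => C * 2 ^ n * (1 + ‖w - z₀‖) ^ (-(n : ℝ)), ?_, fun w z hz => ?_⟩
  · have h : Integrable fun w : Rd d => (1 + ‖w‖) ^ (-(n : ℝ)) :=
      integrable_one_add_norm (by simp [n])
    exact (h.comp_sub_right z₀).const_mul _
  · have h1 : (1 + ‖w - z₀‖) ≤ 2 * (1 + ‖w - z‖) := by
      have : ‖w - z₀‖ ≤ ‖w - z‖ + ‖z - z₀‖ := by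
        simpa using norm_add_le (w - z) (z - z₀)
      rw [mem_ball_iff_norm] at hz
      linarith [norm_nonneg (w - z)]
    have h2 := hC (w - z)
    beta_reduce
    rw [Real.rpow_neg (by positivity), Real.rpow_natCast, ← div_eq_mul_inv,
      le_div_iff₀ (by positivity)]
    calc ‖K (w - z)‖ * (1 + ‖w - z₀‖) ^ n ≤ ‖K (w - z)‖ * (2 * (1 + ‖w - z‖)) ^ n := by gcongr
      _ = ((1 + ‖w - z‖) ^ n * ‖K (w - z)‖) * 2 ^ n := by rw [mul_pow]; ring
      _ ≤ _ := by gcongr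

theorem integrable_corr (hf : Continuous f) (hA : ∀ x, ‖f x‖ ≤ A) (K : 𝓢(Rd d, G)) (z : Rd d) :
    Integrable fun w => f w • K (w - z) :=
  (K.integrable.comp_sub_right z).bdd_smul A hf.aestronglyMeasurable (ae_of_all _ hA)

theorem norm_corr_le (hA : ∀ x, ‖f x‖ ≤ A) (K : 𝓢(Rd d, G)) (z : Rd d) :
    ‖corr f K z‖ ≤ A * ∫ w, ‖K w‖ := by
  refine (norm_integral_le_integral_norm _).trans ?_
  rw [← integral_sub_right_eq_self (fun w => ‖K w‖) z, ← integral_const_mul]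
  refine integral_mono_of_nonneg (ae_of_all _ fun _ => norm_nonneg _)
    ((K.integrable.comp_sub_right z).norm.const_mul _) (ae_of_all _ fun w => ?_)
  simp only [norm_smul]
  gcongr
  exact hA w

theorem hasFDerivAt_corr (hf : Continuous f) (hA : ∀ x, ‖f x‖ ≤ A) (K : 𝓢(Rd d, G))
    (z : Rd d) : HasFDerivAt (corr f K) (corr f (-(SchwartzMap.fderivCLM ℝ (Rd d) G K)) z) z := by
  obtain ⟨b, hb, hbb⟩ := schwartz_decay_translate (-(SchwartzMap.fderivCLM ℝ (Rd d) G K)) z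
  refine hasFDerivAt_integral_of_dominated_of_fderiv_le (bound := fun w => A * b w)
    (F' := fun z w => f w • (-(SchwartzMap.fderivCLM ℝ (Rd d) G K)) (w - z))
    (Metric.ball_mem_nhds z one_pos) (.of_forall fun z => (integrable_corr hf hA K z).1)
    (integrable_corr hf hA K z) (integrable_corr hf hA _ z).1
    (ae_of_all _ fun w z hz => ?_) (hb.const_mul _) (ae_of_all _ fun w z hz => ?_)
  · rw [norm_smul]
    have := hbb w z hz
    have h0 := hA w
    have : 0 ≤ A := (norm_nonneg _).trans h0
    gcongr
  · have h1 : HasFDerivAt (fun z => w - z) (-(ContinuousLinearMap.id ℝ (Rd d))) z := by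
      simpa using (hasFDerivAt_id z).const_sub w
    have h2 := ((K.hasFDerivAt (w - z)).comp z h1).const_smul (f w)
    convert h2 using 1
    congr 1
    ext e
    simp [show (-(SchwartzMap.fderivCLM ℝ (Rd d) G) K) (w - z) = -fderiv ℝ K (w - z) from rfl]

/-- Each derivative falls on the kernel. The induction must range over all target spaces `G`, since
the derivative of the kernel takes values in linear maps. -/
theorem corr_smooth (hf : Continuous f) (hA : ∀ x, ‖f x‖ ≤ A) (n : ℕ) :
    ∀ {G : Type} [NormedAddCommGroup G] [NormedSpace ℝ G] [NormedSpace ℂ G] [CompleteSpace G]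
      [SMulCommClass ℝ ℂ G] (K : 𝓢(Rd d, G)), ContDiff ℝ n (corr f K) ∧
      ∃ C, ∀ x, ‖iteratedFDeriv ℝ n (corr f K) x‖ ≤ C := by
  induction n with
  | zero =>
    intro G _ _ _ _ _ K
    have hd : Differentiable ℝ (corr f K) := fun z => (hasFDerivAt_corr hf hA K z).differentiableAt
    refine ⟨contDiff_zero.2 hd.continuous, A * ∫ w, ‖K w‖, fun x => ?_⟩
    rw [norm_iteratedFDeriv_zero]
    exact norm_corr_le hA K x
  | succ n ih =>
    intro G _ _ _ _ _ K
    have hd : Differentiable ℝ (corr f K) := fun z => (hasFDerivAt_corr hf hA K z).differentiableAt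
    have hfd : fderiv ℝ (corr f K) = corr f (-(SchwartzMap.fderivCLM ℝ (Rd d) G K)) :=
      funext fun z => (hasFDerivAt_corr hf hA K z).fderiv
    obtain ⟨h1, C, hC⟩ := ih (-(SchwartzMap.fderivCLM ℝ (Rd d) G K))
    rw [← hfd] at h1 hC
    refine ⟨?_, C, fun x => ?_⟩
    · exact_mod_cast contDiff_succ_iff_fderiv.2 ⟨hd, by simp, h1⟩
    · rw [← norm_iteratedFDeriv_fderiv]
      exact hC x

theorem corr_temperate (hf : Continuous f) (hA : ∀ x, ‖f x‖ ≤ A) (K : 𝓢(Rd d, G)) :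
    (corr f K).HasTemperateGrowth := by
  refine ⟨contDiff_infty.2 fun n => (corr_smooth hf hA n K).1, fun n => ?_⟩
  obtain ⟨C, hC⟩ := (corr_smooth hf hA n K).2
  exact ⟨0, C, fun x => by simpa using hC x⟩

end convolution

/-- The regularization of a bounded function by the multiplier with symbol `s (r ξ)`. -/
def regu (s : 𝓢(Rd d, ℂ)) (r : ℝ) (f : Rd d → ℂ) (z : Rd d) : ℂ := ∫ y, ft s y * f (z + r • y)

section regu
variable {f : Rd d → ℂ} {A α : ℝ}

theorem integrable_regu (s : 𝓢(Rd d, ℂ)) (r : ℝ) (hf : Continuous f) (hA : ∀ x, ‖f x‖ ≤ A)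
    (z : Rd d) : Integrable fun y => ft s y * f (z + r • y) :=
  (ft s).integrable.mul_bdd (c := A) (hf.comp (by fun_prop)).aestronglyMeasurable
    (ae_of_all _ fun y => hA _)

theorem regu_eq_corr (s : 𝓢(Rd d, ℂ)) {r : ℝ} (hr : 0 < r) (f : Rd d → ℂ) :
    ∃ K : 𝓢(Rd d, ℂ), regu s r f = corr f K := by
  set L : Rd d ≃L[ℝ] Rd d := ContinuousLinearEquiv.smulLeft (Units.mk0 r⁻¹ (by positivity))
  refine ⟨((r ^ d)⁻¹ : ℂ) • SchwartzMap.compCLMOfContinuousLinearEquiv ℂ L (ft s), ?_⟩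
  ext z
  have h1 : ∀ w, L w = r⁻¹ • w := fun w => rfl
  have h2 := Measure.integral_comp_smul (volume : Measure (Rd d))
    (fun v => ft s (r⁻¹ • v) * f (z + v)) r
  simp only [smul_smul, inv_mul_cancel₀ hr.ne', one_smul] at h2
  rw [regu, h2, ← integral_sub_right_eq_self _ z, corr, ← integral_smul]
  refine integral_congr_ae (ae_of_all _ fun w => ?_)
  simp only [smul_apply, SchwartzMap.compCLMOfContinuousLinearEquiv_apply, Function.comp_apply, h1,
    smul_eq_mul, Complex.real_smul, finrank_euclideanSpace_fin]
  rw [abs_of_pos (by positivity), add_sub_cancel]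
  push_cast
  ring

theorem regu_temperate (s : 𝓢(Rd d, ℂ)) {r : ℝ} (hr : 0 < r) (hf : Continuous f)
    (hA : ∀ x, ‖f x‖ ≤ A) : (regu s r f).HasTemperateGrowth := by
  obtain ⟨K, hK⟩ := regu_eq_corr s hr f
  rw [hK]
  exact corr_temperate hf hA K

theorem regu_sub (s : 𝓢(Rd d, ℂ)) (r : ℝ) {g : Rd d → ℂ} {B : ℝ} (hf : Continuous f)
    (hA : ∀ x, ‖f x‖ ≤ A) (hg : Continuous g) (hB : ∀ x, ‖g x‖ ≤ B) :
    regu s r (fun x => f x - g x) = regu s r f - regu s r g := by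
  ext z
  simp only [regu, Pi.sub_apply, mul_sub]
  exact integral_sub (integrable_regu s r hf hA z) (integrable_regu s r hg hB z)

theorem norm_regu_le (s : 𝓢(Rd d, ℂ)) (r : ℝ) (hA : ∀ x, ‖f x‖ ≤ A) (z : Rd d) :
    ‖regu s r f z‖ ≤ l1 (ft s) * A := by
  refine (norm_integral_le_integral_norm _).trans ?_
  rw [l1, ← integral_mul_const]
  refine integral_mono_of_nonneg (ae_of_all _ fun _ => norm_nonneg _)
    ((ft s).integrable.norm.mul_const _) (ae_of_all _ fun y => ?_)
  simp only [norm_mul]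
  gcongr
  exact hA _

theorem regu_holder (s : 𝓢(Rd d, ℂ)) (r : ℝ) (hα : 0 < α) (hf : HolderBound α A f) :
    HolderBound α (l1 (ft s) * A) (regu s r f) := by
  refine ⟨norm_regu_le s r hf.1, fun x y => ?_⟩
  have hc := hf.continuous hα
  have h1 : regu s r f x - regu s r f y = regu s r (fun z => f (z + x) - f (z + y)) 0 := by
    simp only [regu, mul_sub]
    rw [← integral_sub (integrable_regu s r hc hf.1 x) (integrable_regu s r hc hf.1 y)]
    refine integral_congr_ae (ae_of_all _ fun z => ?_)
    simp only [zero_add, add_comm (r • z)]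
  rw [h1, mul_assoc]
  refine norm_regu_le s r (fun z => ?_) 0
  have := hf.2 (z + x) (z + y)
  rwa [add_sub_add_left_eq_sub] at this

theorem norm_regu_sub_le (s : 𝓢(Rd d, ℂ)) {r : ℝ} (hr : 0 ≤ r) (hα : 0 < α) (hα1 : α ≤ 1)
    (hf : HolderBound α A f) (z : Rd d) :
    ‖regu s r f z - s 0 * f z‖ ≤ moment α s * (r ^ α * A) := by
  have hc := hf.continuous hα
  have h1 : regu s r f z - s 0 * f z = ∫ y, ft s y * (f (z + r • y) - f z) := by
    simp only [mul_sub]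
    rw [integral_sub (integrable_regu s r hc hf.1 z) ((ft s).integrable.mul_const _),
      integral_mul_const, integral_fourier, regu]
  rw [h1, moment]
  refine (norm_integral_le_integral_norm _).trans ?_
  rw [← integral_mul_const]
  refine integral_mono_of_nonneg (ae_of_all _ fun _ => norm_nonneg _)
    ((integrable_norm_mul_rpow (ft s) hα.le hα1).mul_const _) (ae_of_all _ fun y => ?_)
  have h2 := hf.2 (z + r • y) z
  rw [add_sub_cancel_left, norm_smul, Real.mul_rpow (norm_nonneg _) (norm_nonneg _),
    Real.norm_of_nonneg hr] at h2
  simp only [norm_mul]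
  calc _ ≤ ‖ft s y‖ * (A * (r ^ α * ‖y‖ ^ α)) := by gcongr
    _ = _ := by ring

theorem tendsto_regu {s : 𝓢(Rd d, ℂ)} (hs : s 0 = 1) {r : ℕ → ℝ}
    (hr : Tendsto r atTop (𝓝[≥] 0)) (hα : 0 < α) (hα1 : α ≤ 1) (hf : HolderBound α A f)
    (z : Rd d) : Tendsto (fun n => regu s (r n) f z) atTop (𝓝 (f z)) := by
  rw [tendsto_iff_norm_sub_tendsto_zero]
  have hr' := tendsto_nhdsWithin_iff.1 hr
  have h1 : Tendsto (fun n => moment α s * ((r n) ^ α * A)) atTop (𝓝 0) := by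
    have h2 : Tendsto (fun n => r n ^ α) atTop (𝓝 0) := by
      have := hr'.1.rpow_const (p := α) (Or.inr hα.le)
      rwa [Real.zero_rpow hα.ne'] at this
    simpa using (h2.mul_const A).const_mul (moment α s)
  refine squeeze_zero' (.of_forall fun _ => norm_nonneg _) ?_ h1
  filter_upwards [hr'.2] with n hn
  have := norm_regu_sub_le s hn hα hα1 hf z
  rwa [hs, one_mul] at this

/-- Fubini's theorem and the shift `x = z + r y`. The sign is opposite to that in `mult_dil_apply`,
because the multiplier has moved from the test function to `f`. -/
theorem isGivenBy_regu {D : 𝓢'(Rd d, ℂ)} (s : 𝓢(Rd d, ℂ)) (r : ℝ) (hf : Continuous f)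
    (hA : ∀ x, ‖f x‖ ≤ A) (hD : IsGivenBy D f) (ψ : 𝓢(Rd d, ℂ)) :
    D (mult (dil s r) ψ) = ∫ z, ψ z * regu s r f z := by
  have hA0 : 0 ≤ A := (norm_nonneg _).trans (hA 0)
  have hint : Integrable (Function.uncurry fun x y => ft s y * ψ (x - r • y) * f x)
      (volume.prod volume) := by
    have hc : Continuous (Function.uncurry fun x y : Rd d => ft s y * ψ (x - r • y) * f x) := by
      unfold Function.uncurry
      exact (((ft s).continuous.comp (by fun_prop)).mul (ψ.continuous.comp (by fun_prop))).mul
        (hf.comp (by fun_prop))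
    rw [integrable_prod_iff' hc.aestronglyMeasurable]
    have hi : ∀ y, Integrable fun x => ft s y * ψ (x - r • y) * f x := fun y =>
      ((ψ.integrable.comp_sub_right _).const_mul _).mul_bdd (c := A) hf.aestronglyMeasurable
        (ae_of_all _ hA)
    refine ⟨ae_of_all _ hi, ?_⟩
    refine ((ft s).integrable.norm.mul_const (l1 ψ * A)).mono'
      (hc.norm.stronglyMeasurable.integral_prod_left').aestronglyMeasurable (ae_of_all _ fun y => ?_)
    rw [Real.norm_of_nonneg (integral_nonneg fun _ => norm_nonneg _), ← l1_comp_sub ψ (r • y), l1,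
      ← integral_mul_const, ← integral_const_mul]
    refine integral_mono (hi y).norm
      (((ψ.integrable.comp_sub_right _).norm.mul_const _).const_mul _) fun x => ?_
    simp only [Function.uncurry_apply_pair, norm_mul, mul_assoc]
    gcongr
    exact hA x
  calc D (mult (dil s r) ψ) = ∫ x, ∫ y, ft s y * ψ (x - r • y) * f x := by
        rw [(hD _).2]
        refine integral_congr_ae (ae_of_all _ fun x => ?_)
        simp only
        rw [mult_dil_apply, integral_mul_const]
    _ = ∫ y, ∫ x, ft s y * ψ (x - r • y) * f x := integral_integral_swap hint
    _ = ∫ y, ∫ z, ψ z * (ft s y * f (z + r • y)) := by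
        refine integral_congr_ae (ae_of_all _ fun y => ?_)
        simp only
        rw [← integral_add_right_eq_self _ (r • y)]
        refine integral_congr_ae (ae_of_all _ fun z => ?_)
        simp only [add_sub_cancel_right]
        ring
    _ = ∫ z, ∫ y, ψ z * (ft s y * f (z + r • y)) := by
        refine integral_integral_swap ?_
        have h1 := ((ft s).integrable (μ := volume)).mul_prod ((ψ.integrable (μ := volume)).mul_const (A : ℂ))
        refine h1.mono ?_ (ae_of_all _ fun p => ?_)
        · refine Continuous.aestronglyMeasurable ?_
          unfold Function.uncurry
          exact (ψ.continuous.comp (by fun_prop)).mul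
            (((ft s).continuous.comp (by fun_prop)).mul (hf.comp (by fun_prop)))
        · simp only [Function.uncurry, norm_mul, Complex.norm_real, Real.norm_of_nonneg hA0]
          calc _ ≤ ‖ψ p.2‖ * (‖ft s p.1‖ * A) := by gcongr; exact hA _
            _ = _ := by ring
    _ = _ := by
        refine integral_congr_ae (ae_of_all _ fun z => ?_)
        simp only
        rw [integral_const_mul, regu]

end regu

theorem isGivenBy_mult {f : Rd d → ℂ} {A : ℝ} {D D' : 𝓢'(Rd d, ℂ)} (s : 𝓢(Rd d, ℂ)) {r : ℝ}
    (hr : 0 < r) (hf : Continuous f) (hA : ∀ x, ‖f x‖ ≤ A) (hD : IsGivenBy D f)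
    (hD' : ∀ ψ, D' ψ = D (mult (dil s r) ψ)) : IsGivenBy D' (regu s r f) := fun ψ => by
  refine ⟨?_, by rw [hD', isGivenBy_regu s r hf hA hD]⟩
  exact ψ.integrable.mul_bdd (c := l1 (ft s) * A)
    (regu_temperate s hr hf hA).1.continuous.aestronglyMeasurable
    (ae_of_all _ fun z => norm_regu_le s r hA z)

theorem exists_isGivenBy {f : Rd d → ℂ} {A : ℝ} (hf : Continuous f) (hA : ∀ x, ‖f x‖ ≤ A) :
    ∃ D : 𝓢'(Rd d, ℂ), IsGivenBy D f := by
  have hg : MemLp f ∞ := memLp_top_of_bound hf.aestronglyMeasurable A (ae_of_all _ hA)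
  refine ⟨(hg.toLp : Lp ℂ ∞ (volume : Measure (Rd d))), fun ψ => ⟨?_, ?_⟩⟩
  · exact ψ.integrable.mul_bdd hf.aestronglyMeasurable (ae_of_all _ hA)
  · rw [Lp.toTemperedDistribution_apply]
    refine integral_congr_ae ?_
    filter_upwards [hg.coeFn_toLp] with x hx
    rw [hx, smul_eq_mul]

/-! ### Tempered distributions as limits of functionals bounded in `W^{1,1}` -/

theorem continuous_l1 : Continuous fun ψ : 𝓢(Rd d, ℂ) => l1 ψ := by
  have : (fun ψ : 𝓢(Rd d, ℂ) => l1 ψ) = fun ψ : 𝓢(Rd d, ℂ) => ‖SchwartzMap.toLpCLM ℂ ℂ 1 volume ψ‖ := by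
    ext ψ
    rw [SchwartzMap.toLpCLM_apply, SchwartzMap.norm_toLp_one, l1]
  rw [this]
  fun_prop

theorem continuous_w11 : Continuous fun ψ : 𝓢(Rd d, ℂ) => w11 ψ := by
  have : (fun ψ : 𝓢(Rd d, ℂ) => w11 ψ) = fun ψ : 𝓢(Rd d, ℂ) => 2 * l1 ψ +
      ‖SchwartzMap.toLpCLM ℝ (Rd d →L[ℝ] ℂ) 1 volume (SchwartzMap.fderivCLM ℝ (Rd d) ℂ ψ)‖ := by
    ext ψ
    rw [SchwartzMap.toLpCLM_apply, SchwartzMap.norm_toLp_one, w11]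
    rfl
  rw [this]
  have := continuous_l1 (d := d)
  fun_prop

/-- Linear functionals bounded by the `W^{1,1}` norm are tempered distributions. -/
theorem exists_distribution (Λ : 𝓢(Rd d, ℂ) →ₗ[ℂ] ℂ) {C : ℝ} (h : ∀ ψ, ‖Λ ψ‖ ≤ C * w11 ψ) :
    ∃ D : 𝓢'(Rd d, ℂ), ∀ ψ, D ψ = Λ ψ := by
  have hc : Continuous Λ := by
    refine continuous_of_continuousAt_zero Λ ?_
    rw [ContinuousAt, map_zero, tendsto_zero_iff_norm_tendsto_zero]
    have h1 : Tendsto (fun ψ : 𝓢(Rd d, ℂ) => C * w11 ψ) (𝓝 0) (𝓝 0) := by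
      have := (continuous_w11.const_mul C).tendsto (0 : 𝓢(Rd d, ℂ))
      have h0 : w11 (0 : 𝓢(Rd d, ℂ)) = 0 := by
        have h2 : ⇑(0 : 𝓢(Rd d, ℂ)) = fun _ => 0 := rfl
        simp [w11, l1, h2]
      rwa [h0, mul_zero] at this
    exact squeeze_zero (fun _ => norm_nonneg _) h h1
  exact ⟨ContinuousLinearMap.toPointwiseConvergenceCLM _ _ _ _ ⟨Λ, hc⟩, fun ψ => rfl⟩

/-- Limits of tempered distributions that are bounded in the dual of `W^{1,1}`. -/
theorem exists_limit_distribution {D : ℕ → 𝓢'(Rd d, ℂ)} {C : ℝ} (h : ∀ n ψ, ‖D n ψ‖ ≤ C * w11 ψ)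
    {l : 𝓢(Rd d, ℂ) → ℂ} (hl : ∀ ψ, Tendsto (fun n => D n ψ) atTop (𝓝 (l ψ))) :
    ∃ E : 𝓢'(Rd d, ℂ), ∀ ψ, E ψ = l ψ := by
  let Λ : 𝓢(Rd d, ℂ) →ₗ[ℂ] ℂ :=
    { toFun := l
      map_add' := fun ψ χ => tendsto_nhds_unique (hl (ψ + χ))
        (((hl ψ).add (hl χ)).congr fun n => (map_add (D n) ψ χ).symm)
      map_smul' := fun c ψ => tendsto_nhds_unique (hl (c • ψ))
        (((hl ψ).const_smul c).congr fun n => (map_smul (D n) c ψ).symm) }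
  exact exists_distribution Λ (C := C) fun ψ =>
    le_of_tendsto (hl ψ).norm (.of_forall fun n => h n ψ)

theorem hasBound_of_tendsto {D : ℕ → 𝓢'(Rd d, ℂ)} {E : 𝓢'(Rd d, ℂ)} {γ C : ℝ}
    (h : ∀ n, HasBound φ γ C (D n)) (hl : ∀ ψ, Tendsto (fun n => D n ψ) atTop (𝓝 (E ψ))) :
    HasBound φ γ C E := fun j ψ =>
  le_of_tendsto (hl _).norm (.of_forall fun n => h n j ψ)

theorem isReal_of_tendsto {D : ℕ → 𝓢'(Rd d, ℂ)} {E : 𝓢'(Rd d, ℂ)}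
    (h : ∀ n, IsRealDistribution (D n)) (hl : ∀ ψ, Tendsto (fun n => D n ψ) atTop (𝓝 (E ψ))) :
    IsRealDistribution E := fun ψ hψ => by
  have h1 := (Complex.continuous_im.tendsto _).comp (hl ψ)
  have h2 : (Complex.im ∘ fun n => D n ψ) = fun _ => 0 := funext fun n => h n ψ hψ
  rw [h2] at h1
  exact tendsto_nhds_unique h1 tendsto_const_nhds

/-! ### Bony's product of a Hölder function and a distribution in `𝓒^β` -/

section product
variable {a : Rd d → ℂ} {α β A B : ℝ} {g : 𝓢'(Rd d, ℂ)}

theorem l1_smul_le (ha : a.HasTemperateGrowth) (hA : ∀ x, ‖a x‖ ≤ A) (ψ : 𝓢(Rd d, ℂ)) :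
    l1 (SchwartzMap.smulLeftCLM ℂ a ψ) ≤ A * l1 ψ := by
  rw [l1, l1, ← integral_const_mul]
  refine integral_mono (SchwartzMap.integrable _).norm (ψ.integrable.norm.const_mul _) fun x => ?_
  rw [SchwartzMap.smulLeftCLM_apply_apply ha, norm_smul]
  gcongr
  exact hA x

/-- The discrete Leibniz rule: the increment falls either on `a`, where the Hölder bound applies, or
on `ψ`. -/
theorem hasModulus_smul (ha : a.HasTemperateGrowth) (hA : HolderBound α A a) {ψ : 𝓢(Rd d, ℂ)}
    {N : ℝ} (hN : HasModulus α N ψ) :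
    HasModulus α (A * (l1 ψ + N)) (SchwartzMap.smulLeftCLM ℂ a ψ) := by
  intro y
  have hA0 : 0 ≤ A := (norm_nonneg _).trans (hA.1 0)
  have h1 : ∀ x, ‖SchwartzMap.smulLeftCLM ℂ a ψ (x - y) - SchwartzMap.smulLeftCLM ℂ a ψ x‖ ≤
      A * ‖y‖ ^ α * ‖ψ (x - y)‖ + A * ‖ψ (x - y) - ψ x‖ := by
    intro x
    rw [SchwartzMap.smulLeftCLM_apply_apply ha, SchwartzMap.smulLeftCLM_apply_apply ha]
    have h2 : a (x - y) • ψ (x - y) - a x • ψ x =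
        (a (x - y) - a x) * ψ (x - y) + a x * (ψ (x - y) - ψ x) := by
      simp only [smul_eq_mul]; ring
    rw [h2]
    refine (norm_add_le _ _).trans ?_
    rw [norm_mul, norm_mul]
    have h3 := hA.2 (x - y) x
    rw [sub_sub_cancel_left, norm_neg] at h3
    have h4 := hA.1 x
    gcongr
  have hi := ψ.integrable (μ := volume)
  have hi2 := hi.comp_sub_right y
  have hi3 : Integrable fun x => ψ (x - y) - ψ x := hi2.sub hi
  calc _ ≤ ∫ x, A * ‖y‖ ^ α * ‖ψ (x - y)‖ + A * ‖ψ (x - y) - ψ x‖ := by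
        refine integral_mono_of_nonneg (ae_of_all _ fun _ => norm_nonneg _) ?_ (ae_of_all _ h1)
        exact (hi2.norm.const_mul _).add (hi3.norm.const_mul _)
    _ = A * ‖y‖ ^ α * l1 ψ + A * l1 (fun x => ψ (x - y) - ψ x) := by
        rw [integral_add (hi2.norm.const_mul _) (hi3.norm.const_mul _),
          integral_const_mul, integral_const_mul]
        congr 2
        exact l1_comp_sub ψ y
    _ ≤ A * ‖y‖ ^ α * l1 ψ + A * (N * ‖y‖ ^ α) := by gcongr; exact hN y
    _ = _ := by ring

theorem HasBound.apply_blk_smul_le (hB : 0 ≤ B) (hg : HasBound φ β B g) (hα : 0 ≤ α) (hα1 : α ≤ 1)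
    (ha : a.HasTemperateGrowth) (hA : HolderBound α A a) (ψ : 𝓢(Rd d, ℂ)) (k : ℕ) :
    ‖g (blk φ k (SchwartzMap.smulLeftCLM ℂ a ψ))‖ ≤
      B * Kc φ * (A * (l1 ψ + w11 ψ)) * 2 ^ (-((β + α) * k)) := by
  have hA0 : 0 ≤ A := (norm_nonneg _).trans (hA.1 0)
  have hl := l1_nonneg ψ
  have hw := w11_nonneg ψ
  have hK := Kc_nonneg φ
  rcases eq_or_ne k 0 with rfl | hk
  · have h0 := (hg.apply_blk_le 0 (SchwartzMap.smulLeftCLM ℂ a ψ)).trans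
      (mul_le_mul_of_nonneg_left (l1_fat_le φ _ 0) (by positivity))
    simp only [Nat.cast_zero, mul_zero, neg_zero, Real.rpow_zero, mul_one] at h0 ⊢
    refine h0.trans ?_
    rw [← mul_assoc]
    gcongr
    refine (l1_smul_le ha hA.1 ψ).trans ?_
    gcongr
    linarith
  · exact hg.apply_blk_small hB hk hα hα1 (by positivity)
      (hasModulus_smul ha hA (hasModulus_w11 ψ hα hα1))

/-- The constant in the product estimate. -/
def prodC (φ : DyadicCutoff d) (α β : ℝ) : ℝ := 2 * Kc φ ^ 2 * geoZ (min (-β) (α + β))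

theorem prodC_nonneg (φ : DyadicCutoff d) (α β : ℝ) : 0 ≤ prodC φ α β := by
  have := geoZ_nonneg (min (-β) (α + β)); have := Kc_nonneg φ
  rw [prodC]; positivity

/-- The product estimate, for smooth functions. -/
theorem HasBound.smul (hB : 0 ≤ B) (hg : HasBound φ β B g) (hα : 0 ≤ α) (hα1 : α ≤ 1) (hβ : β < 0)
    (hαβ : 0 < α + β) (ha : a.HasTemperateGrowth) (hA : HolderBound α A a) :
    HasBound φ β (prodC φ α β * A * B) (TemperedDistribution.smulLeftCLM ℂ a g) := by
  intro i χ
  have hA0 : 0 ≤ A := (norm_nonneg _).trans (hA.1 0)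
  have hl := l1_nonneg χ
  have hK := Kc_nonneg φ
  set δ := min (-β) (α + β) with hδ
  have hδ0 : 0 < δ := lt_min (by linarith) hαβ
  rw [TemperedDistribution.smulLeftCLM_apply_apply]
  set h := SchwartzMap.smulLeftCLM ℂ a (blk φ i χ) with hh
  have hl1 : l1 h ≤ A * (Kc φ * l1 χ) :=
    (l1_smul_le ha hA.1 _).trans (by gcongr; exact l1_blk_le φ χ i)
  have hmod : HasModulus α (2 * A * Kc φ * 2 ^ (α * i) * l1 χ) h := by
    intro y
    refine (hasModulus_smul ha hA (modulus_blk φ χ i hα hα1) y).trans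
      (mul_le_mul_of_nonneg_right ?_ (by positivity))
    have h1 := l1_blk_le φ χ i
    have h2 : (1 : ℝ) ≤ 2 ^ (α * i) := Real.one_le_rpow one_le_two (by positivity)
    have h3 : Kc φ * l1 χ ≤ Kc φ * 2 ^ (α * i) * l1 χ := by
      have : 0 ≤ Kc φ * l1 χ := by positivity
      nlinarith
    calc A * (l1 (blk φ i χ) + Kc φ * 2 ^ (α * i) * l1 χ) ≤
        A * (Kc φ * 2 ^ (α * i) * l1 χ + Kc φ * 2 ^ (α * i) * l1 χ) := by
          gcongr
          exact h1.trans h3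
      _ = _ := by ring
  -- Multiplication by `a` spreads frequency `2^i` to all `2^k`. For `k ≤ i` the `L¹` bound of `h`
  -- suffices because `-β > 0`. For `k > i` the modulus of `h`, of size `2^{αi}`, gives decay
  -- because `α + β > 0`. Hence the rate `δ = min (-β) (α + β)` on both sides of `i`.
  have hb : ∀ k, ‖g (blk φ k h)‖ ≤ (2 * Kc φ ^ 2 * A * B * 2 ^ (-(β * i)) * l1 χ) *
      2 ^ (-(δ * |(k : ℝ) - i|)) := by
    intro k
    rcases le_or_gt k i with hk | hk
    · have hc : (k : ℝ) ≤ i := by exact_mod_cast hk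
      have hc0 : 0 ≤ (i : ℝ) - k := by linarith
      have h1 : (2 : ℝ) ^ (-(β * k)) ≤ 2 ^ (-(β * i)) * 2 ^ (-(δ * |(k : ℝ) - i|)) := by
        rw [abs_of_nonpos (by linarith), neg_sub, ← Real.rpow_add two_pos]
        refine Real.rpow_le_rpow_of_exponent_le one_le_two ?_
        have : δ * (i - k) ≤ -β * (i - k) := by gcongr; exact min_le_left _ _
        linarith
      calc _ ≤ B * 2 ^ (-(β * k)) * (Kc φ * (A * (Kc φ * l1 χ))) := by
            refine (hg.apply_blk_le k h).trans ?_
            gcongr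
            exact (l1_fat_le φ h k).trans (by gcongr)
        _ = 1 * Kc φ ^ 2 * A * B * 2 ^ (-(β * k)) * l1 χ := by ring
        _ ≤ 2 * Kc φ ^ 2 * A * B * (2 ^ (-(β * i)) * 2 ^ (-(δ * |(k : ℝ) - i|))) * l1 χ := by
            gcongr
            norm_num
        _ = _ := by ring
    · have hc : (i : ℝ) ≤ k := by exact_mod_cast hk.le
      have hc0 : 0 ≤ (k : ℝ) - i := by linarith
      have h1 : (2 : ℝ) ^ (α * i) * 2 ^ (-((β + α) * k)) ≤
          2 ^ (-(β * i)) * 2 ^ (-(δ * |(k : ℝ) - i|)) := by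
        rw [abs_of_nonneg hc0, ← Real.rpow_add two_pos, ← Real.rpow_add two_pos]
        refine Real.rpow_le_rpow_of_exponent_le one_le_two ?_
        have : δ * (k - i) ≤ (α + β) * (k - i) := by gcongr; exact min_le_right _ _
        linarith
      calc _ ≤ B * Kc φ * (2 * A * Kc φ * 2 ^ (α * i) * l1 χ) * 2 ^ (-((β + α) * k)) :=
            hg.apply_blk_small hB (by omega) hα hα1 (by positivity) hmod
        _ = 2 * Kc φ ^ 2 * A * B * (2 ^ (α * i) * 2 ^ (-((β + α) * k))) * l1 χ := by ring
        _ ≤ 2 * Kc φ ^ 2 * A * B * (2 ^ (-(β * i)) * 2 ^ (-(δ * |(k : ℝ) - i|))) * l1 χ := by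
            gcongr
        _ = _ := by ring
  refine (norm_apply_le_tsum ((summable_two_rpow_abs_sub hδ0 i).mul_left _) hb).trans ?_
  rw [tsum_mul_left, prodC]
  calc _ ≤ (2 * Kc φ ^ 2 * A * B * 2 ^ (-(β * i)) * l1 χ) * geoZ δ := by
        gcongr
        exact tsum_two_rpow_abs_sub_le hδ0 i
    _ = _ := by ring

/-- Smooth approximations `a n` of `f` with uniform Hölder bounds. -/
structure IsApprox (α A : ℝ) (f : Rd d → ℂ) (a : ℕ → Rd d → ℂ) : Prop where
  temperate : ∀ n, (a n).HasTemperateGrowth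
  holder : ∀ n, HolderBound α A (a n)
  tendsto : ∀ x, Tendsto (fun n => a n x) atTop (𝓝 (f x))

theorem isApprox_regu {f : Rd d → ℂ} (hα : 0 < α) (hα1 : α ≤ 1) (hf : HolderBound α A f)
    {s : 𝓢(Rd d, ℂ)} (hs : s 0 = 1) (hK : kc s ≤ Kc φ) {r : ℕ → ℝ} (hr : ∀ n, 0 < r n)
    (hr0 : Tendsto r atTop (𝓝[≥] 0)) : IsApprox α (Kc φ * A) f fun n => regu s (r n) f where
  temperate n := regu_temperate s (hr n) (hf.continuous hα) hf.1
  holder n := (regu_holder s (r n) hα hf).mono (by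
    have hA0 : 0 ≤ A := (norm_nonneg _).trans (hf.1 0)
    gcongr
    exact (l1_le_kc s).trans hK)
  tendsto := tendsto_regu hs hr0 hα hα1 hf

/-- The product of a Hölder function and a distribution in `𝓒^β`, as a functional. -/
theorem exists_product_limit (hB : 0 ≤ B) (hg : HasBound φ β B g) (hα : 0 < α) (hα1 : α ≤ 1)
    (hαβ : 0 < α + β) {f : Rd d → ℂ} (ψ : 𝓢(Rd d, ℂ)) :
    ∃ l : ℂ, ∀ (a : ℕ → Rd d → ℂ) (A : ℝ), IsApprox α A f a →
      Tendsto (fun n => g (SchwartzMap.smulLeftCLM ℂ (a n) ψ)) atTop (𝓝 l) ∧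
      Tendsto (fun n => ∑ k ∈ Finset.range (n + 1), g (blk φ k (SchwartzMap.smulLeftCLM ℂ (a n) ψ)))
        atTop (𝓝 l) := by
  have h1 : ∀ k, ∃ G : Rd d → ℂ, AEStronglyMeasurable G ∧ (∃ C, ∀ᵐ x, ‖G x‖ ≤ C) ∧
      ∀ η, g (blk φ k η) = ∫ x, η x * G x := by
    intro k
    have h2 : ∀ η, ‖block φ k g η‖ ≤ B * 2 ^ (-(β * k)) * l1 η := fun η => by
      rw [block_apply]
      exact hg k η
    obtain ⟨G, hGm, hGb, hG, -⟩ := exists_linfty h2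
    exact ⟨G, hGm, ⟨_, hGb⟩, fun η => by rw [← block_apply]; exact (hG η).2⟩
  choose G hGm hGb hG using h1
  -- This value is fixed before the approximation is chosen, so the product does not depend on how
  -- `f` is approximated. Each block of `g` is an `L^∞` function, so dominated convergence applies
  -- blockwise and then to the sum over blocks. The second limit, with truncated `g`, is the one in
  -- Bony's definition.
  refine ⟨∑' k, ∫ x, f x * ψ x * G k x, fun a A ha => ?_⟩
  have hlim : ∀ k, Tendsto (fun n => g (blk φ k (SchwartzMap.smulLeftCLM ℂ (a n) ψ))) atTop
      (𝓝 (∫ x, f x * ψ x * G k x)) := by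
    intro k
    obtain ⟨C, hC⟩ := hGb k
    simp only [hG k]
    refine tendsto_integral_of_dominated_convergence (fun x => A * ‖ψ x‖ * C)
      (fun n => ((SchwartzMap.continuous _).aestronglyMeasurable.mul (hGm k)))
      ((ψ.integrable.norm.const_mul _).mul_const _) (fun n => ?_) (ae_of_all _ fun x => ?_)
    · filter_upwards [hC] with x hx
      rw [SchwartzMap.smulLeftCLM_apply_apply (ha.temperate n), norm_mul, norm_smul]
      have := (ha.holder n).1 x
      have : 0 ≤ A := (norm_nonneg _).trans this
      gcongr
    · simp only [SchwartzMap.smulLeftCLM_apply_apply (ha.temperate _), smul_eq_mul]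
      exact ((ha.tendsto x).mul_const _).mul_const _
  have hA0 : 0 ≤ A := (norm_nonneg _).trans ((ha.holder 0).1 0)
  have hbd := fun n => hg.apply_blk_smul_le hB hα.le hα1 (ha.temperate n) (ha.holder n) ψ
  have hsum : Summable fun k : ℕ =>
      B * Kc φ * (A * (l1 ψ + w11 ψ)) * (2 : ℝ) ^ (-((β + α) * k)) :=
    (summable_two_rpow (by linarith)).mul_left _
  constructor
  · refine (tendsto_tsum_of_dominated_convergence hsum hlim (.of_forall fun n k => hbd n k)).congr
      fun n => ?_
    exact (hasSum_blk hsum (hbd n)).tsum_eq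
  · have h3 : Tendsto (fun n : ℕ => ∑' k, if k ∈ Finset.range (n + 1) then
        g (blk φ k (SchwartzMap.smulLeftCLM ℂ (a n) ψ)) else 0) atTop
        (𝓝 (∑' k, ∫ x, f x * ψ x * G k x)) :=
      tendsto_tsum_of_dominated_convergence hsum (fun k => ?_) (.of_forall fun n k => ?_)
    · refine h3.congr fun n => ?_
      rw [tsum_eq_sum (s := Finset.range (n + 1)) (fun k hk => by simp only [hk, if_false])]
      exact Finset.sum_congr rfl fun k hk => by simp only [hk, if_true]
    · refine (hlim k).congr' ?_
      filter_upwards [eventually_ge_atTop k] with n hn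
      rw [if_pos (Finset.mem_range.2 (by omega))]
    · split_ifs
      · exact hbd n k
      · rw [norm_zero]
        have := l1_nonneg ψ; have := w11_nonneg ψ; have := Kc_nonneg φ
        positivity

theorem tendsto_distribution_iff {D : ℕ → 𝓢'(Rd d, ℂ)} {E : 𝓢'(Rd d, ℂ)} :
    Tendsto D atTop (𝓝 E) ↔ ∀ ψ, Tendsto (fun n => D n ψ) atTop (𝓝 (E ψ)) :=
  PointwiseConvergenceCLM.tendsto_iff_forall_tendsto

/-- Existence of Bony's product. -/
theorem exists_isProduct (hB : 0 ≤ B) (hg : HasBound φ β B g) (hα : 0 < α) (hα1 : α ≤ 1)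
    (hαβ : 0 < α + β) {f : Rd d → ℂ} {D : 𝓢'(Rd d, ℂ)} (hf : HolderBound α A f)
    (hD : IsGivenBy D f) :
    ∃ h, IsProduct φ D g h ∧ ∀ (a : ℕ → Rd d → ℂ) (A : ℝ), IsApprox α A f a → ∀ ψ,
      Tendsto (fun n => TemperedDistribution.smulLeftCLM ℂ (a n) g ψ) atTop (𝓝 (h ψ)) := by
  choose l hl using exists_product_limit (f := f) hB hg hα hα1 hαβ
  have hap := isApprox_regu (φ := φ) hα hα1 hf (cut_zero φ) (kc_cut_le φ)
    (r := fun n => ((2 : ℝ) ^ n)⁻¹) (fun n => by positivity) tendsto_inv_two_pow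
  set a : ℕ → Rd d → ℂ := fun n => regu (cut φ) ((2 : ℝ) ^ n)⁻¹ f with ha
  have hlim : ∀ ψ, Tendsto (fun n => TemperedDistribution.smulLeftCLM ℂ (a n) g ψ) atTop
      (𝓝 (l ψ)) := fun ψ => (hl ψ a _ hap).1
  have hA0 : 0 ≤ A := (norm_nonneg _).trans (hf.1 0)
  -- A bound uniform in `n` by the `W^{1,1}` norm of the test function, which makes the pointwise
  -- limit continuous on the Schwartz space.
  obtain ⟨h, hh⟩ := exists_limit_distribution
    (C := geo (β + α) * Kc φ * B * (2 * (Kc φ * A) * 2)) (fun n ψ => by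
      rw [TemperedDistribution.smulLeftCLM_apply_apply]
      have hl1 := l1_smul_le (hap.temperate n) (hap.holder n).1 ψ
      have hmod := hasModulus_smul (hap.temperate n) (hap.holder n) (hasModulus_w11 ψ hα.le hα1)
      have h1 := l1_nonneg ψ
      have h2 := w11_nonneg ψ
      have hK := Kc_nonneg φ
      have hgeo := geo_nonneg (β + α)
      have h3 : l1 ψ ≤ w11 ψ := by
        rw [w11]
        have : 0 ≤ ∫ x, ‖fderiv ℝ ψ x‖ := integral_nonneg fun _ => norm_nonneg _
        linarith
      refine (hg.apply_le hB hα.le hα1 (by linarith) (by positivity) hmod).trans ?_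
      rw [mul_assoc _ (2 * (Kc φ * A) * 2)]
      gcongr
      have h4 : Kc φ * A * l1 ψ ≤ Kc φ * A * w11 ψ := by gcongr
      have h5 : 0 ≤ Kc φ * A * w11 ψ := by positivity
      linarith) hlim
  refine ⟨h, ⟨a, fun N => ⟨hap.temperate N, ?_⟩, ?_⟩, fun a' A' ha' ψ => ?_⟩
  · exact isGivenBy_mult (cut φ) (by positivity) (hf.continuous hα) hf.1 hD
      fun ψ => lowFreq_apply φ N D ψ
  · rw [tendsto_distribution_iff]
    intro ψ
    rw [hh]
    refine (hl ψ a _ hap).2.congr fun n => ?_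
    rw [TemperedDistribution.smulLeftCLM_apply_apply, lowFreq_apply_eq_sum]
  · rw [hh]
    exact (hl ψ a' _ ha').1

/-- The functions representing `S_N f` are continuous, hence determined by the distribution. -/
theorem IsProduct.unique {D g h h' : 𝓢'(Rd d, ℂ)} (h1 : IsProduct φ D g h)
    (h2 : IsProduct φ D g h') : h = h' := by
  obtain ⟨a, ha, hla⟩ := h1
  obtain ⟨b, hb, hlb⟩ := h2
  have hab : a = b := funext fun N => (ha N).2.eq_of_continuous (hb N).2 (ha N).1.1.continuous
    (hb N).1.1.continuous
  rw [← hab] at hlb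
  rw [tendsto_distribution_iff] at hla hlb
  ext ψ
  exact tendsto_nhds_unique (hla ψ) (hlb ψ)

end product

/-! ### Real-valuedness and composition with `F` -/

/-- The Gaussian is real and even. The cutoff `φ₀` is not assumed even, so `S_N f` may fail to be
real for real `f`; this is why real-valuedness of the product is proved with Gaussian
approximations. -/
theorem ft_gauss_im (y : Rd d) : (ft (gauss d) y).im = 0 := by
  rw [← Complex.conj_eq_iff_im, ft, SchwartzMap.fourier_coe, Real.fourier_eq, ← integral_conj,
    ← integral_neg_eq_self]
  refine integral_congr_ae (ae_of_all _ fun x => ?_)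
  simp only [gauss_apply, Circle.smul_def, smul_eq_mul, map_mul, Complex.conj_ofReal, norm_neg,
    inner_neg_left, neg_neg]
  congr 1
  rw [← Circle.coe_inv_eq_conj, ← AddChar.map_neg_eq_inv]

theorem regu_gauss_im {f : Rd d → ℂ} (hf : ∀ x, (f x).im = 0) (r : ℝ) (z : Rd d) :
    (regu (gauss d) r f z).im = 0 := by
  have : ∀ y, ft (gauss d) y * f (z + r • y) =
      (((ft (gauss d) y).re * (f (z + r • y)).re : ℝ) : ℂ) := fun y =>
    Complex.ext (by simp [hf, ft_gauss_im]) (by simp [hf, ft_gauss_im])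
  rw [regu]
  simp only [this]
  rw [integral_complex_ofReal, Complex.ofReal_im]

theorem heatS_im {ψ : 𝓢(Rd d, ℂ)} (hψ : ∀ x, (ψ x).im = 0) (t : ℝ) (x : Rd d) :
    (heatS t ψ x).im = 0 := by
  have : ∀ y, ft (gauss d) y * ψ (x - √t • y) =
      (((ft (gauss d) y).re * (ψ (x - √t • y)).re : ℝ) : ℂ) := fun y =>
    Complex.ext (by simp [hψ, ft_gauss_im]) (by simp [hψ, ft_gauss_im])
  rw [heatS, mult_dil_apply]
  simp only [this]
  rw [integral_complex_ofReal, Complex.ofReal_im]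

theorem IsRealDistribution.heat {f : 𝓢'(Rd d, ℂ)} (hf : IsRealDistribution f) {t : ℝ}
    (ht : 0 ≤ t) : IsRealDistribution (heat t f) := fun ψ hψ => by
  rw [heat_apply' ht]
  exact hf _ fun x => heatS_im hψ t x

/-- `F` is Lipschitz with constant `L` and its derivative is Lipschitz with constant `M`. -/
structure IsLip (F : Rd d → ℝ) (L M : ℝ) : Prop where
  nonneg : 0 ≤ L
  nonneg' : 0 ≤ M
  differentiable : Differentiable ℝ F
  lip : ∀ x y, |F x - F y| ≤ L * ‖x - y‖
  lip' : ∀ x y, ‖fderiv ℝ F x - fderiv ℝ F y‖ ≤ M * ‖x - y‖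

theorem isLip_of_partial {F : Rd d → ℝ} {L M : ℝ≥0} (hF : ContDiff ℝ 1 F)
    (hF' : ∀ i : Fin d, LipschitzWith M
      (fun x => fderiv ℝ F x (EuclideanSpace.single i (1 : ℝ))))
    (hL : LipschitzWith L F) : IsLip F L (d * M) where
  nonneg := L.coe_nonneg
  nonneg' := by positivity
  differentiable := hF.differentiable one_ne_zero
  lip x y := by simpa [Real.dist_eq, dist_eq_norm] using hL.dist_le_mul x y
  lip' x y := by
    refine ContinuousLinearMap.opNorm_le_bound _ (by positivity) fun h => ?_
    have h1 : h = ∑ i, h i • (EuclideanSpace.single i (1 : ℝ) : Rd d) := by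
      ext j
      simp [Pi.single_apply]
    conv_lhs => rw [h1, map_sum]
    refine (norm_sum_le _ _).trans ?_
    have h2 : ∀ i ∈ Finset.univ, ‖(fderiv ℝ F x - fderiv ℝ F y)
        (h i • (EuclideanSpace.single i (1 : ℝ) : Rd d))‖ ≤ M * ‖x - y‖ * ‖h‖ := by
      intro i _
      have h3 := (hF' i).dist_le_mul x y
      rw [dist_eq_norm, dist_eq_norm] at h3
      rw [map_smul, norm_smul, mul_comm]
      gcongr
      · exact h3
      · exact PiLp.norm_apply_le h i
    refine (Finset.sum_le_sum h2).trans (le_of_eq ?_)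
    simp
    ring

section composition
variable {F : Rd d → ℝ} {L M α A δ : ℝ} {v w : Rd d → Rd d}

theorem HolderBound.comp_isLip (hF : IsLip F L M) (hv : HolderBound α A v) :
    HolderBound α (|F 0| + L * A) fun x => (F (v x) : ℂ) := by
  have hL := hF.nonneg
  refine ⟨fun x => ?_, fun x y => ?_⟩
  · rw [Complex.norm_real, Real.norm_eq_abs]
    have h1 := hF.lip (v x) 0
    rw [sub_zero] at h1
    have h2 : |F (v x)| ≤ |F 0| + |F (v x) - F 0| := by
      have := abs_add_le (F 0) (F (v x) - F 0)
      rwa [add_sub_cancel] at this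
    have h3 := mul_le_mul_of_nonneg_left (hv.1 x) hL
    linarith
  · rw [← Complex.ofReal_sub, Complex.norm_real, Real.norm_eq_abs]
    have h3 := mul_le_mul_of_nonneg_left (hv.2 x y) hL
    have h4 : 0 ≤ |F 0| * ‖x - y‖ ^ α := by positivity
    rw [add_mul]
    linarith [hF.lip (v x) (v y)]

/-- The function `z ↦ F (z + h) - F z` has derivative bounded by `M ‖h‖`. -/
theorem IsLip.second_difference (hF : IsLip F L M) (a b h : Rd d) :
    |(F (a + h) - F a) - (F (b + h) - F b)| ≤ M * ‖h‖ * ‖a - b‖ := by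
  have h1 : ∀ z, HasFDerivAt (fun z => F (z + h) - F z) (fderiv ℝ F (z + h) - fderiv ℝ F z) z := by
    intro z
    refine HasFDerivAt.sub ?_ (hF.differentiable z).hasFDerivAt
    have := (hF.differentiable (z + h)).hasFDerivAt
    simpa [Function.comp_def] using this.comp z ((hasFDerivAt_id z).add_const h)
  have := Convex.norm_image_sub_le_of_norm_hasFDerivWithin_le (s := univ) (C := M * ‖h‖)
    (fun z _ => (h1 z).hasFDerivWithinAt) (fun z _ => by simpa using hF.lip' (z + h) z) convex_univ
    (mem_univ b) (mem_univ a)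
  simpa using this

theorem HolderBound.comp_sub_comp (hF : IsLip F L M) (hw : HolderBound α A w)
    (hd : HolderBound α δ fun x => v x - w x) :
    HolderBound α ((L + M * A) * δ) fun x => (F (v x) : ℂ) - (F (w x) : ℂ) := by
  have hL := hF.nonneg
  have hM := hF.nonneg'
  have hA0 : 0 ≤ A := (norm_nonneg _).trans (hw.1 0)
  have hδ0 : 0 ≤ δ := (norm_nonneg _).trans (hd.1 0)
  refine ⟨fun x => ?_, fun x y => ?_⟩
  · simp only [← Complex.ofReal_sub, Complex.norm_real, Real.norm_eq_abs]
    have h1 := mul_le_mul_of_nonneg_left (hd.1 x) hL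
    have h2 : 0 ≤ M * A * δ := by positivity
    rw [add_mul]
    linarith [hF.lip (v x) (w x)]
  · simp only [← Complex.ofReal_sub, Complex.norm_real, Real.norm_eq_abs]
    -- The increment `v x - w x` is transplanted from `w x` to `w y`. The first part is a second
    -- difference, controlled by `DF`; the second involves only the increment of `v - w`.
    have h1 : (F (v x) - F (w x)) - (F (v y) - F (w y)) =
        ((F (w x + (v x - w x)) - F (w x)) - (F (w y + (v x - w x)) - F (w y))) +
        (F (w y + (v x - w x)) - F (v y)) := by
      rw [add_sub_cancel]; ring
    rw [h1]
    refine (abs_add_le _ _).trans ?_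
    have h2 := hF.second_difference (w x) (w y) (v x - w x)
    have h3 := hF.lip (w y + (v x - w x)) (v y)
    rw [show w y + (v x - w x) - v y = (v x - w x) - (v y - w y) by abel] at h3
    have h4 : M * ‖v x - w x‖ * ‖w x - w y‖ ≤ M * δ * (A * ‖x - y‖ ^ α) := by
      gcongr
      · exact hd.1 x
      · exact hw.2 x y
    have h5 := mul_le_mul_of_nonneg_left (hd.2 x y) hL
    calc _ ≤ M * δ * (A * ‖x - y‖ ^ α) + L * (δ * ‖x - y‖ ^ α) := by linarith
      _ = _ := by ring

end composition

theorem exists_isApprox_gauss (φ : DyadicCutoff d) {α A : ℝ} (hα : 0 < α) (hα1 : α ≤ 1)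
    {f : Rd d → ℂ} (hf : HolderBound α A f) :
    IsApprox α (Kc φ * A) f fun n : ℕ => regu (gauss d) (1 / ((n : ℝ) + 1)) f :=
  isApprox_regu hα hα1 hf gauss_zero (kc_gauss_le φ) (fun n => by positivity)
    (tendsto_nhdsWithin_iff.2 ⟨tendsto_one_div_add_atTop_nhds_zero_nat,
      .of_forall fun n => by simp only [mem_Ici]; positivity⟩)

/-! ### The nonlinear term: existence, linear growth and local Lipschitz continuity -/

section nonlinear
variable {F : Rd d → ℝ} {L M α β A B δ : ℝ} {u u' b h h' : 𝓢'(Rd d, ℂ)} {v v' : Rd d → Rd d}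

/-- Without this, the forcing `G` in the definition of a mild solution would be a free choice. It
rests on uniqueness of the continuous gradient and of Bony's product. -/
theorem IsNonlinearTerm.unique (h1 : IsNonlinearTerm φ F u b h) (h2 : IsNonlinearTerm φ F u b h') :
    h = h' := by
  obtain ⟨v, f, hv, hvu, hf, hp⟩ := h1
  obtain ⟨v', f', hv', hvu', hf', hp'⟩ := h2
  obtain rfl : v = v' := IsGrad.unique ⟨hv, hvu⟩ ⟨hv', hvu'⟩
  obtain rfl : f = f' := by
    ext ψ
    rw [(hf ψ).2, (hf' ψ).2]
  exact hp.unique hp'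

/-- The nonlinear term is defined through `S_N`, but any uniformly Hölder approximation computes it;
the Gaussian one is used below. -/
theorem IsNonlinearTerm.tendsto (hh : IsNonlinearTerm φ F u b h) (hF : IsLip F L M)
    (hα : 0 < α) (hα1 : α ≤ 1) (hαβ : 0 < α + β) (hv : IsGrad u v) (hvA : HolderBound α A v)
    (hB : 0 ≤ B) (hb : HasBound φ β B b) {a : ℕ → Rd d → ℂ} {A' : ℝ}
    (ha : IsApprox α A' (fun x => (F (v x) : ℂ)) a) (ψ : 𝓢(Rd d, ℂ)) :
    Tendsto (fun n => TemperedDistribution.smulLeftCLM ℂ (a n) b ψ) atTop (𝓝 (h ψ)) := by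
  obtain ⟨v', f, hv', hvu', hf, hp⟩ := hh
  obtain rfl : v = v' := IsGrad.unique hv ⟨hv', hvu'⟩
  obtain ⟨h', hp', hlim⟩ := exists_isProduct hB hb hα hα1 hαβ (hvA.comp_isLip hF) hf
  rw [hp.unique hp']
  exact hlim a A' ha ψ

/-- The constant in the estimates of the nonlinear term. -/
def nlC (φ : DyadicCutoff d) (F : Rd d → ℝ) (L M α β : ℝ) : ℝ :=
  prodC φ α β * Kc φ * (|F 0| + L * gradHC φ α + M * gradHC φ α ^ 2)

theorem IsLip.nlC_nonneg (hF : IsLip F L M) (φ : DyadicCutoff d) (α β : ℝ) :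
    0 ≤ nlC φ F L M α β := by
  have := hF.nonneg; have := hF.nonneg'
  have := prodC_nonneg φ α β; have := Kc_nonneg φ; have := gradHC_nonneg φ α
  rw [nlC]; positivity

/-- Existence of and bound for the nonlinear term. -/
theorem exists_isNonlinearTerm (hF : IsLip F L M) (hα : 0 < α) (hα1 : α < 1) (hβ : β < 0)
    (hαβ : 0 < α + β) (hA : 0 ≤ A) (hur : IsRealDistribution u) (hu : HasBound φ (α + 1) A u)
    (hB : 0 ≤ B) (hbr : IsRealDistribution b) (hb : HasBound φ β B b) :
    ∃ h, IsNonlinearTerm φ F u b h ∧ IsRealDistribution h ∧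
      HasBound φ β (nlC φ F L M α β * (1 + A) * B) h := by
  obtain ⟨v, hv, hvA⟩ := hu.exists_grad hur hA hα hα1
  have hf := hvA.comp_isLip hF
  obtain ⟨f, hfg⟩ := exists_isGivenBy (hf.continuous hα) hf.1
  obtain ⟨h, hp, hlim⟩ := exists_isProduct hB hb hα hα1.le hαβ hf hfg
  have hap := exists_isApprox_gauss φ hα hα1.le hf
  refine ⟨h, ⟨v, f, hv.1, hv.2, hfg, hp⟩, isReal_of_tendsto (fun n ψ hψ => ?_) (hlim _ _ hap),
    (hasBound_of_tendsto (fun n => hb.smul hB hα.le hα1.le hβ hαβ (hap.temperate n)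
      (hap.holder n)) (hlim _ _ hap)).mono ?_⟩
  · rw [TemperedDistribution.smulLeftCLM_apply_apply]
    refine hbr _ fun x => ?_
    rw [SchwartzMap.smulLeftCLM_apply_apply (hap.temperate n), smul_eq_mul, Complex.mul_im, hψ,
      regu_gauss_im (fun x => Complex.ofReal_im _)]
    ring
  · have h1 := hF.nonneg; have h2 := hF.nonneg'
    have h3 := prodC_nonneg φ α β; have h4 := Kc_nonneg φ; have h5 := gradHC_nonneg φ α
    rw [nlC, mul_assoc _ (Kc φ), mul_assoc _ (_ * _) (1 + A), mul_assoc (Kc φ)]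
    gcongr
    have h6 : 0 ≤ |F 0| * A := by positivity
    have h7 : 0 ≤ L * gradHC φ α := by positivity
    have h8 : 0 ≤ M * gradHC φ α ^ 2 * (1 + A) := by positivity
    linarith

/-- Local Lipschitz continuity of the nonlinear term. -/
theorem IsNonlinearTerm.hasBound_sub (hh : IsNonlinearTerm φ F u b h)
    (hh' : IsNonlinearTerm φ F u' b h') (hF : IsLip F L M) (hα : 0 < α) (hα1 : α < 1) (hβ : β < 0)
    (hαβ : 0 < α + β) (hA : 0 ≤ A) (hur : IsRealDistribution u) (hu : HasBound φ (α + 1) A u)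
    (hur' : IsRealDistribution u') (hu' : HasBound φ (α + 1) A u') (hδ : 0 ≤ δ)
    (hd : HasBound φ (α + 1) δ (u - u')) (hB : 0 ≤ B) (hb : HasBound φ β B b) :
    HasBound φ β (nlC φ F L M α β * (1 + A) * δ * B) (h - h') := by
  obtain ⟨v, hv, hvA⟩ := hu.exists_grad hur hA hα hα1
  obtain ⟨v', hv', hvA'⟩ := hu'.exists_grad hur' hA hα hα1
  have hdH := (hv.sub hv').holderBound (hur.sub hur') hδ hd hα hα1
  have hf := hvA.comp_isLip hF
  have hf' := hvA'.comp_isLip hF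
  have hff := HolderBound.comp_sub_comp hF hvA' hdH
  have hap := exists_isApprox_gauss φ hα hα1.le hf
  have hap' := exists_isApprox_gauss φ hα hα1.le hf'
  have hapd := exists_isApprox_gauss φ hα hα1.le hff
  have hlim := hh.tendsto hF hα hα1.le hαβ hv hvA hB hb hap
  have hlim' := hh'.tendsto hF hα hα1.le hαβ hv' hvA' hB hb hap'
  refine (hasBound_of_tendsto (D := fun n => _) (fun n => hb.smul hB hα.le hα1.le hβ hαβ
    (hapd.temperate n) (hapd.holder n)) fun ψ => ?_).mono ?_
  · refine ((hlim ψ).sub (hlim' ψ)).congr fun n => ?_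
    rw [regu_sub _ _ (hf.continuous hα) hf.1 (hf'.continuous hα) hf'.1]
    simp only [TemperedDistribution.smulLeftCLM_apply_apply]
    rw [← map_sub]
    congr 1
    ext x
    rw [sub_apply, SchwartzMap.smulLeftCLM_apply_apply (hap.temperate n),
      SchwartzMap.smulLeftCLM_apply_apply (hap'.temperate n), SchwartzMap.smulLeftCLM_apply_apply
      ((hap.temperate n).sub (hap'.temperate n)), Pi.sub_apply, sub_smul]
  · have h1 := hF.nonneg; have h2 := hF.nonneg'
    have h3 := prodC_nonneg φ α β; have h4 := Kc_nonneg φ; have h5 := gradHC_nonneg φ α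
    have h6 : 0 ≤ |F 0| * (1 + A) := by positivity
    have h7 : 0 ≤ L * gradHC φ α * A := by positivity
    have h8 : 0 ≤ M * gradHC φ α ^ 2 := by positivity
    have h9 : L * gradHC φ α + M * gradHC φ α ^ 2 * A ≤
        (|F 0| + L * gradHC φ α + M * gradHC φ α ^ 2) * (1 + A) := by linarith
    calc _ = prodC φ α β * Kc φ * (L * gradHC φ α + M * gradHC φ α ^ 2 * A) * δ * B := by ring
      _ ≤ prodC φ α β * Kc φ * ((|F 0| + L * gradHC φ α + M * gradHC φ α ^ 2) * (1 + A)) * δ *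
          B := by gcongr
      _ = _ := by rw [nlC]; ring

end nonlinear

/-! ### Measurability and continuity in time -/

/-- Measurability of the diagonal of a function that is measurable in one variable and continuous
in the other. -/
theorem aemeasurable_diagonal {H : ℝ → ℝ → ℂ} {T : ℝ} (hT : 0 ≤ T)
    (h1 : ∀ r ∈ Icc 0 T, AEMeasurable (H r) (volume.restrict (Icc 0 T)))
    (h2 : ∀ᵐ s ∂(volume.restrict (Icc 0 T)), ContinuousOn (fun r => H r s) (Icc 0 T)) :
    AEMeasurable (fun s => H s s) (volume.restrict (Icc 0 T)) := by
  -- The first variable is discretized to `⌊s n⌋ / n`, capped at `T`. For each `n` only countably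
  -- many sections occur, so the discretized diagonal is measurable.
  set g : ℕ → ℕ → ℝ := fun n k => min ((k : ℝ) / n) T with hg
  have hg0 : ∀ n k, g n k ∈ Icc 0 T := fun n k =>
    ⟨le_min (by positivity) hT, min_le_right _ _⟩
  have h3 : ∀ n : ℕ, AEMeasurable (fun s : ℝ => H (g n ⌊s * n⌋₊) s) (volume.restrict (Icc 0 T)) := by
    intro n
    have h4 : ∀ k, ∃ f : ℝ → ℂ, Measurable f ∧ H (g n k) =ᵐ[volume.restrict (Icc 0 T)] f :=
      fun k => h1 _ (hg0 n k)
    choose f hf hHf using h4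
    have hm : Measurable fun p : ℕ × ℝ => f p.1 p.2 := measurable_from_prod_countable_right hf
    have hm2 : Measurable fun s : ℝ => (⌊s * n⌋₊, s) :=
      (Nat.measurable_floor.comp (measurable_id.mul_const (n : ℝ))).prodMk measurable_id
    refine ⟨fun s => f ⌊s * n⌋₊ s, hm.comp hm2, ?_⟩
    filter_upwards [ae_all_iff.2 hHf] with s hs
    exact hs _
  refine aemeasurable_of_tendsto_metrizable_ae atTop h3 ?_
  filter_upwards [h2, ae_restrict_mem measurableSet_Icc] with s hs hsT
  have h4 : Tendsto (fun n : ℕ => (⌊s * n⌋₊ : ℝ) / n) atTop (𝓝 s) :=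
    (tendsto_nat_floor_mul_div_atTop hsT.1).comp tendsto_natCast_atTop_atTop
  have h5 : Tendsto (fun n : ℕ => g n ⌊s * n⌋₊) atTop (𝓝 s) := by
    have := h4.min (tendsto_const_nhds (x := T))
    rwa [min_eq_left hsT.2] at this
  exact (hs s hsT).tendsto.comp (tendsto_nhdsWithin_iff.2 ⟨h5, .of_forall fun n => hg0 n _⟩)

theorem l1_le_w11 (ψ : 𝓢(Rd d, ℂ)) : l1 ψ ≤ w11 ψ := by
  have h1 := l1_nonneg ψ
  have h2 : 0 ≤ ∫ x, ‖fderiv ℝ ψ x‖ := integral_nonneg fun _ => norm_nonneg _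
  rw [w11]
  linarith

theorem HasBound.apply_le_w11 {γ A : ℝ} {f : 𝓢'(Rd d, ℂ)} (hA : 0 ≤ A) (hf : HasBound φ γ A f)
    (hγ : -1 < γ) (ψ : 𝓢(Rd d, ℂ)) : ‖f ψ‖ ≤ 2 * (geo (γ + 1) * Kc φ * A) * w11 ψ := by
  have hg := geo_nonneg (γ + 1); have hK := Kc_nonneg φ
  refine (hf.apply_le hA zero_le_one le_rfl (by linarith) (w11_nonneg ψ)
    (hasModulus_w11 ψ zero_le_one le_rfl)).trans ?_
  have : geo (γ + 1) * Kc φ * A * (l1 ψ + w11 ψ) ≤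
      geo (γ + 1) * Kc φ * A * (w11 ψ + w11 ψ) := by
    gcongr
    exact l1_le_w11 ψ
  linarith

theorem continuousOn_of_holder {f : ℝ → ℂ} {S : Set ℝ} {C a : ℝ} (ha : 0 < a)
    (h : ∀ p ∈ S, ∀ q ∈ S, q ≤ p → ‖f p - f q‖ ≤ C * (p - q) ^ a) : ContinuousOn f S := by
  intro t ht
  rw [ContinuousWithinAt, tendsto_iff_norm_sub_tendsto_zero]
  have h5 : Tendsto (fun s : ℝ => C * |s - t| ^ a) (𝓝[S] t) (𝓝 0) := by
    have : ContinuousAt (fun s : ℝ => C * |s - t| ^ a) t :=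
      ContinuousAt.const_mul (ContinuousAt.rpow_const (by fun_prop) (Or.inr ha.le)) _
    have h6 := this.tendsto
    simp only [sub_self, abs_zero, Real.zero_rpow ha.ne', mul_zero] at h6
    exact h6.mono_left nhdsWithin_le_nhds
  refine squeeze_zero' (.of_forall fun _ => norm_nonneg _) ?_ h5
  filter_upwards [self_mem_nhdsWithin] with s hs
  rcases le_total t s with h1 | h1
  · rw [abs_of_nonneg (sub_nonneg.2 h1)]
    exact h s hs t ht h1
  · rw [norm_sub_rev, abs_sub_comm, abs_of_nonneg (sub_nonneg.2 h1)]
    exact h t ht s hs h1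

/-- Continuity in time of the heat semigroup, tested against a fixed function. -/
theorem HasBound.continuousOn_heatS {γ A : ℝ} {f : 𝓢'(Rd d, ℂ)} (hA : 0 ≤ A)
    (hf : HasBound φ γ A f) (hγ : -1 < γ) (hγ1 : γ ≤ 1) (ψ : 𝓢(Rd d, ℂ)) :
    ContinuousOn (fun t => f (heatS t ψ)) (Ici 0) := by
  -- Half of the room above regularity `-1` is spent on continuity in time; the remaining regularity
  -- `γ - a > -1` still permits testing with `W^{1,1}` functions.
  set a := (γ + 1) / 2 with ha
  set C := 2 * (geo (γ - a + 1) * Kc φ * (Kc φ ^ 2 * (Kc φ * A))) * w11 ψ with hC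
  have hK := Kc_nonneg φ
  have ha0 : 0 < a / 2 := by rw [ha]; linarith
  refine continuousOn_of_holder (C := C) ha0 fun p _ q hq hqp => ?_
  have h1 := hf.heat hA hq
  have h2 : HasBound φ (γ - a + a) (Kc φ * A) (SingularPDE.heat q f) := by
    rwa [sub_add_cancel]
  have h3 := (h2.heat_sub (by positivity) (sub_nonneg.2 hqp) (by linarith)
    (by linarith)).apply_le_w11 (by have := sub_nonneg.2 hqp; positivity) (by linarith) ψ
  have h4 : (SingularPDE.heat (p - q) (SingularPDE.heat q f) - SingularPDE.heat q f) ψ =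
      f (heatS p ψ) - f (heatS q ψ) := by
    have : (SingularPDE.heat (p - q) (SingularPDE.heat q f) - SingularPDE.heat q f) ψ =
      SingularPDE.heat (p - q) (SingularPDE.heat q f) ψ - SingularPDE.heat q f ψ := rfl
    rw [this, heat_apply' (sub_nonneg.2 hqp), heat_apply' hq, heat_apply' hq,
      heatS_add hq (sub_nonneg.2 hqp), add_sub_cancel]
  rw [h4] at h3
  exact h3.trans (le_of_eq (by rw [hC]; ring))

/-- The dual form of the norm makes Minkowski's inequality for a weak integral a scalar estimate for
each `j` and `ψ`. -/
theorem HasBound.integral {H : ℝ → 𝓢'(Rd d, ℂ)} {D : 𝓢'(Rd d, ℂ)} {k : ℝ → ℝ} {γ p q : ℝ}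
    (hpq : p ≤ q) (hk : IntervalIntegrable k volume p q)
    (h : ∀ᵐ r, r ∈ Ioc p q → HasBound φ γ (k r) (H r)) (hD : ∀ ψ, D ψ = ∫ r in p..q, H r ψ) :
    HasBound φ γ (∫ r in p..q, k r) D := by
  intro j ψ
  rw [hD, mul_assoc, ← intervalIntegral.integral_mul_const]
  refine intervalIntegral.norm_integral_le_of_norm_le hpq ?_ (hk.mul_const _)
  filter_upwards [h] with r hr hrpq
  rw [← mul_assoc]
  exact hr hrpq j ψ

/-! ### The singular kernel and Duhamel integrals -/

/-- The weighted mass of the singular kernel. -/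
def wt (θ ρ T : ℝ) : ℝ := ∫ r in (0 : ℝ)..T, Real.exp (-ρ * r) * (1 + r ^ (-θ))

theorem intervalIntegrable_wt {θ : ℝ} (hθ : θ < 1) (ρ p q : ℝ) :
    IntervalIntegrable (fun r => Real.exp (-ρ * r) * (1 + r ^ (-θ))) volume p q :=
  IntervalIntegrable.continuousOn_mul
    (intervalIntegrable_const.add (intervalIntegral.intervalIntegrable_rpow' (by linarith)))
    (by fun_prop)

theorem wt_mono {θ : ℝ} (hθ : θ < 1) (ρ : ℝ) {t T : ℝ} (ht : 0 ≤ t) (htT : t ≤ T) :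
    wt θ ρ t ≤ wt θ ρ T := by
  refine intervalIntegral.integral_mono_interval le_rfl ht htT ?_ (intervalIntegrable_wt hθ ρ 0 T)
  filter_upwards [ae_restrict_mem measurableSet_Ioc] with r hr
  have := hr.1.le
  simp only [Pi.zero_apply]
  positivity

theorem wt_nonneg (θ ρ : ℝ) {T : ℝ} (hT : 0 ≤ T) : 0 ≤ wt θ ρ T :=
  intervalIntegral.integral_nonneg hT fun r hr => by
    have := hr.1
    positivity

/-- Dominated convergence, the integrand with weight zero being the dominating function. This
smallness replaces a short time interval in the fixed point argument. -/
theorem tendsto_wt {θ : ℝ} (hθ : θ < 1) {T : ℝ} (hT : 0 ≤ T) :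
    Tendsto (fun ρ => wt θ ρ T) atTop (𝓝 0) := by
  have h0 : (0 : ℝ) = ∫ r in (0 : ℝ)..T, (0 : ℝ) := by simp
  rw [h0]
  refine intervalIntegral.tendsto_integral_filter_of_dominated_convergence
    (fun r => Real.exp (-0 * r) * (1 + r ^ (-θ)))
    (.of_forall fun ρ => (intervalIntegrable_iff.1 (intervalIntegrable_wt hθ ρ 0 T)).1) ?_
    (intervalIntegrable_wt hθ 0 0 T) (ae_of_all _ fun r hr => ?_)
  · filter_upwards [eventually_ge_atTop 0] with ρ hρ
    refine ae_of_all _ fun r hr => ?_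
    rw [uIoc_of_le hT] at hr
    have := hr.1.le
    rw [Real.norm_of_nonneg (by positivity)]
    gcongr
  · rw [uIoc_of_le hT] at hr
    have h1 : Tendsto (fun ρ : ℝ => Real.exp (-ρ * r)) atTop (𝓝 0) :=
      Real.tendsto_exp_atBot.comp (tendsto_neg_atTop_atBot.atBot_mul_const hr.1)
    simpa using h1.mul_const (1 + r ^ (-θ))

theorem intervalIntegrable_wt_sub {θ : ℝ} (hθ : θ < 1) (ρ t p q : ℝ) :
    IntervalIntegrable (fun r => Real.exp (ρ * r) * (1 + (t - r) ^ (-θ))) volume p q := by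
  have h := (intervalIntegrable_wt hθ 0 (t - p) (t - q)).comp_sub_left t
  simp only [sub_sub_cancel, neg_zero, zero_mul, Real.exp_zero, one_mul] at h
  exact h.continuousOn_mul (by fun_prop)

theorem integral_wt_sub (θ ρ t : ℝ) :
    ∫ r in (0 : ℝ)..t, Real.exp (ρ * r) * (1 + (t - r) ^ (-θ)) = wt θ ρ t * Real.exp (ρ * t) := by
  have h := intervalIntegral.integral_comp_sub_left (a := 0) (b := t)
    (fun r => Real.exp (-ρ * r) * (1 + r ^ (-θ)) * Real.exp (ρ * t)) t
  rw [sub_self, sub_zero] at h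
  rw [wt, ← intervalIntegral.integral_mul_const, ← h]
  refine intervalIntegral.integral_congr fun r _ => ?_
  rw [mul_right_comm, ← Real.exp_add]
  congr 2
  ring

theorem integral_wt_tail {θ s t : ℝ} (hθ : θ < 1) :
    ∫ r in s..t, (1 + (t - r) ^ (-θ)) = (t - s) + (t - s) ^ (1 - θ) / (1 - θ) := by
  rw [intervalIntegral.integral_comp_sub_left (fun r => 1 + r ^ (-θ)) t, sub_self,
    intervalIntegral.integral_add intervalIntegrable_const
      (intervalIntegral.intervalIntegrable_rpow' (by linarith)),
    integral_rpow (Or.inl (by linarith)), intervalIntegral.integral_const,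
    show -θ + 1 = 1 - θ by ring, Real.zero_rpow (by linarith)]
  simp

/-- Forcing terms: measurable and bounded in time with values in `𝓒^β`. -/
structure IsForcing (φ : DyadicCutoff d) (β T K : ℝ) (G : ℝ → 𝓢'(Rd d, ℂ)) : Prop where
  measurable : ∀ ψ : 𝓢(Rd d, ℂ), AEMeasurable (fun s => G s ψ) (volume.restrict (Icc 0 T))
  bound : ∀ᵐ s ∂(volume.restrict (Icc 0 T)), HasBound φ β K (G s)

/-- `D(t) = ∫₀ᵗ P_{t-s} G(s) ds`. -/
def IsDuhamel (T : ℝ) (G D : ℝ → 𝓢'(Rd d, ℂ)) : Prop :=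
  ∀ t ∈ Icc 0 T, ∀ ψ : 𝓢(Rd d, ℂ),
    IntervalIntegrable (fun s => heat (t - s) (G s) ψ) volume 0 t ∧
    D t ψ = ∫ s in (0 : ℝ)..t, heat (t - s) (G s) ψ

section duhamel
variable {β T K : ℝ} {G G' D D' : ℝ → 𝓢'(Rd d, ℂ)}

theorem ae_Ioc_of_ae_Icc {P : ℝ → Prop} (h : ∀ᵐ s ∂(volume.restrict (Icc 0 T)), P s) {s t : ℝ}
    (hs : 0 ≤ s) (htT : t ≤ T) : ∀ᵐ r, r ∈ Ioc s t → P r := by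
  filter_upwards [(ae_restrict_iff' measurableSet_Icc).1 h] with r hr hrt
  exact hr ⟨hs.trans hrt.1.le, hrt.2.trans htT⟩

theorem IsForcing.intervalIntegrable (hG : IsForcing φ β T K G) (hK : 0 ≤ K) (hβ : -1 < β)
    (hβ0 : β ≤ 1) {t : ℝ} (ht : t ∈ Icc 0 T) (ψ : 𝓢(Rd d, ℂ)) :
    IntervalIntegrable (fun s => heat (t - s) (G s) ψ) volume 0 t ∧
      ‖∫ s in (0 : ℝ)..t, heat (t - s) (G s) ψ‖ ≤
        T * (2 * (geo (β + 1) * Kc φ * (Kc φ * K))) * w11 ψ := by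
  have hKc := Kc_nonneg φ
  have hge := geo_nonneg (β + 1)
  have hw := w11_nonneg ψ
  have hbt := ae_Ioc_of_ae_Icc hG.bound le_rfl ht.2
  have h1 : AEMeasurable (fun s => G s (heatS (t - s) ψ)) (volume.restrict (Icc 0 t)) := by
    -- The time in the semigroup is separated from the time in `G`: measurability is known in the
    -- latter and continuity in the former.
    refine aemeasurable_diagonal (H := fun r s => G s (heatS (t - r) ψ)) ht.1 (fun r hr => ?_) ?_
    · exact (hG.measurable _).mono_measure (Measure.restrict_mono (Icc_subset_Icc_right ht.2) le_rfl)
    · filter_upwards [ae_restrict_of_ae_restrict_of_subset (Icc_subset_Icc_right ht.2) hG.bound]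
        with s hs
      exact (hs.continuousOn_heatS hK hβ hβ0 ψ).comp (by fun_prop)
        fun r hr => by simpa using hr.2
  have h2 : ∀ᵐ r, r ∈ Ioc 0 t → ‖heat (t - r) (G r) ψ‖ ≤
      2 * (geo (β + 1) * Kc φ * (Kc φ * K)) * w11 ψ := by
    filter_upwards [hbt] with r hr hrt
    exact ((hr hrt).heat hK (sub_nonneg.2 hrt.2)).apply_le_w11 (by positivity) hβ ψ
  constructor
  · rw [intervalIntegrable_iff_integrableOn_Ioc_of_le ht.1]
    refine (integrable_const (2 * (geo (β + 1) * Kc φ * (Kc φ * K)) * w11 ψ)).mono' ?_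
      ((ae_restrict_iff' measurableSet_Ioc).2 h2)
    refine AEMeasurable.aestronglyMeasurable ?_
    refine (h1.mono_measure (Measure.restrict_mono Ioc_subset_Icc_self le_rfl)).congr ?_
    filter_upwards [ae_restrict_mem measurableSet_Ioc] with r hr
    rw [heat_apply' (sub_nonneg.2 hr.2)]
  · have h3 := intervalIntegral.norm_integral_le_of_norm_le ht.1 h2 intervalIntegrable_const
    refine h3.trans ?_
    rw [intervalIntegral.integral_const, sub_zero, smul_eq_mul, mul_assoc T]
    gcongr
    exact ht.2

theorem IsForcing.exists_isDuhamel (hG : IsForcing φ β T K G) (hK : 0 ≤ K) (hβ : -1 < β)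
    (hβ0 : β ≤ 1) : ∃ D, IsDuhamel T G D := by
  have h : ∀ t : ℝ, ∃ D : 𝓢'(Rd d, ℂ), t ∈ Icc 0 T → ∀ ψ : 𝓢(Rd d, ℂ),
      D ψ = ∫ s in (0 : ℝ)..t, heat (t - s) (G s) ψ := by
    intro t
    by_cases ht : t ∈ Icc 0 T
    · have hi := fun ψ => hG.intervalIntegrable hK hβ hβ0 ht ψ
      obtain ⟨D, hD⟩ := exists_distribution
        { toFun := fun ψ => ∫ s in (0 : ℝ)..t, heat (t - s) (G s) ψ
          map_add' := fun ψ χ => by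
            simp only [map_add]
            exact intervalIntegral.integral_add (hi ψ).1 (hi χ).1
          map_smul' := fun c ψ => by
            simp only [map_smul]
            exact intervalIntegral.integral_smul _ _ } (fun ψ => (hi ψ).2)
      exact ⟨D, fun _ => hD⟩
    · exact ⟨0, fun h => (ht h).elim⟩
  choose D hD using h
  exact ⟨D, fun t ht ψ => ⟨(hG.intervalIntegrable hK hβ hβ0 ht ψ).1, hD t ht ψ⟩⟩

theorem IsDuhamel.sub (h : IsDuhamel T G D) (h' : IsDuhamel T G' D') :
    IsDuhamel T (fun s => G s - G' s) (fun s => D s - D' s) := fun t ht ψ => by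
  have h1 : ∀ s, heat (t - s) (G s - G' s) ψ = heat (t - s) (G s) ψ - heat (t - s) (G' s) ψ :=
    fun s => by rw [heat, map_sub]; rfl
  have h2 : (D t - D' t) ψ = D t ψ - D' t ψ := rfl
  simp only [h1, h2]
  refine ⟨(h t ht ψ).1.sub (h' t ht ψ).1, ?_⟩
  rw [(h t ht ψ).2, (h' t ht ψ).2, intervalIntegral.integral_sub (h t ht ψ).1 (h' t ht ψ).1]

theorem IsDuhamel.isReal (h : IsDuhamel T G D)
    (hG : ∀ᵐ s ∂(volume.restrict (Icc 0 T)), IsRealDistribution (G s)) {t : ℝ} (ht : t ∈ Icc 0 T) :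
    IsRealDistribution (D t) := fun ψ hψ => by
  rw [(h t ht ψ).2]
  have h1 : ∫ s in (0 : ℝ)..t, heat (t - s) (G s) ψ =
      ∫ s in (0 : ℝ)..t, (((heat (t - s) (G s) ψ).re : ℝ) : ℂ) := by
    refine intervalIntegral.integral_congr_ae ?_
    rw [uIoc_of_le ht.1]
    filter_upwards [ae_Ioc_of_ae_Icc hG le_rfl ht.2] with r hr hrt
    refine Complex.ext (by simp) ?_
    rw [Complex.ofReal_im]
    exact (hr hrt).heat (sub_nonneg.2 hrt.2) ψ hψ
  rw [h1, intervalIntegral.integral_ofReal, Complex.ofReal_im]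

theorem ae_hasBound_heat {k : ℝ → ℝ} (hk : ∀ r, 0 ≤ k r)
    (hG : ∀ᵐ s ∂(volume.restrict (Icc 0 T)), HasBound φ β (k s) (G s)) {θ : ℝ} (hθ : 0 ≤ θ)
    (hθ1 : θ ≤ 1) {s t : ℝ} (hs : 0 ≤ s) (ht : t ≤ T) :
    ∀ᵐ r, r ∈ Ioc s t → HasBound φ (β + 2 * θ) (2 * Kc φ ^ 4 * k r * (1 + (t - r) ^ (-θ)))
      (heat (t - r) (G r)) := by
  have hne : ∀ᵐ r : ℝ, r ≠ t := by simp [ae_iff, measure_singleton]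
  filter_upwards [ae_Ioc_of_ae_Icc hG hs ht, hne] with r hr hrt hrst
  exact (hr hrst).heat_smoothing (hk r) (sub_pos.2 (lt_of_le_of_ne hrst.2 hrt)) hθ hθ1

theorem IsDuhamel.hasBound (h : IsDuhamel T G D) (hK : 0 ≤ K) {ρ : ℝ}
    (hG : ∀ᵐ s ∂(volume.restrict (Icc 0 T)), HasBound φ β (K * Real.exp (ρ * s)) (G s))
    {θ : ℝ} (hθ : 0 ≤ θ) (hθ1 : θ < 1) {t : ℝ} (ht : t ∈ Icc 0 T) :
    HasBound φ (β + 2 * θ) (2 * Kc φ ^ 4 * wt θ ρ T * K * Real.exp (ρ * t)) (D t) := by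
  have hKc := Kc_nonneg φ
  have h1 := HasBound.integral ht.1
    (k := fun r => 2 * Kc φ ^ 4 * K * (Real.exp (ρ * r) * (1 + (t - r) ^ (-θ))))
    ((intervalIntegrable_wt_sub hθ1 ρ t 0 t).const_mul _) (H := fun r => heat (t - r) (G r)) (by
      filter_upwards [ae_hasBound_heat (fun r => by positivity) hG hθ hθ1.le le_rfl ht.2]
        with r hr hrt
      exact (hr hrt).mono (le_of_eq (by ring))) (fun ψ => (h t ht ψ).2)
  refine h1.mono ?_
  rw [intervalIntegral.integral_const_mul, integral_wt_sub]
  have := wt_mono hθ1 ρ ht.1 ht.2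
  calc _ = 2 * Kc φ ^ 4 * wt θ ρ t * K * Real.exp (ρ * t) := by ring
    _ ≤ _ := by gcongr

/-- By the semigroup property the difference is `∫_s^t P_{t-r} G(r) dr`, and the kernel has mass of
order `(t - s)^{1-θ}` on this interval for small `t - s`. -/
theorem IsDuhamel.hasBound_increment (h : IsDuhamel T G D) (hK : 0 ≤ K)
    (hG : ∀ᵐ s ∂(volume.restrict (Icc 0 T)), HasBound φ β K (G s))
    {θ : ℝ} (hθ : 0 ≤ θ) (hθ1 : θ < 1) {s t : ℝ} (hs : 0 ≤ s) (hst : s ≤ t) (ht : t ≤ T) :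
    HasBound φ (β + 2 * θ) (2 * Kc φ ^ 4 * K * ((t - s) + (t - s) ^ (1 - θ) / (1 - θ)))
      (D t - heat (t - s) (D s)) := by
  have ht' : t ∈ Icc 0 T := ⟨hs.trans hst, ht⟩
  have hs' : s ∈ Icc 0 T := ⟨hs, hst.trans ht⟩
  have hKc := Kc_nonneg φ
  have hi := intervalIntegrable_wt_sub hθ1 0 t s t
  simp only [zero_mul, Real.exp_zero, one_mul] at hi
  have h1 := HasBound.integral (D := D t - heat (t - s) (D s)) hst
    (k := fun r => 2 * Kc φ ^ 4 * K * (1 + (t - r) ^ (-θ))) (hi.const_mul _)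
    (H := fun r => heat (t - r) (G r))
    (ae_hasBound_heat (fun r => hK) hG hθ hθ1.le hs ht) (fun ψ => by
      have h2 : (D t - heat (t - s) (D s)) ψ = D t ψ - heat (t - s) (D s) ψ := rfl
      rw [h2, heat_apply' (sub_nonneg.2 hst), (h t ht' ψ).2, (h s hs' _).2]
      have h3 : ∫ r in (0 : ℝ)..s, heat (s - r) (G r) (heatS (t - s) ψ) =
          ∫ r in (0 : ℝ)..s, heat (t - r) (G r) ψ := by
        refine intervalIntegral.integral_congr fun r hr => ?_
        rw [uIcc_of_le hs] at hr
        rw [heat_apply' (sub_nonneg.2 hr.2), heat_apply' (by linarith [hr.2]),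
          heatS_add (sub_nonneg.2 hr.2) (sub_nonneg.2 hst)]
        congr 2
        ring_nf
      rw [h3, intervalIntegral.integral_interval_sub_left (h t ht' ψ).1]
      refine (h t ht' ψ).1.mono_set ?_
      rw [uIcc_of_le hs, uIcc_of_le ht'.1]
      exact Icc_subset_Icc_right hst)
  rwa [intervalIntegral.integral_const_mul, integral_wt_tail hθ1] at h1

end duhamel

/-! ### Picard's map: invariant set, contraction and fixed point -/

/-- The assumptions on the coefficients of the equation. -/
structure IsSetting (φ : DyadicCutoff d) (F : Rd d → ℝ) (L M α β T B : ℝ)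
    (b : ℝ → 𝓢'(Rd d, ℂ)) : Prop where
  isLip : IsLip F L M
  pos : 0 < α
  lt_one : α < 1
  neg : β < 0
  add_pos : 0 < α + β
  sub_lt : α - 1 < β
  time_pos : 0 < T
  bound_nonneg : 0 ≤ B
  measurable : ∀ ψ : 𝓢(Rd d, ℂ), AEMeasurable (fun s => b s ψ) (volume.restrict (Icc 0 T))
  bound : ∀ᵐ s ∂(volume.restrict (Icc 0 T)), IsRealDistribution (b s) ∧ HasBound φ β B (b s)

/-- `u' = P u₀ + ∫ P (F(∇u) b)`. -/
def IsMildMap (φ : DyadicCutoff d) (F : Rd d → ℝ) (T : ℝ) (b : ℝ → 𝓢'(Rd d, ℂ))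
    (u₀ : 𝓢'(Rd d, ℂ)) (u u' : ℝ → 𝓢'(Rd d, ℂ)) : Prop :=
  ∃ G : ℝ → 𝓢'(Rd d, ℂ),
    (∀ᵐ s ∂(volume.restrict (Icc 0 T)), IsNonlinearTerm φ F (u s) (b s) (G s)) ∧
    ∀ t ∈ Icc 0 T, ∀ ψ : 𝓢(Rd d, ℂ),
      IntervalIntegrable (fun s => heat (t - s) (G s) ψ) volume 0 t ∧
      u' t ψ = heat t u₀ ψ + ∫ s in (0 : ℝ)..t, heat (t - s) (G s) ψ

theorem IsMildMap.isDuhamel {F : Rd d → ℝ} {T : ℝ} {b u u' : ℝ → 𝓢'(Rd d, ℂ)} {u₀ : 𝓢'(Rd d, ℂ)}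
    (h : IsMildMap φ F T b u₀ u u') : ∃ G : ℝ → 𝓢'(Rd d, ℂ),
      (∀ᵐ s ∂(volume.restrict (Icc 0 T)), IsNonlinearTerm φ F (u s) (b s) (G s)) ∧
      IsDuhamel T G fun t => u' t - heat t u₀ := by
  obtain ⟨G, hG, hD⟩ := h
  refine ⟨G, hG, fun t ht ψ => ⟨(hD t ht ψ).1, ?_⟩⟩
  have : (u' t - heat t u₀) ψ = u' t ψ - heat t u₀ ψ := rfl
  rw [this, (hD t ht ψ).2, add_sub_cancel_left]

/-- Uniform bounds on `[0,T]`. -/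
def IsBdd (φ : DyadicCutoff d) (γ T A : ℝ) (u : ℝ → 𝓢'(Rd d, ℂ)) : Prop :=
  ∀ t ∈ Icc 0 T, IsRealDistribution (u t) ∧ HasBound φ γ A (u t)

/-- Functions of time with an exponentially weighted bound and a Hölder bound. -/
structure IsAdm (φ : DyadicCutoff d) (γ T A ρ C ε : ℝ) (u : ℝ → 𝓢'(Rd d, ℂ)) : Prop where
  isReal : ∀ t ∈ Icc 0 T, IsRealDistribution (u t)
  bound : ∀ t ∈ Icc 0 T, HasBound φ γ (A * Real.exp (ρ * t)) (u t)
  holder : ∀ s t, 0 ≤ s → s ≤ t → t ≤ T → HasBound φ γ (C * (t - s) ^ ε) (u t - u s)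

theorem IsAdm.isBdd {γ T A ρ C ε : ℝ} {u : ℝ → 𝓢'(Rd d, ℂ)} (h : IsAdm φ γ T A ρ C ε u)
    (hA : 0 ≤ A) (hρ : 0 ≤ ρ) : IsBdd φ γ T (A * Real.exp (ρ * T)) u := fun t ht =>
  ⟨h.isReal t ht, (h.bound t ht).mono (by have := ht.2; gcongr)⟩

/-- The nonlinear term, where it exists. -/
def nl (φ : DyadicCutoff d) (F : Rd d → ℝ) (u b : 𝓢'(Rd d, ℂ)) : 𝓢'(Rd d, ℂ) :=
  Classical.epsilon fun h => IsNonlinearTerm φ F u b h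

theorem rpow_le_mul_rpow {x T ε p : ℝ} (hx : 0 ≤ x) (hxT : x ≤ T) (hε : 0 ≤ ε) (hp : ε ≤ p) :
    x ^ p ≤ T ^ (p - ε) * x ^ ε := by
  have h1 := Real.rpow_add_of_nonneg hx (sub_nonneg.2 hp) hε
  rw [sub_add_cancel] at h1
  rw [h1]
  have := sub_nonneg.2 hp
  gcongr

theorem IsRealDistribution.add {f g : 𝓢'(Rd d, ℂ)} (hf : IsRealDistribution f)
    (hg : IsRealDistribution g) : IsRealDistribution (f + g) := fun ψ hψ => by
  have : (f + g) ψ = f ψ + g ψ := rfl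
  rw [this, Complex.add_im, hf ψ hψ, hg ψ hψ, add_zero]

theorem heat_heat {s t : ℝ} (hs : 0 ≤ s) (ht : 0 ≤ t) (f : 𝓢'(Rd d, ℂ)) :
    heat t (heat s f) = heat (s + t) f := by
  ext ψ
  rw [heat_apply' ht, heat_apply' hs, heat_apply' (by positivity), heatS_add hs ht]

theorem heat_map_add (t : ℝ) (f g : 𝓢'(Rd d, ℂ)) : heat t (f + g) = heat t f + heat t g :=
  map_add _ f g

section setting
variable {F : Rd d → ℝ} {L M α β T B A : ℝ} {b u u' w w' : ℝ → 𝓢'(Rd d, ℂ)} {u₀ : 𝓢'(Rd d, ℂ)}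

theorem IsSetting.isNonlinearTerm_nl (S : IsSetting φ F L M α β T B b) (hA : 0 ≤ A)
    {v g : 𝓢'(Rd d, ℂ)} (hv : IsRealDistribution v) (hvA : HasBound φ (α + 1) A v)
    (hg : IsRealDistribution g) (hgB : HasBound φ β B g) :
    IsNonlinearTerm φ F v g (nl φ F v g) := by
  obtain ⟨h, hh, -, -⟩ := exists_isNonlinearTerm S.isLip S.pos S.lt_one S.neg S.add_pos hA hv hvA
    S.bound_nonneg hg hgB
  have h1 : ∃ h, IsNonlinearTerm φ F v g h := ⟨h, hh⟩
  exact Classical.epsilon_spec h1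

theorem IsSetting.hasBound_of_isNonlinearTerm (S : IsSetting φ F L M α β T B b) (hA : 0 ≤ A)
    {v g h : 𝓢'(Rd d, ℂ)} (hv : IsRealDistribution v) (hvA : HasBound φ (α + 1) A v)
    (hg : IsRealDistribution g) (hgB : HasBound φ β B g) (hh : IsNonlinearTerm φ F v g h) :
    IsRealDistribution h ∧ HasBound φ β (nlC φ F L M α β * (1 + A) * B) h := by
  obtain ⟨h', hh', h1⟩ := exists_isNonlinearTerm S.isLip S.pos S.lt_one S.neg S.add_pos hA hv hvA
    S.bound_nonneg hg hgB
  rwa [hh.unique hh']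

/-- Hölder continuity of `u` in time is what makes `s ↦ F(∇u(s)) b(s)` measurable, and is one reason
for building it into the set on which Picard's map acts. -/
theorem IsSetting.exists_forcing (S : IsSetting φ F L M α β T B b) (hA : 0 ≤ A)
    (hu : IsBdd φ (α + 1) T A u) {C ε : ℝ} (hC : 0 ≤ C) (hε : 0 < ε)
    (hh : ∀ s t, 0 ≤ s → s ≤ t → t ≤ T → HasBound φ (α + 1) (C * (t - s) ^ ε) (u t - u s)) :
    ∃ G : ℝ → 𝓢'(Rd d, ℂ),
      (∀ᵐ s ∂(volume.restrict (Icc 0 T)), IsNonlinearTerm φ F (u s) (b s) (G s)) ∧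
      IsForcing φ β T (nlC φ F L M α β * (1 + A) * B) G := by
  -- The exceptional null set of times `s` is the same for all `r`, as needed to freeze `u` at one
  -- time and `b` at another.
  have hnl : ∀ᵐ s ∂(volume.restrict (Icc 0 T)), ∀ r ∈ Icc 0 T,
      IsNonlinearTerm φ F (u r) (b s) (nl φ F (u r) (b s)) := by
    filter_upwards [S.bound] with s hs r hr
    exact S.isNonlinearTerm_nl hA (hu r hr).1 (hu r hr).2 hs.1 hs.2
  refine ⟨fun s => nl φ F (u s) (b s), ?_, fun ψ => ?_, ?_⟩
  · filter_upwards [hnl, ae_restrict_mem measurableSet_Icc] with s hs hsT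
    exact hs s hsT
  · refine aemeasurable_diagonal (H := fun r s => nl φ F (u r) (b s) ψ) S.time_pos.le
      (fun r hr => ?_) ?_
    · obtain ⟨v, hv, hvA⟩ := (hu r hr).2.exists_grad (hu r hr).1 hA S.pos S.lt_one
      have hap := exists_isApprox_gauss φ S.pos S.lt_one.le (hvA.comp_isLip S.isLip)
      refine aemeasurable_of_tendsto_metrizable_ae (u := atTop)
        (f := fun (n : ℕ) s => TemperedDistribution.smulLeftCLM ℂ
          (regu (gauss d) (1 / ((n : ℝ) + 1)) fun x => (F (v x) : ℂ)) (b s) ψ) ?_ ?_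
      · intro n
        simp only [TemperedDistribution.smulLeftCLM_apply_apply]
        exact S.measurable _
      · filter_upwards [hnl, S.bound] with s hs hsb
        exact (hs r hr).tendsto S.isLip S.pos S.lt_one.le S.add_pos hv hvA S.bound_nonneg hsb.2
          hap ψ
    · filter_upwards [hnl, S.bound] with s hs hsb
      refine continuousOn_of_holder (C := 2 * (geo (β + 1) * Kc φ *
        (nlC φ F L M α β * (1 + A) * C * B)) * w11 ψ) hε fun p hp q hq hqp => ?_
      have hpq := sub_nonneg.2 hqp
      have hn := S.isLip.nlC_nonneg φ α β
      have hB := S.bound_nonneg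
      have h1 := (hs p hp).hasBound_sub (hs q hq) S.isLip S.pos S.lt_one S.neg S.add_pos hA
        (hu p hp).1 (hu p hp).2 (hu q hq).1 (hu q hq).2 (by positivity) (hh q p hq.1 hqp hp.2)
        S.bound_nonneg hsb.2
      have h2 := h1.apply_le_w11 (by positivity) (by linarith [S.sub_lt, S.pos]) ψ
      exact h2.trans (le_of_eq (by ring))
  · filter_upwards [hnl, S.bound, ae_restrict_mem measurableSet_Icc] with s hs hsb hsT
    exact (S.hasBound_of_isNonlinearTerm hA (hu s hsT).1 (hu s hsT).2 hsb.1 hsb.2 (hs s hsT)).2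

theorem eventually_wt_le {θ : ℝ} (hθ : θ < 1) (hT : 0 ≤ T) (c : ℝ) {η : ℝ} (hη : 0 < η) :
    ∃ ρ, 0 ≤ ρ ∧ c * wt θ ρ T ≤ η := by
  have h1 := (tendsto_wt hθ hT).const_mul c
  rw [mul_zero] at h1
  obtain ⟨ρ, h2, h3⟩ := ((eventually_ge_atTop 0).and (h1.eventually (ge_mem_nhds hη))).exists
  exact ⟨ρ, h2, h3⟩

/-- Picard's map is a contraction in a weighted norm. -/
theorem IsSetting.contraction (S : IsSetting φ F L M α β T B b) (hA : 0 ≤ A) :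
    ∃ σ, 0 ≤ σ ∧ ∀ {u u' w w' : ℝ → 𝓢'(Rd d, ℂ)} {δ : ℝ}, 0 ≤ δ → IsBdd φ (α + 1) T A u →
      IsBdd φ (α + 1) T A w → IsMildMap φ F T b u₀ u u' → IsMildMap φ F T b u₀ w w' →
      (∀ t ∈ Icc 0 T, HasBound φ (α + 1) (δ * Real.exp (σ * t)) (u t - w t)) →
      ∀ t ∈ Icc 0 T, HasBound φ (α + 1) (δ / 2 * Real.exp (σ * t)) (u' t - w' t) := by
  have hα := S.pos; have hβ := S.neg; have hs := S.sub_lt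
  have hn := S.isLip.nlC_nonneg φ α β
  have hB := S.bound_nonneg
  have hθ1 : (α + 1 - β) / 2 < 1 := by linarith
  -- The local Lipschitz constant grows with the radius `A`, so the weight `σ` depends on `A`. The
  -- initial data cancel in the difference.
  obtain ⟨σ, hσ, hw⟩ := eventually_wt_le hθ1 S.time_pos.le
    (2 * Kc φ ^ 4 * (nlC φ F L M α β * (1 + A) * B)) (η := 1 / 2) (by norm_num)
  refine ⟨σ, hσ, fun {u u' w w' δ} hδ hu hw' hmu hmw hd t ht => ?_⟩
  obtain ⟨G, hG, hD⟩ := hmu.isDuhamel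
  obtain ⟨G', hG', hD'⟩ := hmw.isDuhamel
  have h1 := (hD.sub hD').hasBound (φ := φ) (β := β) (K := nlC φ F L M α β * (1 + A) * δ * B)
    (ρ := σ) (by positivity) (by
      filter_upwards [hG, hG', S.bound, ae_restrict_mem measurableSet_Icc] with s hs hs' hsb hsT
      refine (hs.hasBound_sub hs' S.isLip S.pos S.lt_one S.neg S.add_pos hA (hu s hsT).1
        (hu s hsT).2 (hw' s hsT).1 (hw' s hsT).2 (by positivity) (hd s hsT) S.bound_nonneg
        hsb.2).mono (le_of_eq (by ring)))
    (θ := (α + 1 - β) / 2) (by linarith) hθ1 ht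
  rw [sub_sub_sub_cancel_right, show β + 2 * ((α + 1 - β) / 2) = α + 1 by ring] at h1
  refine h1.mono ?_
  calc _ = (2 * Kc φ ^ 4 * (nlC φ F L M α β * (1 + A) * B) * wt ((α + 1 - β) / 2) σ T) *
        (δ * Real.exp (σ * t)) := by ring
    _ ≤ 1 / 2 * (δ * Real.exp (σ * t)) := by gcongr
    _ = _ := by ring

/-- Picard's map preserves a set of functions with uniform bounds. -/
theorem IsSetting.exists_step (S : IsSetting φ F L M α β T B b) {ε A₀ : ℝ} (hε : 0 < ε)
    (hε' : α - 1 - β + 2 * ε < 0) (hA₀ : 0 ≤ A₀) (hu₀r : IsRealDistribution u₀)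
    (hu₀ : HasBound φ (α + 1 + 2 * ε) A₀ u₀) :
    ∃ A ρ C, 0 ≤ A ∧ 0 ≤ ρ ∧ 0 ≤ C ∧ ∀ u, IsAdm φ (α + 1) T A ρ C ε u →
      ∃ u', IsAdm φ (α + 1) T A ρ C ε u' ∧ IsMildMap φ F T b u₀ u u' := by
  have hα := S.pos; have hβ := S.neg; have hs := S.sub_lt; have hT := S.time_pos
  have hn := S.isLip.nlC_nonneg φ α β
  have hB := S.bound_nonneg
  have hKc := Kc_nonneg φ
  set θ := (α + 1 - β) / 2 with hθ
  -- The smoothing that reaches `𝓒^{α+1+2ε}`; the assumption on `ε` says exactly that `θ' < 1`,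
  -- equivalently `ε < 1 - θ`.
  set θ' := (α + 1 + 2 * ε - β) / 2 with hθ'
  have hθ0 : 0 ≤ θ := by rw [hθ]; linarith
  have hθ1 : θ < 1 := by rw [hθ]; linarith
  have hθ0' : 0 ≤ θ' := by rw [hθ']; linarith
  have hθ1' : θ' < 1 := by rw [hθ']; linarith
  have hεθ : ε ≤ 1 - θ := by rw [hθ]; linarith
  -- The first summand bounds `P_t u₀`, and the spare `1` accommodates the Duhamel term once `ρ` is
  -- large. Linear growth of the nonlinearity is essential: it lets the weight `e^{ρs}` pass
  -- through.
  set A := Kc φ * A₀ + 1 with hA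
  have hA0 : 0 ≤ A := by positivity
  obtain ⟨ρ, hρ, hwt⟩ := eventually_wt_le hθ1 hT.le
    (2 * Kc φ ^ 4 * (nlC φ F L M α β * (1 + A) * B)) (η := 1) one_pos
  set K := nlC φ F L M α β * (1 + A * Real.exp (ρ * T)) * B with hK
  have hK0 : 0 ≤ K := by positivity
  have hw0 := wt_nonneg θ' 0 hT.le
  -- The Hölder constant of the image depends on `A` and `ρ` only, not on that of the argument, so
  -- there is no circularity in choosing it.
  set C₁ := Kc φ ^ 2 * (Kc φ * A₀ + 2 * Kc φ ^ 4 * wt θ' 0 T * K) with hC₁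
  set C₂ := 2 * Kc φ ^ 4 * K * (T ^ (1 - ε) + T ^ (1 - θ - ε) / (1 - θ)) with hC₂
  have h1θ : 0 < 1 - θ := sub_pos.2 hθ1
  have hC₁0 : 0 ≤ C₁ := by positivity
  have hC₂0 : 0 ≤ C₂ := by positivity
  refine ⟨A, ρ, C₂ + C₁, hA0, hρ, by positivity, fun u hu => ?_⟩
  have hub := hu.isBdd hA0 hρ
  obtain ⟨G, hG, hGf⟩ := S.exists_forcing (by positivity) hub (by positivity) hε hu.holder
  obtain ⟨D, hD⟩ := hGf.exists_isDuhamel hK0 (by linarith) (by linarith)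
  have hGr : ∀ᵐ s ∂(volume.restrict (Icc 0 T)), IsRealDistribution (G s) := by
    filter_upwards [hG, S.bound, ae_restrict_mem measurableSet_Icc] with s hs hsb hsT
    exact (S.hasBound_of_isNonlinearTerm (by positivity) (hub s hsT).1 (hub s hsT).2 hsb.1 hsb.2
      hs).1
  have hGw : ∀ᵐ s ∂(volume.restrict (Icc 0 T)),
      HasBound φ β (nlC φ F L M α β * (1 + A) * B * Real.exp (ρ * s)) (G s) := by
    filter_upwards [hG, S.bound, ae_restrict_mem measurableSet_Icc] with s hs hsb hsT
    refine (S.hasBound_of_isNonlinearTerm (by positivity) (hu.isReal s hsT) (hu.bound s hsT) hsb.1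
      hsb.2 hs).2.mono ?_
    have h1 : 1 ≤ Real.exp (ρ * s) := Real.one_le_exp (mul_nonneg hρ hsT.1)
    calc _ ≤ nlC φ F L M α β * (Real.exp (ρ * s) + A * Real.exp (ρ * s)) * B := by gcongr
      _ = _ := by ring
  have hu₀' : HasBound φ (α + 1) A₀ u₀ := hu₀.mono_exponent hA₀ (by linarith)
  refine ⟨fun t => heat t u₀ + D t, ⟨fun t ht => ?_, fun t ht => ?_, fun s t hs hst htT => ?_⟩,
    G, hG, fun t ht ψ => ⟨(hD t ht ψ).1, ?_⟩⟩
  · exact (hu₀r.heat ht.1).add (hD.isReal hGr ht)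
  · have h1 := hD.hasBound (by positivity) hGw hθ0 hθ1 ht
    rw [show β + 2 * θ = α + 1 by rw [hθ]; ring] at h1
    refine ((hu₀'.heat hA₀ ht.1).add h1).mono ?_
    have h2 : 1 ≤ Real.exp (ρ * t) := Real.one_le_exp (mul_nonneg hρ ht.1)
    calc _ = Kc φ * A₀ * 1 + (2 * Kc φ ^ 4 * (nlC φ F L M α β * (1 + A) * B) * wt θ ρ T) *
          Real.exp (ρ * t) := by ring
      _ ≤ Kc φ * A₀ * Real.exp (ρ * t) + 1 * Real.exp (ρ * t) := by gcongr
      _ = _ := by rw [hA]; ring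
  · have hsT : s ∈ Icc 0 T := ⟨hs, hst.trans htT⟩
    have hts := sub_nonneg.2 hst
    have htsT : t - s ≤ T := by linarith
    have h1 := hD.hasBound_increment hK0 hGf.bound hθ0 hθ1 hs hst htT
    rw [show β + 2 * θ = α + 1 by rw [hθ]; ring] at h1
    have h2 := hD.hasBound (ρ := 0) hK0 (by simpa using hGf.bound) hθ0' hθ1' hsT
    rw [show β + 2 * θ' = α + 1 + 2 * ε by rw [hθ']; ring, zero_mul, Real.exp_zero, mul_one] at h2
    have h3 := ((hu₀.heat hA₀ hs).add h2).heat_sub (by positivity) hts (by linarith) (by linarith)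
    rw [show 2 * ε / 2 = ε by ring] at h3
    -- The new forcing on `[s, t]`, plus the semigroup minus the identity acting on the image at
    -- time `s`, which has `2ε` derivatives to spare.
    have h4 : heat t u₀ + D t - (heat s u₀ + D s) = (D t - heat (t - s) (D s)) +
        (heat (t - s) (heat s u₀ + D s) - (heat s u₀ + D s)) := by
      rw [heat_map_add, heat_heat hs hts, add_sub_cancel]
      abel
    rw [h4]
    refine (h1.add h3).mono ?_
    rw [add_mul]
    refine add_le_add ?_ le_rfl
    have h5 : t - s ≤ T ^ (1 - ε) * (t - s) ^ ε := by
      have := rpow_le_mul_rpow hts htsT hε.le (p := 1) (by linarith)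
      rwa [Real.rpow_one] at this
    have h6 := rpow_le_mul_rpow hts htsT hε.le hεθ
    calc _ ≤ 2 * Kc φ ^ 4 * K * (T ^ (1 - ε) * (t - s) ^ ε +
          T ^ (1 - θ - ε) * (t - s) ^ ε / (1 - θ)) := by gcongr
      _ = _ := by rw [hC₂]; ring
  · rw [← (hD t ht ψ).2]
    rfl

theorem eq_of_hasBound {γ C : ℝ} (hγ : 0 < γ) (hC : 0 ≤ C) {f g : 𝓢'(Rd d, ℂ)}
    (h : ∀ n : ℕ, HasBound φ γ (C * (1 / 2) ^ n) (f - g)) : f = g := by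
  ext ψ
  rw [← sub_eq_zero, ← norm_le_zero_iff]
  have h1 : Tendsto (fun n : ℕ => 3 * geo γ * Kc φ * (C * (1 / 2 : ℝ) ^ n) * l1 ψ) atTop (𝓝 0) := by
    have := ((((tendsto_pow_atTop_nhds_zero_of_lt_one (r := (1 / 2 : ℝ)) (by norm_num)
      (by norm_num)).const_mul C).const_mul (3 * geo γ * Kc φ)).mul_const (l1 ψ))
    simpa using this
  exact ge_of_tendsto' h1 fun n => (h n).apply_le_l1 (by positivity) hγ ψ

theorem IsMildMap.congr (h : IsMildMap φ F T b u₀ u u') (hw : EqOn u' w (Icc 0 T)) :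
    IsMildMap φ F T b u₀ u w := by
  obtain ⟨G, hG, hD⟩ := h
  exact ⟨G, hG, fun t ht ψ => ⟨(hD t ht ψ).1, by rw [← hw ht, (hD t ht ψ).2]⟩⟩

/-- Both functions are fixed points of the same map in a common ball. Iterating the contraction
halves the weighted bound of their difference indefinitely. -/
theorem IsSetting.unique (S : IsSetting φ F L M α β T B b) (hA : 0 ≤ A)
    (hu : IsBdd φ (α + 1) T A u) (hw : IsBdd φ (α + 1) T A w)
    (hmu : IsMildMap φ F T b u₀ u u) (hmw : IsMildMap φ F T b u₀ w w) : EqOn u w (Icc 0 T) := by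
  obtain ⟨σ, hσ, hc⟩ := S.contraction (u₀ := u₀) hA
  have h1 : ∀ n : ℕ, ∀ t ∈ Icc 0 T,
      HasBound φ (α + 1) (2 * A * (1 / 2) ^ n * Real.exp (σ * t)) (u t - w t) := by
    intro n
    induction n with
    | zero =>
      intro t ht
      refine ((hu t ht).2.sub (hw t ht).2).mono ?_
      have h2 : 1 ≤ Real.exp (σ * t) := Real.one_le_exp (mul_nonneg hσ ht.1)
      nlinarith
    | succ n ih =>
      intro t ht
      refine (hc (by positivity) hu hw hmu hmw ih t ht).mono (le_of_eq ?_)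
      rw [pow_succ]
      ring
  intro t ht
  refine eq_of_hasBound (γ := α + 1) (C := 2 * A * Real.exp (σ * t)) (by linarith [S.pos])
    (by positivity) fun n => (h1 n t ht).mono (le_of_eq (by ring))

/-- Picard iteration. -/
theorem IsSetting.exists_fixed (S : IsSetting φ F L M α β T B b) {ρ C ε : ℝ} (hA : 0 ≤ A)
    (hρ : 0 ≤ ρ) (hC : 0 ≤ C)
    (hstep : ∀ u, IsAdm φ (α + 1) T A ρ C ε u →
      ∃ u', IsAdm φ (α + 1) T A ρ C ε u' ∧ IsMildMap φ F T b u₀ u u') :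
    ∃ u, IsAdm φ (α + 1) T A ρ C ε u ∧ IsMildMap φ F T b u₀ u u := by
  have hα : 0 < α + 1 := by linarith [S.pos]
  have hKc := Kc_nonneg φ
  have hge := geo_nonneg (α + 1)
  choose! Φ hΦ hΦm using hstep
  set A₁ := A * Real.exp (ρ * T) with hA₁
  have hA₁0 : 0 ≤ A₁ := by positivity
  obtain ⟨σ, hσ, hc⟩ := S.contraction (u₀ := u₀) hA₁0
  set x : ℕ → ℝ → 𝓢'(Rd d, ℂ) := fun n => Φ^[n] 0 with hx
  have hxs : ∀ n, x (n + 1) = Φ (x n) := fun n => Function.iterate_succ_apply' Φ n 0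
  have hzero : ∀ c : ℝ, 0 ≤ c → HasBound φ (α + 1) c 0 := fun c hc j ψ => by
    have h0 : (0 : 𝓢'(Rd d, ℂ)) (blk φ j ψ) = 0 := rfl
    have := l1_nonneg ψ
    rw [h0, norm_zero]
    positivity
  have hadm : ∀ n, IsAdm φ (α + 1) T A ρ C ε (x n) := by
    intro n
    induction n with
    | zero =>
      refine ⟨fun t ht ψ hψ => rfl, fun t ht => hzero _ (by positivity), fun s t hs hst ht => ?_⟩
      have := sub_nonneg.2 hst
      have h0 : x 0 t - x 0 s = 0 := sub_self 0
      rw [h0]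
      exact hzero _ (by positivity)
    | succ n ih => rw [hxs]; exact hΦ _ ih
  have hbdd := fun n => (hadm n).isBdd hA hρ
  have hmild : ∀ n, IsMildMap φ F T b u₀ (x n) (x (n + 1)) := fun n => by
    rw [hxs]; exact hΦm _ (hadm n)
  have hdiff : ∀ n, ∀ t ∈ Icc 0 T,
      HasBound φ (α + 1) (2 * A₁ * (1 / 2) ^ n * Real.exp (σ * t)) (x (n + 1) t - x n t) := by
    intro n
    induction n with
    | zero =>
      intro t ht
      refine ((hbdd 1 t ht).2.sub (hbdd 0 t ht).2).mono ?_
      have h2 : 1 ≤ Real.exp (σ * t) := Real.one_le_exp (mul_nonneg hσ ht.1)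
      nlinarith
    | succ n ih =>
      intro t ht
      refine (hc (by positivity) (hbdd _) (hbdd _) (hmild _) (hmild _) ih t ht).mono (le_of_eq ?_)
      rw [pow_succ]
      ring
  -- The exact geometric sum is kept, so that the induction on `m` closes with equality.
  have htel : ∀ n m, ∀ t ∈ Icc 0 T, HasBound φ (α + 1)
      (4 * A₁ * (1 / 2) ^ n * (1 - (1 / 2) ^ m) * Real.exp (σ * t)) (x (m + n) t - x n t) := by
    intro n m t ht
    induction m with
    | zero => simpa using hzero 0 le_rfl
    | succ m ih =>
      have h1 := (hdiff (m + n) t ht).add ih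
      rw [sub_add_sub_cancel, add_right_comm] at h1
      refine h1.mono (le_of_eq ?_)
      rw [pow_succ, pow_add]
      ring
  have hlim : ∀ t, ∃ E : 𝓢'(Rd d, ℂ), t ∈ Icc 0 T →
      ∀ ψ, Tendsto (fun n => x n t ψ) atTop (𝓝 (E ψ)) := by
    intro t
    by_cases ht : t ∈ Icc 0 T
    · have h1 : ∀ ψ : 𝓢(Rd d, ℂ), ∃ l : ℂ, Tendsto (fun n => x n t ψ) atTop (𝓝 l) := fun ψ => by
        refine cauchySeq_tendsto_of_complete (cauchySeq_of_le_geometric (1 / 2)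
          (3 * geo (α + 1) * Kc φ * (2 * A₁ * Real.exp (σ * t)) * l1 ψ) (by norm_num) fun n => ?_)
        rw [dist_comm, dist_eq_norm]
        refine ((hdiff n t ht).apply_le_l1 (by positivity) hα ψ).trans (le_of_eq ?_)
        ring
      choose l hl using h1
      obtain ⟨E, hE⟩ := exists_limit_distribution
        (fun n ψ => (hbdd n t ht).2.apply_le_w11 hA₁0 (by linarith) ψ) hl
      exact ⟨E, fun _ ψ => by rw [hE]; exact hl ψ⟩
    · exact ⟨0, fun h => (ht h).elim⟩
  choose U hU using hlim
  -- The bounds defining the set involve one test function at a time, so they survive pointwise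
  -- limits.
  have hUadm : IsAdm φ (α + 1) T A ρ C ε U := by
    refine ⟨fun t ht => isReal_of_tendsto (fun n => (hadm n).isReal t ht) (hU t ht),
      fun t ht => hasBound_of_tendsto (fun n => (hadm n).bound t ht) (hU t ht),
      fun s t hs hst ht => hasBound_of_tendsto (fun n => (hadm n).holder s t hs hst ht) fun ψ => ?_⟩
    exact (hU t ⟨hs.trans hst, ht⟩ ψ).sub (hU s ⟨hs, hst.trans ht⟩ ψ)
  have hUx : ∀ n, ∀ t ∈ Icc 0 T,
      HasBound φ (α + 1) (4 * A₁ * (1 / 2) ^ n * Real.exp (σ * t)) (U t - x n t) := by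
    intro n t ht
    refine hasBound_of_tendsto (D := fun m => x (m + n) t - x n t) (fun m => (htel n m t ht).mono ?_)
      fun ψ => ?_
    · have h1 : 0 ≤ (1 / 2 : ℝ) ^ m := by positivity
      have h2 : 0 ≤ 4 * A₁ * (1 / 2) ^ n * Real.exp (σ * t) := by positivity
      nlinarith
    · exact (((hU t ht ψ).comp (tendsto_add_atTop_nat n)).sub_const _)
  refine ⟨U, hUadm, (hΦm U hUadm).congr fun t ht => ?_⟩
  refine eq_of_hasBound (φ := φ) (γ := α + 1) (C := 4 * A₁ * Real.exp (σ * t)) hα (by positivity)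
    fun n => ?_
  -- Both `U` and its image under `Φ` are compared with `x (n + 1)`, and the two bounds vanish as `n
  -- → ∞`. Equality is obtained on `[0,T]` only, since `Φ` is uncontrolled outside.
  have h1 := hc (by positivity) (hUadm.isBdd hA hρ) (hbdd n) (hΦm U hUadm) (hmild n) (hUx n) t ht
  have h2 := h1.sub (hUx (n + 1) t ht)
  rw [sub_sub_sub_cancel_right] at h2
  refine h2.mono (le_of_eq ?_)
  rw [pow_succ]
  ring

end setting

/-! ### Passage to the function spaces of the theorem -/

/-- Compactness of `[0,T]`: continuity gives the bound `1 + A` near each time. Thus an arbitrary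
mild solution lies in some ball, where uniqueness applies. -/
theorem MemContinuous.exists_isBdd {γ T : ℝ} {u : ℝ → 𝓢'(Rd d, ℂ)} (h : MemContinuous φ γ T u) :
    ∃ A, 0 ≤ A ∧ IsBdd φ γ T A u := by
  obtain ⟨A, hA, hAu⟩ : ∃ A, 0 ≤ A ∧ ∀ t ∈ Icc 0 T, HasBound φ γ A (u t) := by
    refine isCompact_Icc.induction_on (p := fun S => ∃ A, 0 ≤ A ∧ ∀ t ∈ S, HasBound φ γ A (u t))
      ⟨0, le_rfl, by simp⟩ (fun S S' hS ⟨A, hA, hAS⟩ => ⟨A, hA, fun t ht => hAS t (hS ht)⟩)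
      (fun S S' ⟨A, hA, hAS⟩ ⟨A', hA', hAS'⟩ => ⟨max A A', le_max_of_le_left hA, fun t ht => ?_⟩)
      fun t ht => ?_
    · rcases ht with ht | ht
      · exact (hAS t ht).mono (le_max_left _ _)
      · exact (hAS' t ht).mono (le_max_right _ _)
    · obtain ⟨A, hA, hAt⟩ := exists_hasBound (h.1 t ht).2
      refine ⟨_, (h.2 t ht).eventually (ge_mem_nhds one_pos), 1 + A, by positivity, fun s hs => ?_⟩
      have h1 : HasBound φ γ 1 (u s - u t) :=
        (besovNorm_le_iff zero_le_one).1 (by simpa using hs)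
      simpa using h1.add hAt
  exact ⟨A, hA, fun t ht => ⟨(h.1 t ht).1, hAu t ht⟩⟩

section adm
variable {γ T A ρ C ε : ℝ} {u : ℝ → 𝓢'(Rd d, ℂ)}

theorem IsAdm.memBesov (h : IsAdm φ γ T A ρ C ε u) (hA : 0 ≤ A) {t : ℝ} (ht : t ∈ Icc 0 T) :
    MemBesov φ γ (u t) :=
  ⟨h.isReal t ht, (h.bound t ht).besovNorm_lt_top (by positivity)⟩

theorem IsAdm.memTimeHolder (h : IsAdm φ γ T A ρ C ε u) (hA : 0 ≤ A) (hρ : 0 ≤ ρ) (hC : 0 ≤ C) :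
    MemTimeHolder φ ε γ T u := by
  refine ⟨fun t ht => h.memBesov hA ht, ?_⟩
  have h1 : (⨆ t ∈ Icc 0 T, besovNorm φ γ (u t)) ≤ ENNReal.ofReal (A * Real.exp (ρ * T)) :=
    iSup₂_le fun t ht => (besovNorm_le_iff (by positivity)).2 (h.isBdd hA hρ t ht).2
  have h2 : (⨆ (s ∈ Icc 0 T) (t ∈ Icc 0 T) (_ : s < t),
      besovNorm φ γ (u t - u s) / ENNReal.ofReal ((t - s) ^ ε)) ≤ ENNReal.ofReal C := by
    refine iSup₂_le fun s hs => iSup₂_le fun t ht => iSup_le fun hst => ?_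
    have hp : 0 < (t - s) ^ ε := Real.rpow_pos_of_pos (sub_pos.2 hst) _
    refine ENNReal.div_le_of_le_mul ?_
    rw [← ENNReal.ofReal_mul hC]
    exact (besovNorm_le_iff (by positivity)).2 (h.holder s t hs.1 hst.le ht.2)
  exact (add_le_add h1 h2).trans_lt (ENNReal.add_lt_top.2 ⟨ENNReal.ofReal_lt_top,
    ENNReal.ofReal_lt_top⟩)

theorem IsAdm.memContinuous (h : IsAdm φ γ T A ρ C ε u) (hA : 0 ≤ A) (hC : 0 ≤ C) (hε : 0 < ε) :
    MemContinuous φ γ T u := by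
  refine ⟨fun t ht => h.memBesov hA ht, fun t ht => ?_⟩
  have h1 : Tendsto (fun s : ℝ => ENNReal.ofReal (C * |s - t| ^ ε)) (𝓝[Icc 0 T] t) (𝓝 0) := by
    have : ContinuousAt (fun s : ℝ => C * |s - t| ^ ε) t :=
      ContinuousAt.const_mul (ContinuousAt.rpow_const (by fun_prop) (Or.inr hε.le)) _
    have h6 := ENNReal.tendsto_ofReal this.tendsto
    simp only [sub_self, abs_zero, Real.zero_rpow hε.ne', mul_zero, ENNReal.ofReal_zero] at h6
    exact h6.mono_left nhdsWithin_le_nhds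
  refine tendsto_of_tendsto_of_tendsto_of_le_of_le' tendsto_const_nhds h1
    (.of_forall fun _ => zero_le) ?_
  filter_upwards [self_mem_nhdsWithin] with s hs
  rw [besovNorm_le_iff (by positivity)]
  rcases le_total t s with hts | hts
  · rw [abs_of_nonneg (sub_nonneg.2 hts)]
    exact h.holder t s ht.1 hts hs.2
  · rw [abs_sub_comm, abs_of_nonneg (sub_nonneg.2 hts), ← neg_sub (u t)]
    exact (h.holder s t hs.1 hts ht.2).neg

end adm

theorem isSetting_of_memLinfty {F : Rd d → ℝ} {L M α β T : ℝ} {b : ℝ → 𝓢'(Rd d, ℂ)}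
    (hF : IsLip F L M) (hα₀ : 0 < α) (hα₁ : α < 1) (hβ : β < 0) (hαβ : max (-α) (α - 1) < β)
    (hT : 0 < T) (hb : MemLinfty φ β T b) : ∃ B, IsSetting φ F L M α β T B b := by
  obtain ⟨hm, hr, C, hC⟩ := hb
  have h1 := (le_max_left _ _).trans_lt hαβ
  exact ⟨C, hF, hα₀, hα₁, hβ, by linarith, (le_max_right _ _).trans_lt hαβ, hT, C.coe_nonneg, hm, by
    filter_upwards [hr, hC] with s hs hsC
    exact ⟨hs.1, (besovNorm_le_iff C.coe_nonneg).1 (by rwa [ENNReal.ofReal_coe_nnreal])⟩⟩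

end SingularPDE

end

open SingularPDE
theorem mainTheorem3 (d : ℕ) (φ : DyadicCutoff d) (F : Rd d → ℝ)
    (α β ε ν T : ℝ) (b : ℝ → 𝓢'(Rd d, ℂ)) (u₀ : 𝓢'(Rd d, ℂ))
    (hF : ContDiff ℝ 1 F)
    (hF' : ∃ L : ℝ≥0, ∀ i : Fin d,
      LipschitzWith L (fun x => fderiv ℝ F x (EuclideanSpace.single i (1 : ℝ))))
    (hFLip : ∃ L : ℝ≥0, LipschitzWith L F)
    (hα₀ : 0 < α) (hα₁ : α < 1) (hβ : β < 0) (hαβ : max (-α) (α - 1) < β)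
    (hT : 0 < T) (hb : MemLinfty φ β T b)
    (hε : 0 < ε) (hε' : α - 1 - β + 2 * ε < 0)
    (hν : 0 < ν) (hu₀ : MemBesov φ (α + 1 + 2 * ε + ν) u₀) :
    ∃ u : ℝ → 𝓢'(Rd d, ℂ),
      MemTimeHolder φ ε (α + 1) T u ∧
      IsMildSolution φ F (α + 1) T b u₀ u ∧
      ∀ w : ℝ → 𝓢'(Rd d, ℂ),
        IsMildSolution φ F (α + 1) T b u₀ w → EqOn w u (Icc 0 T) := by
  obtain ⟨M, hM⟩ := hF'
  obtain ⟨L, hL⟩ := hFLip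
  obtain ⟨B, S⟩ := isSetting_of_memLinfty (isLip_of_partial hF hM hL) hα₀ hα₁ hβ hαβ hT hb
  obtain ⟨A₀, hA₀, hu₀A⟩ := exists_hasBound hu₀.2
  obtain ⟨A, ρ, C, hA, hρ, hC, hstep⟩ := S.exists_step hε hε' hA₀ hu₀.1
    (hu₀A.mono_exponent hA₀ (by linarith))
  obtain ⟨u, hu, hmu⟩ := S.exists_fixed hA hρ hC hstep
  refine ⟨u, hu.memTimeHolder hA hρ hC, ⟨hu.memContinuous hA hC hε, hmu⟩, fun w hw => ?_⟩
  obtain ⟨A', hA', hwA⟩ := hw.1.exists_isBdd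
  -- A radius common to both solutions; uniqueness holds in balls of every size, not only in the one
  -- used for existence.
  refine S.unique (A := max A' (A * Real.exp (ρ * T))) (le_max_of_le_left hA')
    (fun t ht => ⟨(hwA t ht).1, (hwA t ht).2.mono (le_max_left _ _)⟩)
    (fun t ht => ⟨hu.isReal t ht, (hu.isBdd hA hρ t ht).2.mono (le_max_right _ _)⟩) hw.2 hmu
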